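/- Let $T(s,t,u)$ be the Tornheim double zeta function: the function that is holomorphic in $(s,t,u)\in\mathbb C^3$ off the hyperplanes $s+u\in\mathbb Z_{\le 1}$, $t+u\in\mathbb Z_{\le 1}$, $s+t+u=2$, and equal to the absolutely convergent series $\sum_{m,n\ge 1} m^{-s}n^{-t}(m+n)^{-u}$ when $\Re(s+u)>1$, $\Re(t+u)>1$, $\Re(s+t+u)>2$ (this continuation exists and is unique). Put \[ S_1(s,t,u)=(1+e^{-\pi i(s+t+u)})T(s,t,u)+(e^{-\pi i s}+e^{-\pi i(u+t)})T(u,s,t)+(e^{-\pi i t}+e^{-\pi i(u+s)})T(t,u,s), \] \[ S_2(s,t,u)=(e^{-\pi i u}+e^{-\pi i(s+t)})T(s,t,u)+(e^{-\pi i t}+e^{-\pi i(u+s)})T(u,s,t)+(e^{-\pi i s}+e^{-\pi i(t+u)})T(t,u,s), \] as meromorphic functions, $S_1$ being extended holomorphically across its removable singularities, and \[ G(s,t,u)=\frac{e^{-\pi i(s+t+u)/2}(2\pi)^{s+t+u}}{\Gamma(s)\Gamma(t)\Gamma(u)},\qquad \eta_k^{\pm}(s)=(\pm2)^{-k}\binom{k-s}{k}\zeta(k+1-s),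 \] where for $k\ge1$ the removable singularity of $\eta_k^\pm$ at $s=k$ is filled in by the limit. Let $\kappa_{l,m,n}=1$ if $l+m+n$ is even and $\kappa_{l,m,n}=0$ otherwise. (1) The function $S_1$ is holomorphic on the set where $s+t\notin\mathbb Z_{\le1}$ and unbounded near every other point, and on this set \[ S_1(s,t,u)=G(s,t,u)\Bigl\{\sum_{l,m,n\ge0}\frac{\kappa_{l,m,n}\eta_l^+(s)\eta_m^+(t)\eta_n^-(u)}{l+m+n+1}+\sum_{n\ge0}\frac{2^{1-s-t}\eta_n^+(u)}{s+t+n-1} +\sum_{m,n\ge0}\frac{\eta_m^-(t)\eta_n^+(u)}{2^s(s+m+n)}+\sum_{l,n\ge0}\frac{\eta_l^-(s)\eta_n^+(u)}{2^t(t+l+n)}+\sum_{l,m\ge0}\frac{\eta_l^+(s)\eta_m^+(t)}{2^u(u+l+m)}\Bigr\}. \] (2) The function $S_2$ is holomorphic on the set where $s+t,\ t+u,\ u+s\notin\mathbb Z_{\le1}$ and $s+t+u\ne2$, and unbounded near every other point, and on this set \[ S_2(s,t,u)=G(s,t,u)\Bigl\{\frac{2^{2-s-t-u}}{s+t+u-2}+\sum_{l,m,n\ge0}\frac{\kappa_{l,m,n}\eta_l^+(s)\eta_m^+(t)\eta_n^+(u)}{l+m+n+1}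 +\sum_{l,m\ge0}\frac{\eta_l^-(s)\eta_m^-(t)}{2^u(u+l+m)}+\sum_{m,n\ge0}\frac{\eta_m^-(t)\eta_n^-(u)}{2^s(s+m+n)}+\sum_{n,l\ge0}\frac{\eta_n^-(u)\eta_l^-(s)}{2^t(t+n+l)} \] \[ +\sum_{l\ge0}\frac{2^{1-t-u}\eta_l^-(s)}{t+u+l-1}+\sum_{m\ge0}\frac{2^{1-u-s}\eta_m^-(t)}{u+s+m-1}+\sum_{n\ge0}\frac{2^{1-s-t}\eta_n^-(u)}{s+t+n-1}\Bigr\}. \] If none of $s,t,u$ is a non-positive integer, every term in the braces is finite and the identities hold as written. At the other points of the two sets, $G$ is multiplied into the series term by term, each product $G\cdot(\text{term})$ being replaced by its holomorphic extension to the respective set, which exists. All the series converge absolutely and rapidly: at every point of the respective set and for every $r>1/2$, the products $G\cdot(\text{term})$ are bounded by a constant times $r^{d}$, where $d$ is the sum of the summation indices. -/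

import Mathlib

open scoped Topology

noncomputable section

namespace Tornheim

/-- `z` is an integer that is at most `1`. -/
def IsIntLeOne (z : ℂ) : Prop := ∃ n : ℤ, n ≤ 1 ∧ z = n

/-! ### The Tornheim double zeta function -/

/-- The term `1 / (m ^ s n ^ t (m + n) ^ u)` with `m = i.1 + 1` and `n = i.2 + 1`. -/
def seriesTerm (s t u : ℂ) (i : ℕ × ℕ) : ℂ :=
  1 / (((i.1 + 1 : ℕ) : ℂ) ^ s * ((i.2 + 1 : ℕ) : ℂ) ^ t
    * (((i.1 + 1) + (i.2 + 1) : ℕ) : ℂ) ^ u)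

/-- The region of absolute convergence of the Tornheim series. -/
def convergenceRegion : Set (ℂ × ℂ × ℂ) :=
  {(s, t, u) | 1 < (s + u).re ∧ 1 < (t + u).re ∧ 2 < (s + t + u).re}

/-- The complement of the singular hyperplanes of the Tornheim function. -/
def domT : Set (ℂ × ℂ × ℂ) :=
  {(s, t, u) | ¬ IsIntLeOne (s + u) ∧ ¬ IsIntLeOne (t + u) ∧ s + t + u ≠ 2}

/-- `F` is holomorphic off the singular hyperplanes and is the sum of the Tornheim series in its
region of absolute convergence. As `domT` is open and connected, this fixes `F` on `domT`. -/
structure IsContinuation (F : ℂ × ℂ × ℂ → ℂ) : Prop where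
  differentiableOn : DifferentiableOn ℂ F domT
  hasSum : ∀ s t u : ℂ, (s, t, u) ∈ convergenceRegion → HasSum (seriesTerm s t u) (F (s, t, u))

/-- The Tornheim double zeta function: the continuation of the Tornheim series to `domT`
(the values outside `domT` are irrelevant). -/
def T (s t u : ℂ) : ℂ := Classical.epsilon IsContinuation (s, t, u)

/-! ### The symmetric Tornheim functions -/

/-- `e ^ (-π i z)` -/
def e (z : ℂ) : ℂ := Complex.exp (-(Real.pi * Complex.I * z))

/-- The domain `s + t ∉ ℤ_{≤ 1}`. -/
def D₁ : Set (ℂ × ℂ × ℂ) := {(s, t, _u) | ¬ IsIntLeOne (s + t)}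

/-- The domain `s + t, t + u, u + s ∉ ℤ_{≤ 1}`, `s + t + u ≠ 2`, on which each of
`T s t u`, `T u s t`, `T t u s` is holomorphic. -/
def D₂ : Set (ℂ × ℂ × ℂ) :=
  {(s, t, u) | ¬ IsIntLeOne (s + t) ∧ ¬ IsIntLeOne (t + u) ∧ ¬ IsIntLeOne (u + s)
    ∧ s + t + u ≠ 2}

/-- The linear combination of Tornheim functions that defines `S₁`; it makes sense on `D₂`. -/
def comb₁ (s t u : ℂ) : ℂ :=
  (1 + e (s + t + u)) * T s t u + (e s + e (u + t)) * T u s t + (e t + e (u + s)) * T t u s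

/-- `S₁`: the extension by continuity of `comb₁`, from `D₂` across the hyperplanes where the
singularities of the individual summands cancel. -/
def S₁ (s t u : ℂ) : ℂ := extendFrom D₂ (fun (s, t, u) => comb₁ s t u) (s, t, u)

/-- `S₂`, on its domain `D₂`. -/
def S₂ (s t u : ℂ) : ℂ :=
  (e u + e (s + t)) * T s t u + (e t + e (u + s)) * T u s t + (e s + e (t + u)) * T t u s

/-! ### The ingredients of the expansions -/

/-- `G(s,t,u) = e^{-π i (s+t+u)/2} (2π)^{s+t+u} / (Γ(s) Γ(t) Γ(u))`, an entire function
(in Mathlib `Γ` is `0` at its poles, so that the quotient is `0` there, as it should be). -/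
def G (s t u : ℂ) : ℂ :=
  Complex.exp (-(Real.pi * Complex.I * (s + t + u) / 2)) * (2 * Real.pi : ℂ) ^ (s + t + u)
    / (Complex.Gamma s * Complex.Gamma t * Complex.Gamma u)

/-- `c ^ (-k) * binom(k - s, k) * ζ(k + 1 - s)`. For `k ≥ 1` the singularity at `s = k` is
removable and the value there is the limit; `k = 0`, `s = 0` is a pole. -/
def eta (c : ℂ) (k : ℕ) : ℂ → ℂ :=
  extendFrom {(k : ℂ)}ᶜ fun s => c ^ (-(k : ℤ)) * Ring.choose ((k : ℂ) - s) k
    * riemannZeta (k + 1 - s)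

/-- `η_k^+` -/
def etaP (k : ℕ) (s : ℂ) : ℂ := eta 2 k s

/-- `η_k^-` -/
def etaM (k : ℕ) (s : ℂ) : ℂ := eta (-2) k s

/-- The parity weight `κ_{l,m,n}`. -/
def kappa (l m n : ℕ) : ℂ := if Even (l + m + n) then 1 else 0

/-- General term of the triple series. -/
def triple (a b c : ℕ → ℂ → ℂ) (s t u : ℂ) (i : ℕ × ℕ × ℕ) : ℂ :=
  kappa i.1 i.2.1 i.2.2 * a i.1 s * b i.2.1 t * c i.2.2 u / (i.1 + i.2.1 + i.2.2 + 1)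

/-- General term of a double series. -/
def double (a b : ℕ → ℂ → ℂ) (s t u : ℂ) (i : ℕ × ℕ) : ℂ :=
  a i.1 t * b i.2 u / ((2 : ℂ) ^ s * (s + i.1 + i.2))

/-- General term of a single series. -/
def single (a : ℕ → ℂ → ℂ) (s t u : ℂ) (n : ℕ) : ℂ :=
  (2 : ℂ) ^ (1 - s - t) * a n u / (s + t + n - 1)

/-! ### Points where a factor of a term has a pole that is cancelled by a zero of `G` -/

/-- The points with `s, t, u ∉ ℤ_{≤ 0}`; here `G` has no zeros, and a term of one of the series
has no pole other than the singularities that the domains `D₁`, `D₂` exclude. -/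
def regularPoints : Set (ℂ × ℂ × ℂ) :=
  {(s, t, u) | ∀ n : ℕ, s ≠ -(n : ℂ) ∧ t ≠ -(n : ℂ) ∧ u ≠ -(n : ℂ)}

/-- The product `G(s,t,u) * a(s,t,u)`, extended by continuity from the regular points. -/
def regG (a : ℂ → ℂ → ℂ → ℂ) (s t u : ℂ) : ℂ :=
  extendFrom regularPoints (fun (s, t, u) => G s t u * a s t u) (s, t, u)

/-- The series `∑ i, G * a i` is meaningful and converges rapidly on `D`: each term extends
holomorphically from the regular points to `D`, and at each point of `D` the terms decay
geometrically in the total degree `deg i`, with every ratio `r > 1/2`. -/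
structure RapidOn {ι : Type} (D : Set (ℂ × ℂ × ℂ)) (deg : ι → ℕ) (a : ℂ → ℂ → ℂ → ι → ℂ) :
    Prop where
  holomorphic : ∀ i, DifferentiableOn ℂ
    (fun (s, t, u) => regG (fun s t u => a s t u i) s t u) D
  eq_of_regular : ∀ i s t u, (s, t, u) ∈ D → (s, t, u) ∈ regularPoints →
    regG (fun s t u => a s t u i) s t u = G s t u * a s t u i
  decay : ∀ s t u, (s, t, u) ∈ D → ∀ r : ℝ, 1 / 2 < r → ∃ C : ℝ, ∀ i,
    ‖regG (fun s t u => a s t u i) s t u‖ ≤ C * r ^ deg i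
  summable : ∀ s t u, (s, t, u) ∈ D → Summable fun i => regG (fun s t u => a s t u i) s t u

/-- The total degree of a double index. -/
def deg₂ (i : ℕ × ℕ) : ℕ := i.1 + i.2

/-- The total degree of a triple index. -/
def deg₃ (i : ℕ × ℕ × ℕ) : ℕ := i.1 + i.2.1 + i.2.2

/-- `∑ i, G(s,t,u) * a(s,t,u,i)`, with the terms extended by continuity. -/
def sumG {ι : Type} (a : ℂ → ℂ → ℂ → ι → ℂ) (s t u : ℂ) : ℂ :=
  ∑' i, regG (fun s t u => a s t u i) s t u

/-- Every point outside `D` is a true singularity of `f`: `f` is unbounded near it. -/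
def SingularOff (D : Set (ℂ × ℂ × ℂ)) (f : ℂ → ℂ → ℂ → ℂ) : Prop :=
  ∀ p ∉ D, ∀ U ∈ 𝓝 p, ∀ C : ℝ, ∃ s t u, (s, t, u) ∈ U ∩ D ∧ C < ‖f s t u‖

end Tornheim

end

/-! Write F(s, x) for the periodic zeta function, the sum of e^{2πimx} m^{-s}. Hurwitz's formula
expresses ζ(1 - s, x) / Γ(s) as (2π)^{-s} (e^{-πis/2} F(s, x) + e^{πis/2} F(s, -x)). When all real
parts exceed 1, multiply three such functions with parameters s, t, u and integrate over a period.
By orthogonality of the exponentials only the frequencies with k = m + n survive, and the integral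
becomes a combination of the three Tornheim series. With all arguments equal to x the combination is
S₂ (`gNum_mul_integral_same`); with -x in the factor belonging to u it is S₁
(`gNum_mul_integral_opposite`).

The same integral can be computed from the behaviour at the end points of the period. The interval
is folded onto [0, 1/2]. There ζ(1 - s, x) is x^{s-1} plus a Taylor series in -x, and ζ(1 - s, 1 -
x) is a Taylor series in x, with coefficients binom(k - s, k) ζ(k + 1 - s). These series have radius
of convergence 1, so on [0, 1/2] they converge like 2^{-k}, and termwise integration of the products
gives the stated series (`gNum_mul_integral_opposite_eq_W₁`, `gNum_mul_integral_same_eq_W₂`). The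
parity weight arises by adding the contributions of the two halves.

After multiplication by G all terms are holomorphic on the asserted domains: 1/Γ cancels the pole of
η_0 and the poles 1/(s + l + m). Their sums W₁ and W₂ converge locally uniformly
(`exists_bound_etaGamma`), so the identities persist by the identity theorem, which works on
complements of countably many hyperplanes because every complex line through a point of such a set
meets it in a connected set.

The existence of T also comes from the expansions. Eliminating two of the three Tornheim series from
W₂ and three permuted copies of W₁ leaves a multiple of the third, with factor (e(s)² - 1)(e(t)² -
1)(e(u)² - 1) (`contNum_eq`). This factor, and an auxiliary 1/Γ(s + t - 1), can be divided out:
their zeros are simple, and each of their zero hyperplanes meets the region of absolute convergence,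
which forces the numerator to vanish on the whole hyperplane.

Finally, 1/Γ(s + t - 1) times W₁ or W₂ continues across s + t = 1 - k and reduces there to a single
residue term, nonzero at points arbitrarily near any given one; s + t + u = 2 is treated in the same
way with the factor s + t + u - 2. Hence these singularities are genuine. -/

open scoped Topology

noncomputable section

namespace Tornheim

open Set Filter Metric

/-! ### Holomorphic functions of several variables -/

section SeveralVariables

variable {E : Type*} [NormedAddCommGroup E] [NormedSpace ℂ E]

/-- Cauchy's estimate for the derivative of a holomorphic function of several variables. -/
theorem norm_fderiv_le_of_forall_ball {f : E → ℂ} {p : E} {ρ C : ℝ} (hρ : 0 < ρ)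
    (hf : DifferentiableOn ℂ f (ball p (2 * ρ))) (hC : ∀ q ∈ ball p (2 * ρ), ‖f q‖ ≤ C) :
    ‖fderiv ℂ f p‖ ≤ C / ρ := by
  have hp : p ∈ ball p (2 * ρ) := mem_ball_self (by positivity)
  have hC0 : 0 ≤ C := (norm_nonneg _).trans (hC p hp)
  refine ContinuousLinearMap.opNorm_le_bound _ (by positivity) fun v => ?_
  rcases eq_or_ne v 0 with rfl | hv
  · simp
  have hv0 : 0 < ‖v‖ := norm_pos_iff.2 hv
  have hmem : ∀ z ∈ closedBall (0 : ℂ) (ρ / ‖v‖), p + z • v ∈ ball p (2 * ρ) := by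
    intro z hz
    rw [mem_closedBall_zero_iff, le_div_iff₀ hv0] at hz
    rw [mem_ball, dist_eq_norm, add_sub_cancel_left, norm_smul]
    linarith
  have hd : ∀ z ∈ closedBall (0 : ℂ) (ρ / ‖v‖),
      HasDerivAt (fun z : ℂ => f (p + z • v)) (fderiv ℂ f (p + z • v) v) z := by
    intro z hz
    have h1 : HasFDerivAt f (fderiv ℂ f (p + z • v)) (p + z • v) :=
      ((hf _ (hmem z hz)).differentiableAt (isOpen_ball.mem_nhds (hmem z hz))).hasFDerivAt
    have h2 : HasDerivAt (fun z : ℂ => p + z • v) v z := by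
      simpa using ((hasDerivAt_id z).smul_const v).const_add p
    exact h1.comp_hasDerivAt z h2
  have h0 : (0 : ℂ) ∈ closedBall (0 : ℂ) (ρ / ‖v‖) := mem_closedBall_self (by positivity)
  -- The one-variable Cauchy estimate on the slice in direction v. The radius ρ / ‖v‖ turns the
  -- bound C / (ρ / ‖v‖) into (C / ρ) ‖v‖.
  have h3 := Complex.norm_deriv_le_of_forall_mem_sphere_norm_le (c := 0) (R := ρ / ‖v‖) (C := C)
    (f := fun z : ℂ => f (p + z • v)) (by positivity)
    (DifferentiableOn.diffContOnCl_ball (U := closedBall 0 (ρ / ‖v‖))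
      (fun z hz => (hd z hz).differentiableAt.differentiableWithinAt) subset_rfl)
    (fun z hz => hC _ (hmem z (sphere_subset_closedBall hz)))
  rw [(hd 0 h0).deriv, zero_smul, add_zero] at h3
  calc _ ≤ _ := h3
    _ = _ := by field_simp

/-- A series of holomorphic functions that is locally dominated by convergent series of numbers
is holomorphic. -/
theorem differentiableOn_tsum_of_locally_bounded {ι : Type*} {U : Set E} (hU : IsOpen U)
    {f : ι → E → ℂ} (hf : ∀ i, DifferentiableOn ℂ (f i) U)
    (hb : ∀ p ∈ U, ∃ u : ι → ℝ, Summable u ∧ ∀ᶠ q in 𝓝 p, ∀ i, ‖f i q‖ ≤ u i) :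
    DifferentiableOn ℂ (fun p => ∑' i, f i p) U := by
  intro p hp
  obtain ⟨u, hu, hb⟩ := hb p hp
  obtain ⟨ε, hε, hball⟩ := Metric.eventually_nhds_iff_ball.1 (hb.and (hU.mem_nhds hp))
  -- A ball of radius 2ρ about a point within ρ of p must stay in the ball of radius ε = 3ρ;
  -- Cauchy's estimate then bounds the derivatives by u i / ρ.
  set ρ := ε / 3 with hρ
  have hρ0 : 0 < ρ := by positivity
  have hsub : ∀ q ∈ ball p ρ, ball q (2 * ρ) ⊆ ball p ε := fun q hq => by
    refine ball_subset_ball' ?_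
    have := mem_ball.1 hq
    linarith
  have key := hasFDerivAt_tsum_of_isPreconnected (𝕜 := ℂ) (f := f)
    (f' := fun i q => fderiv ℂ (f i) q) (u := fun i => u i / ρ) (s := ball p ρ)
    (x₀ := p) (x := p) (hu.div_const ρ) isOpen_ball (convex_ball p ρ).isPreconnected
    (fun i q hq => ((hf i q (hball q (hsub q hq (mem_ball_self (by positivity)))).2).differentiableAt
      (hU.mem_nhds (hball q (hsub q hq (mem_ball_self (by positivity)))).2)).hasFDerivAt)
    (fun i q hq => norm_fderiv_le_of_forall_ball hρ0
      ((hf i).mono fun x hx => (hball x (hsub q hq hx)).2)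
      (fun x hx => (hball x (hsub q hq hx)).1 i))
    (mem_ball_self hρ0)
    (Summable.of_norm_bounded hu fun i => (hball p (mem_ball_self hε)).1 i)
    (mem_ball_self hρ0)
  exact key.differentiableAt.differentiableWithinAt

/-- Identity theorem along a complex line. -/
theorem eq_zero_of_line {D : Set E} (hD : IsOpen D) {f : E → ℂ} (hf : DifferentiableOn ℂ f D)
    {q v : E} (hpre : IsPreconnected {z : ℂ | q + z • v ∈ D}) (hq : q ∈ D) (hv : q + v ∈ D)
    (h0 : ∀ᶠ z : ℂ in 𝓝 0, f (q + z • v) = 0) : f (q + v) = 0 := by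
  have hc : Continuous fun z : ℂ => q + z • v := by fun_prop
  have hopen : IsOpen {z : ℂ | q + z • v ∈ D} := hD.preimage hc
  have hdiff : DifferentiableOn ℂ (fun z : ℂ => f (q + z • v)) {z : ℂ | q + z • v ∈ D} := by
    refine hf.comp (t := D) ?_ (fun z hz => hz)
    exact (by fun_prop : Differentiable ℂ fun z : ℂ => q + z • v).differentiableOn
  have := (hdiff.analyticOnNhd hopen).eqOn_zero_of_preconnected_of_eventuallyEq_zero hpre
    (z₀ := 0) (by simpa using hq) h0 (show (1 : ℂ) ∈ _ by simpa using hv)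
  simpa using this

/-- The set `D` meets every complex line through one of its points in a cocountable set. -/
def LineCocountable (D : Set E) : Prop :=
  ∀ q ∈ D, ∀ v : E, {z : ℂ | q + z • v ∉ D}.Countable

theorem LineCocountable.inter {D D' : Set E} (h : LineCocountable D) (h' : LineCocountable D') :
    LineCocountable (D ∩ D') := fun q hq v =>
  ((h q hq.1 v).union (h' q hq.2 v)).mono fun z hz => by
    simp only [mem_ofPred_eq, mem_inter_iff, not_and_or] at hz
    exact hz

/-- A line through a point off the hyperplane is not contained in it, hence meets it at most once.
-/
theorem lineCocountable_ne (ℓ : E →L[ℂ] ℂ) (c : ℂ) : LineCocountable {p | ℓ p ≠ c} := by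
  intro q hq v
  refine Set.Subsingleton.countable fun z hz w hw => ?_
  simp only [mem_ofPred_eq, ne_eq, not_not, map_add, map_smul, smul_eq_mul] at hz hw hq
  by_cases hv : ℓ v = 0
  · simp [hv] at hz; exact absurd hz hq
  · exact mul_right_cancel₀ hv (by linear_combination hz - hw)

theorem LineCocountable.iInter {ι : Type*} [Countable ι] {D : ι → Set E}
    (h : ∀ i, LineCocountable (D i)) : LineCocountable (⋂ i, D i) := fun q hq v =>
  (countable_iUnion fun i => h i q (mem_iInter.1 hq i) v).mono fun z hz => by
    simpa using hz

/-- On the line from q to p the bad parameters are countable, so p is a limit of points of D on this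
line. -/
theorem LineCocountable.dense {D : Set E} (h : LineCocountable D) (hne : D.Nonempty) :
    Dense D := by
  obtain ⟨q, hq⟩ := hne
  intro p
  have h1 : Dense {z : ℂ | q + z • (p - q) ∈ D} := by
    have := (h q hq (p - q)).dense_compl ℂ
    simpa [compl_ofPred] using this
  have hc : Continuous fun z : ℂ => q + z • (p - q) := by fun_prop
  have h2 : (fun z : ℂ => q + z • (p - q)) 1 ∈ closure D :=
    map_mem_closure (f := fun z : ℂ => q + z • (p - q)) hc (h1 1) fun z hz => hz
  simpa using h2

/-- The complement of a countable set in ℂ is path connected, because ℂ has real dimension 2. -/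
theorem LineCocountable.isPreconnected {D : Set E} (h : LineCocountable D) {q : E} (hq : q ∈ D)
    (v : E) : IsPreconnected {z : ℂ | q + z • v ∈ D} := by
  have := ((h q hq v).isPathConnected_compl_of_one_lt_rank (by
    rw [Complex.rank_real_complex]; norm_num)).isConnected.isPreconnected
  simpa [compl_ofPred] using this

/-- Identity theorem on the complement of countably many hyperplanes. -/
theorem LineCocountable.eqOn {D : Set E} (h : LineCocountable D) (hD : IsOpen D) {f g : E → ℂ}
    (hf : DifferentiableOn ℂ f D) (hg : DifferentiableOn ℂ g D) {q : E} (hq : q ∈ D)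
    (hfg : f =ᶠ[𝓝 q] g) : EqOn f g D := by
  intro p hp
  have hc : ContinuousAt (fun z : ℂ => q + z • (p - q)) 0 := by fun_prop
  have h0 : ∀ᶠ z : ℂ in 𝓝 0, (f - g) (q + z • (p - q)) = 0 := by
    have h1 : Tendsto (fun z : ℂ => q + z • (p - q)) (𝓝 0) (𝓝 q) := by
      simpa [ContinuousAt] using hc
    filter_upwards [h1.eventually hfg] with z hz
    simp [hz]
  have := eq_zero_of_line hD (hf.sub hg) (h.isPreconnected hq (p - q)) hq (by simpa using hp) h0
  simpa [sub_eq_zero] using this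

/-- The slice of a convex set by a complex line is convex, hence connected. This version serves the
region of absolute convergence, which is not a complement of hyperplanes. -/
theorem _root_.Convex.eqOn_of_differentiableOn [NormedSpace ℝ E] [IsScalarTower ℝ ℂ E] {D : Set E}
    (h : Convex ℝ D) (hD : IsOpen D)
    {f g : E → ℂ} (hf : DifferentiableOn ℂ f D) (hg : DifferentiableOn ℂ g D) {q : E} (hq : q ∈ D)
    (hfg : f =ᶠ[𝓝 q] g) : EqOn f g D := by
  intro p hp
  have hc : ContinuousAt (fun z : ℂ => q + z • (p - q)) 0 := by fun_prop
  have h0 : ∀ᶠ z : ℂ in 𝓝 0, (f - g) (q + z • (p - q)) = 0 := by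
    have h1 : Tendsto (fun z : ℂ => q + z • (p - q)) (𝓝 0) (𝓝 q) := by
      simpa [ContinuousAt] using hc
    filter_upwards [h1.eventually hfg] with z hz
    simp [hz]
  have hpre : IsPreconnected {z : ℂ | q + z • (p - q) ∈ D} := by
    refine Convex.isPreconnected fun z hz w hw a b ha hb hab => ?_
    have := h hz hw ha hb hab
    simp only [mem_ofPred_eq] at hz hw ⊢
    convert this using 1
    have hq' : q = a • q + b • q := by rw [← add_smul, hab, one_smul]
    rw [add_smul, smul_add, smul_add, smul_assoc, smul_assoc]
    nth_rewrite 1 [hq']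
    abel
  have := eq_zero_of_line hD (hf.sub hg) hpre hq (by simpa using hp) h0
  simpa [sub_eq_zero] using this

/-- Differentiation under the integral sign. The circle is compact, so g is bounded on a closed
neighbourhood of it inside V, and Cauchy's estimate dominates the derivatives. It is used to show
that a function equal to its circle means is holomorphic in all variables jointly. -/
theorem differentiableAt_integral_circleMap {g : ℂ × ℂ × ℂ → ℂ} {V : Set (ℂ × ℂ × ℂ)}
    (hV : IsOpen V) (hg : DifferentiableOn ℂ g V) {p v : ℂ × ℂ × ℂ} {r : ℝ}
    (hr : ∀ z ∈ sphere (0 : ℂ) r, p + z • v ∈ V) (hr0 : 0 ≤ r) :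
    DifferentiableAt ℂ
      (fun q => ∫ θ in (0 : ℝ)..2 * Real.pi, g (q + circleMap 0 r θ • v)) p := by
  set K : Set (ℂ × ℂ × ℂ) := (fun z : ℂ => p + z • v) '' sphere 0 r with hK
  have hKc : IsCompact K := (isCompact_sphere _ _).image (by fun_prop)
  have hKV : K ⊆ V := by rintro _ ⟨z, hz, rfl⟩; exact hr z hz
  obtain ⟨δ, hδ, hδV⟩ := hKc.exists_cthickening_subset_open hV hKV
  obtain ⟨C, hC⟩ := (hKc.cthickening (r := δ)).exists_bound_of_continuousOn
    (hg.continuousOn.mono hδV)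
  set ρ := δ / 3 with hρ
  have hρ0 : 0 < ρ := by positivity
  have hsub : ∀ q ∈ ball p ρ, ∀ θ : ℝ,
      ball (q + circleMap 0 r θ • v) (2 * ρ) ⊆ cthickening δ K := by
    intro q hq θ x hx
    refine mem_cthickening_of_dist_le x (p + circleMap 0 r θ • v) δ K
      ⟨_, circleMap_mem_sphere 0 hr0 θ, rfl⟩ ?_
    have h1 : dist (q + circleMap 0 r θ • v) (p + circleMap 0 r θ • v) = dist q p :=
      dist_add_right _ _ _
    have := dist_triangle x (q + circleMap 0 r θ • v) (p + circleMap 0 r θ • v)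
    rw [h1] at this
    have h2 := mem_ball.1 hq
    have h3 := mem_ball.1 hx
    linarith
  have hmem : ∀ q ∈ ball p ρ, ∀ θ : ℝ, q + circleMap 0 r θ • v ∈ V := fun q hq θ =>
    hδV (hsub q hq θ (mem_ball_self (by positivity)))
  have hcont : ∀ q ∈ ball p ρ, Continuous fun θ : ℝ => g (q + circleMap 0 r θ • v) := by
    intro q hq
    refine continuous_iff_continuousAt.2 fun θ => ?_
    refine ContinuousAt.comp (f := fun θ : ℝ => q + circleMap 0 r θ • v) (g := g)
      (hg.continuousOn.continuousAt (hV.mem_nhds (hmem q hq θ))) ?_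
    exact (continuous_const.add ((continuous_circleMap 0 r).smul continuous_const)).continuousAt
  have key := intervalIntegral.hasFDerivAt_integral_of_dominated_of_fderiv_le (𝕜 := ℂ)
    (μ := MeasureTheory.volume) (a := 0) (b := 2 * Real.pi)
    (F := fun q θ => g (q + circleMap 0 r θ • v))
    (F' := fun q θ => fderiv ℂ g (q + circleMap 0 r θ • v)) (x₀ := p) (s := ball p ρ)
    (bound := fun _ => C / ρ) (ball_mem_nhds p hρ0)
    (by filter_upwards [ball_mem_nhds p hρ0] with q hq
        exact (hcont q hq).aestronglyMeasurable)
    ((hcont p (mem_ball_self hρ0)).intervalIntegrable _ _)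
    (by
      refine Measurable.aestronglyMeasurable ?_
      exact (measurable_fderiv ℂ g).comp
        (continuous_const.add ((continuous_circleMap 0 r).smul continuous_const)).measurable)
    (.of_forall fun θ _ q hq => norm_fderiv_le_of_forall_ball hρ0
      (hg.mono ((hsub q hq θ).trans hδV)) fun x hx => hC x (hsub q hq θ hx))
    intervalIntegrable_const
    (.of_forall fun θ _ q hq => by
      have h1 := ((hg _ (hmem q hq θ)).differentiableAt (hV.mem_nhds (hmem q hq θ))).hasFDerivAt
      exact (hasFDerivAt_comp_add_right (f := g) (circleMap 0 r θ • v)).2 h1)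
  exact key.differentiableAt

/-- A holomorphic function that vanishes on the zero set of `φ ∘ ℓ`, where `ℓ` is linear and `φ` has
only simple zeros, is divisible by `φ ∘ ℓ`. -/
theorem exists_differentiableOn_mul_eq {U : Set (ℂ × ℂ × ℂ)} (hU : IsOpen U)
    {f : ℂ × ℂ × ℂ → ℂ} (hf : DifferentiableOn ℂ f U) (ℓ : ℂ × ℂ × ℂ →L[ℂ] ℂ) {v : ℂ × ℂ × ℂ}
    (hv : ℓ v = 1) {φ : ℂ → ℂ} (hφ : Differentiable ℂ φ)
    (hsimple : ∀ w, φ w = 0 → deriv φ w ≠ 0) (h0 : ∀ p ∈ U, φ (ℓ p) = 0 → f p = 0) :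
    ∃ g, DifferentiableOn ℂ g U ∧ ∀ p ∈ U, φ (ℓ p) * g p = f p := by
  classical
  -- On the zero set the value is prescribed by l'Hôpital's rule along v; as ℓ v = 1, the
  -- denominator φ(ℓ(p + z v)) has derivative φ'(ℓ p) at z = 0.
  set g : ℂ × ℂ × ℂ → ℂ := fun p =>
    if φ (ℓ p) = 0 then deriv (fun z : ℂ => f (p + z • v)) 0 / deriv φ (ℓ p)
    else f p / φ (ℓ p) with hg
  have hφℓ : Continuous fun p => φ (ℓ p) := hφ.continuous.comp ℓ.continuous
  have hoff : ∀ p ∈ U, φ (ℓ p) ≠ 0 → DifferentiableAt ℂ g p := by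
    intro p hp hne
    have h2 : DifferentiableAt ℂ (fun p => φ (ℓ p)) p := (hφ _).comp p ℓ.differentiableAt
    have h1 : DifferentiableAt ℂ (fun p => f p / φ (ℓ p)) p := by
      simp only [div_eq_mul_inv]
      exact ((hf p hp).differentiableAt (hU.mem_nhds hp)).mul (h2.inv hne)
    refine h1.congr_of_eventuallyEq ?_
    filter_upwards [hφℓ.continuousAt.eventually_ne hne] with q hq
    simp [hg, hq]
  have hline : ∀ p, ∀ z : ℂ, HasDerivAt (fun z : ℂ => p + z • v) v z := fun p z => by
    simpa using ((hasDerivAt_id z).smul_const v).const_add p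
  have hslice0 : ∀ p ∈ U, DifferentiableAt ℂ (fun z : ℂ => g (p + z • v)) 0 := by
    intro p hp
    by_cases hp0 : φ (ℓ p) = 0
    swap
    · refine DifferentiableAt.comp (f := fun z : ℂ => p + z • v) (g := g) 0 ?_
        (hline p 0).differentiableAt
      simpa using hoff p hp hp0
    set F : ℂ → ℂ := fun z => f (p + z • v)
    set Φ : ℂ → ℂ := fun z => φ (ℓ p + z)
    have hΦd : Differentiable ℂ Φ := by fun_prop
    have hΦ' : HasDerivAt Φ (deriv φ (ℓ p)) 0 := by
      have : HasDerivAt φ (deriv φ (ℓ p)) (ℓ p + 0) := by simpa using (hφ (ℓ p)).hasDerivAt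
      exact this.comp_const_add (ℓ p) 0
    have hF0 : F 0 = 0 := by simpa [F] using h0 p hp hp0
    have hΦ0 : Φ 0 = 0 := by simpa [Φ] using hp0
    set S : Set ℂ := {z | p + z • v ∈ U}
    have hS : S ∈ 𝓝 (0 : ℂ) :=
      (hU.preimage (by fun_prop : Continuous fun z : ℂ => p + z • v)).mem_nhds (by simpa using hp)
    have hFS : DifferentiableOn ℂ F S :=
      hf.comp (fun z _ => (hline p z).differentiableAt.differentiableWithinAt) fun z hz => hz
    -- Numerator and denominator both vanish at z = 0. Dividing each by z leaves holomorphic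
    -- functions, and the new denominator is nonzero because the zero is simple.
    have hq : DifferentiableAt ℂ (fun z => dslope F 0 z / dslope Φ 0 z) 0 := by
      refine DifferentiableAt.div ?_ ?_ ?_
      · exact ((Complex.differentiableOn_dslope hS).2 hFS).differentiableAt hS
      · exact ((Complex.differentiableOn_dslope univ_mem).2
          hΦd.differentiableOn).differentiableAt univ_mem
      · rw [dslope_same, hΦ'.deriv]
        exact hsimple _ hp0
    refine hq.congr_of_eventuallyEq ?_
    have hne : ∀ᶠ z in 𝓝[≠] (0 : ℂ), Φ z ≠ 0 := by
      simpa [hΦ0] using hΦ'.eventually_ne (c := 0) (hsimple _ hp0)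
    rw [eventually_nhdsWithin_iff] at hne
    filter_upwards [hne] with z hz
    by_cases hz0 : z = 0
    · subst hz0
      simp [hg, hp0, dslope_same, hΦ'.deriv, F]
    · have h2 := hz hz0
      have h3 : φ (ℓ p + z) ≠ 0 := h2
      rw [dslope_of_ne _ hz0, dslope_of_ne _ hz0, slope_def_field, slope_def_field, hF0, hΦ0]
      simp only [hg, map_add, map_smul, hv, smul_eq_mul, mul_one, h3, if_false, F, Φ, sub_zero]
      field_simp
  have hslice : ∀ p, ∀ z : ℂ, p + z • v ∈ U → DifferentiableAt ℂ (fun z : ℂ => g (p + z • v)) z := by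
    intro p z hz
    have h1 := hslice0 _ hz
    have h2 : DifferentiableAt ℂ (fun w : ℂ => w - z) z := by fun_prop
    have h3 : DifferentiableAt ℂ (fun w : ℂ => g (p + z • v + w • v)) (z - z) := by simpa using h1
    refine (DifferentiableAt.comp (f := fun w : ℂ => w - z) z h3 h2).congr_of_eventuallyEq (.of_forall fun w => ?_)
    simp only [Function.comp_apply]
    congr 1
    rw [sub_smul]; abel
  refine ⟨g, fun p hp => ?_, fun p hp => ?_⟩
  · refine DifferentiableAt.differentiableWithinAt ?_
    by_cases hp0 : φ (ℓ p) = 0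
    swap
    · exact hoff p hp hp0
    have hne : ∀ᶠ z in 𝓝[≠] (0 : ℂ), φ (ℓ p + z) ≠ 0 := by
      have : HasDerivAt φ (deriv φ (ℓ p)) (ℓ p + 0) := by simpa using (hφ (ℓ p)).hasDerivAt
      simpa [hp0] using (this.comp_const_add (ℓ p) 0).eventually_ne (c := 0) (hsimple _ hp0)
    rw [eventually_nhdsWithin_iff] at hne
    have hcont : Tendsto (fun x : (ℂ × ℂ × ℂ) × ℂ => x.1 + x.2 • v) (𝓝 p ×ˢ 𝓝 (0 : ℂ)) (𝓝 p) := by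
      rw [← nhds_prod_eq]
      have : Continuous fun x : (ℂ × ℂ × ℂ) × ℂ => x.1 + x.2 • v := by fun_prop
      simpa using this.tendsto (p, 0)
    obtain ⟨P, hP, Q, hQ, hPQ⟩ := eventually_prod_iff.1 (hcont.eventually (hU.mem_nhds hp))
    obtain ⟨ε, hε, hball⟩ := Metric.eventually_nhds_iff_ball.1 (hne.and hQ)
    set r := ε / 2
    have hr : 0 < r := by positivity
    have hcb : ∀ z ∈ closedBall (0 : ℂ) r, z ∈ ball (0 : ℂ) ε :=
      fun z hz => closedBall_subset_ball (half_lt_self hε) hz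
    have hV : IsOpen {q | q ∈ U ∧ φ (ℓ q) ≠ 0} := hU.inter (isOpen_ne_fun hφℓ continuous_const)
    -- A small circle about p in direction v avoids the zero set, so the mean of g over its
    -- translates depends holomorphically on the centre. Along each nearby slice g is already known
    -- to be holomorphic, so this mean equals g at the centre.
    have h1 := differentiableAt_integral_circleMap hV
      (fun q hq => (hoff q hq.1 hq.2).differentiableWithinAt) (p := p) (v := v) (r := r)
      (fun z hz => by
        have hz' := hcb z (sphere_subset_closedBall hz)
        have hz0 : z ≠ 0 := by
          rintro rfl
          simp at hz
          exact hr.ne hz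
        refine ⟨hPQ (hP.self_of_nhds) (hball z hz').2, ?_⟩
        simpa [hv] using (hball z hz').1 hz0) hr.le
    refine (h1.const_smul ((2 * Real.pi)⁻¹ : ℝ)).congr_of_eventuallyEq ?_
    filter_upwards [hP] with q hq
    have h2 : DiffContOnCl ℂ (fun z : ℂ => g (q + z • v)) (ball 0 |r|) := by
      rw [abs_of_pos hr]
      refine DifferentiableOn.diffContOnCl_ball (U := closedBall 0 r) (fun z hz => ?_) subset_rfl
      exact (hslice q z (hPQ hq (hball z (hcb z hz)).2)).differentiableWithinAt
    have h3 := h2.circleAverage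
    rw [Real.circleAverage] at h3
    simpa using h3.symm
  · by_cases hp0 : φ (ℓ p) = 0
    · rw [hp0, zero_mul, h0 p hp hp0]
    · simp only [hg, hp0, if_false]
      field_simp

end SeveralVariables

/-! ### Entire functions built from `ζ` and `1 / Γ` -/

/-- The entire function `w ζ(1 + w)`. -/
def zetaReg : ℂ → ℂ := Function.update (fun w => w * riemannZeta (1 + w)) 0 1

theorem zetaReg_of_ne {w : ℂ} (hw : w ≠ 0) : zetaReg w = w * riemannZeta (1 + w) := by
  simp [zetaReg, hw]

/-- The singularity at 0 is removable, and the prescribed value 1 is the residue of ζ at 1. -/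
theorem differentiable_zetaReg : Differentiable ℂ zetaReg := by
  rw [← differentiableOn_univ, ← Complex.differentiableOn_compl_singleton_and_continuousAt_iff
    (c := 0) univ_mem]
  constructor
  · intro w hw
    have hw0 : w ≠ 0 := by simpa using hw
    have h1 : DifferentiableAt ℂ riemannZeta (1 + w) :=
      differentiableAt_riemannZeta (by simpa using hw0)
    have h2 : DifferentiableAt ℂ (fun w => w * riemannZeta (1 + w)) w :=
      differentiableAt_id.mul (DifferentiableAt.comp (f := fun w : ℂ => 1 + w) w h1 (by fun_prop))
    refine (h2.congr_of_eventuallyEq ?_).differentiableWithinAt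
    filter_upwards [isOpen_ne.mem_nhds hw0] with x hx using zetaReg_of_ne hx
  · refine continuousAt_update_same.2 ?_
    have h : Tendsto (fun w : ℂ => 1 + w) (𝓝[≠] 0) (𝓝[≠] 1) := by
      refine tendsto_nhdsWithin_iff.2 ⟨?_, ?_⟩
      · have : Continuous fun w : ℂ => 1 + w := by fun_prop
        simpa using (this.tendsto 0).mono_left nhdsWithin_le_nhds
      · filter_upwards [self_mem_nhdsWithin] with w hw
        simpa using hw
    simpa [Function.comp_def] using riemannZeta_residue_one.comp h

/-- The function `binom(k - s, k) ζ(k + 1 - s)`, holomorphic except for the pole at `s = 0` if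
`k = 0`. -/
def etaBase : ℕ → ℂ → ℂ
  | 0, s => riemannZeta (1 - s)
  | k + 1, s => (∏ j ∈ Finset.range k, ((j + 1 : ℂ) - s)) / (k + 1).factorial
      * zetaReg ((k + 1 : ℕ) - s)

/-- The entire function `binom(k - s, k) ζ(k + 1 - s) / Γ(s)`. -/
def etaGamma : ℕ → ℂ → ℂ
  | 0, s => -zetaReg (-s) * (Complex.Gamma (s + 1))⁻¹
  | k + 1, s => etaBase (k + 1) s * (Complex.Gamma s)⁻¹

/-- The binomial coefficient is the multichoose number of 1 - s, that is, a rising factorial divided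
by k!. -/
theorem choose_sub_eq_prod (k : ℕ) (s : ℂ) :
    Ring.choose ((k : ℂ) - s) k = (∏ j ∈ Finset.range k, ((j + 1 : ℂ) - s)) / k.factorial := by
  have h := Ring.factorial_nsmul_multichoose_eq_ascPochhammer (1 - s) k
  have h2 : Ring.choose ((k : ℂ) - s) k = Ring.multichoose (1 - s) k := by
    rw [Ring.multichoose_eq]
    congr 1
    ring
  rw [h2, eq_div_iff (by exact_mod_cast k.factorial_ne_zero), mul_comm, ← nsmul_eq_mul, h]
  clear h h2
  induction k with
  | zero => simp
  | succ n ih =>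
    rw [Finset.prod_range_succ, ← ih, ascPochhammer_succ_right, Polynomial.smeval_mul,
      Polynomial.smeval_add, Polynomial.smeval_X, Polynomial.smeval_natCast]
    simp only [pow_one, pow_zero, nsmul_eq_mul, mul_one]
    ring

theorem choose_mul_zeta_eq_etaBase {k : ℕ} {s : ℂ} (hs : s ≠ k) :
    Ring.choose ((k : ℂ) - s) k * riemannZeta (k + 1 - s) = etaBase k s := by
  cases k with
  | zero => simp [etaBase]
  | succ k =>
    have hne : ((k + 1 : ℕ) : ℂ) - s ≠ 0 := sub_ne_zero.2 (Ne.symm hs)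
    rw [choose_sub_eq_prod, etaBase, zetaReg_of_ne hne, Finset.prod_range_succ]
    rw [show (1 : ℂ) + (((k + 1 : ℕ) : ℂ) - s) = ((k + 1 : ℕ) : ℂ) + 1 - s by ring]
    push_cast
    ring

theorem differentiable_etaBase_succ (k : ℕ) : Differentiable ℂ (etaBase (k + 1)) := by
  have := differentiable_zetaReg
  unfold etaBase
  fun_prop

theorem differentiable_etaGamma (k : ℕ) : Differentiable ℂ (etaGamma k) := by
  cases k with
  | zero =>
    have h1 := differentiable_zetaReg
    have h2 : Differentiable ℂ fun s : ℂ => (Complex.Gamma (s + 1))⁻¹ :=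
      Complex.differentiable_one_div_Gamma.comp (by fun_prop : Differentiable ℂ fun s : ℂ => s + 1)
    unfold etaGamma
    fun_prop
  | succ k =>
    exact (differentiable_etaBase_succ k).mul Complex.differentiable_one_div_Gamma

/-- Only k = 0 has content: the pole of ζ(1 - s) at s = 0 is absorbed by 1/Γ(s) = s / Γ(s + 1). -/
theorem etaBase_mul_gamma_inv {k : ℕ} {s : ℂ} (h : s ≠ 0) :
    etaBase k s * (Complex.Gamma s)⁻¹ = etaGamma k s := by
  cases k with
  | zero =>
    rw [etaBase, etaGamma, zetaReg_of_ne (neg_ne_zero.2 h),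
      Complex.one_div_Gamma_eq_self_mul_one_div_Gamma_add_one, ← sub_eq_add_neg]
    ring
  | succ k => rfl

theorem differentiableAt_etaBase {k : ℕ} {s : ℂ} (h : k ≠ 0 ∨ s ≠ 0) :
    DifferentiableAt ℂ (etaBase k) s := by
  cases k with
  | zero =>
    have hs : s ≠ 0 := by simpa using h
    exact DifferentiableAt.comp (f := fun s : ℂ => 1 - s) s
      (differentiableAt_riemannZeta (by simpa using hs)) (by fun_prop)
  | succ k => exact differentiable_etaBase_succ k s

theorem eta_eq {c : ℂ} {k : ℕ} {s : ℂ} (h : k ≠ 0 ∨ s ≠ 0) :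
    eta c k s = c ^ (-(k : ℤ)) * etaBase k s := by
  refine extendFrom_eq (by rw [closure_compl_singleton]; trivial) ?_
  have h1 : Tendsto (fun s => c ^ (-(k : ℤ)) * etaBase k s) (𝓝 s)
      (𝓝 (c ^ (-(k : ℤ)) * etaBase k s)) :=
    (differentiableAt_etaBase h).continuousAt.tendsto.const_mul _
  refine (h1.mono_left nhdsWithin_le_nhds).congr' ?_
  filter_upwards [self_mem_nhdsWithin] with x hx
  rw [← choose_mul_zeta_eq_etaBase (by simpa using hx), mul_assoc]

/-- The estimate behind all convergence statements. The binomial coefficient is at most ∏ (1 + R /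
j), which grows more slowly than any ρ^k with ρ > 1; for large k the zeta value lies in Re ≥ 2,
where it is bounded; the finitely many remaining k are handled by compactness. -/
theorem exists_bound_etaGamma (R : ℝ) {ρ : ℝ} (hρ : 1 < ρ) :
    ∃ C : ℝ, 0 ≤ C ∧ ∀ k : ℕ, ∀ s : ℂ, ‖s‖ ≤ R → ‖etaGamma k s‖ ≤ C * ρ ^ k := by
  rcases lt_or_ge R 0 with hR | hR
  · exact ⟨0, le_rfl, fun k s hs => absurd (hs.trans_lt hR) (not_lt.2 (norm_nonneg s))⟩
  have hcomp : ∀ f : ℂ → ℂ, Continuous f → ∃ C : ℝ, ∀ s : ℂ, ‖s‖ ≤ R → ‖f s‖ ≤ C := by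
    intro f hf
    obtain ⟨C, hC⟩ := (isCompact_closedBall (0 : ℂ) R).exists_bound_of_continuousOn hf.continuousOn
    exact ⟨C, fun s hs => hC s (by simpa using hs)⟩
  choose c hc using fun k => hcomp _ (differentiable_etaGamma k).continuous
  obtain ⟨M, hM⟩ := hcomp _ Complex.differentiable_one_div_Gamma.continuous
  have hM0 : 0 ≤ M := (norm_nonneg _).trans (hM 0 (by simpa using hR))
  set p : ℕ → ℝ := fun k => ∏ j ∈ Finset.range k, (1 + R / (j + 1)) with hp
  have hp0 : ∀ k, 0 < p k := fun k => Finset.prod_pos fun j _ => by positivity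
  obtain ⟨B, hB⟩ : ∃ B : ℝ, ∀ k, p k ≤ B * ρ ^ k := by
    -- Consecutive quotients tend to 1 / ρ < 1. Summability is more than needed: it makes p k / ρ^k
    -- bounded.
    have hsum : Summable fun k => p k / ρ ^ k := by
      refine summable_of_ratio_test_tendsto_lt_one (l := 1 / ρ)
        (by rw [div_lt_one (by linarith)]; exact hρ)
        (.of_forall fun k => by have := hp0 k; positivity) ?_
      have h1 : Tendsto (fun k : ℕ => (1 + R / ((k : ℝ) + 1)) / ρ) atTop (𝓝 ((1 + 0) / ρ)) :=
        ((tendsto_const_nhds.div_atTop (tendsto_natCast_atTop_atTop.atTop_add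
          tendsto_const_nhds)).const_add 1).div_const ρ
      rw [add_zero] at h1
      refine h1.congr fun k => ?_
      have := hp0 k
      rw [Real.norm_of_nonneg (by have := hp0 (k + 1); positivity),
        Real.norm_of_nonneg (by positivity)]
      simp only [hp, Finset.prod_range_succ, pow_succ] at this ⊢
      field_simp
    obtain ⟨B, hB⟩ := hsum.tendsto_atTop_zero.bddAbove_range
    refine ⟨B, fun k => ?_⟩
    have := hB ⟨k, rfl⟩
    rwa [div_le_iff₀ (by positivity)] at this
  have hB0 : 0 ≤ B := by
    have := hB 0
    simp [hp] at this
    linarith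
  set ζ₂ : ℝ := ∑' n : ℕ, 1 / ((n : ℝ) + 1) ^ 2
  have hs2 : Summable fun n : ℕ => 1 / ((n : ℝ) + 1) ^ 2 := by
    have := (summable_nat_add_iff 1).2 (Real.summable_one_div_nat_pow.2 one_lt_two)
    simpa using this
  have hζ : ∀ w : ℂ, 2 ≤ w.re → ‖riemannZeta w‖ ≤ ζ₂ := by
    intro w hw
    rw [zeta_eq_tsum_one_div_nat_add_one_cpow (by linarith)]
    refine tsum_of_norm_bounded hs2.hasSum fun n => ?_
    have h1 : ((n : ℂ) + 1) = ((n + 1 : ℕ) : ℂ) := by push_cast; rfl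
    rw [norm_div, norm_one, h1, Complex.norm_natCast_cpow_of_pos n.succ_pos]
    refine one_div_le_one_div_of_le (by positivity) ?_
    rw [← Real.rpow_natCast]
    push_cast
    exact Real.rpow_le_rpow_of_exponent_le (by linarith [(n.cast_nonneg : (0 : ℝ) ≤ n)]) hw
  have hζ0 : 0 ≤ ζ₂ := tsum_nonneg fun n => by positivity
  -- For k ≥ R + 1 and ‖s‖ ≤ R one has s ≠ k and Re(k + 1 - s) ≥ 2.
  obtain ⟨K, hK⟩ := exists_nat_ge (R + 1)
  set c' : ℕ → ℝ := fun k => |c k|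
  refine ⟨B * ζ₂ * M + ∑ k ∈ Finset.range K, c' k, by positivity, fun k s hs => ?_⟩
  have hρk : 1 ≤ ρ ^ k := one_le_pow₀ hρ.le
  rcases lt_or_ge k K with hk | hk
  · calc ‖etaGamma k s‖ ≤ c' k := (hc k s hs).trans (le_abs_self _)
      _ ≤ ∑ k ∈ Finset.range K, c' k :=
        Finset.single_le_sum (f := c') (fun _ _ => abs_nonneg _) (Finset.mem_range.2 hk)
      _ ≤ B * ζ₂ * M + ∑ k ∈ Finset.range K, c' k := le_add_of_nonneg_left (by positivity)
      _ ≤ _ := le_mul_of_one_le_right (by positivity) hρk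
  · have hkR : R + 1 ≤ k := hK.trans (by exact_mod_cast hk)
    have hsk : s ≠ k := by
      rintro rfl
      simp at hs
      linarith
    have hk0 : k ≠ 0 := by
      rintro rfl
      simp at hkR
      linarith
    obtain ⟨k', rfl⟩ := Nat.exists_eq_succ_of_ne_zero hk0
    have hre : 2 ≤ (((k' + 1 : ℕ) : ℂ) + 1 - s).re := by
      have := (abs_le.1 (Complex.abs_re_le_norm s)).2
      simp only [Complex.sub_re, Complex.add_re, Complex.natCast_re, Complex.one_re]
      simp only [Nat.succ_eq_add_one] at hkR
      linarith
    have hch : ‖Ring.choose (((k' + 1 : ℕ) : ℂ) - s) (k' + 1)‖ ≤ p (k' + 1) := by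
      rw [choose_sub_eq_prod, ← Finset.prod_range_add_one_eq_factorial, Nat.cast_prod,
        ← Finset.prod_div_distrib, norm_prod]
      refine Finset.prod_le_prod (fun _ _ => norm_nonneg _) fun j _ => ?_
      have hj : ((j : ℂ) + 1) ≠ 0 := by exact_mod_cast j.succ_ne_zero
      push_cast
      rw [sub_div, div_self hj]
      refine (norm_sub_le _ _).trans ?_
      rw [norm_one, norm_div]
      have : ‖(j : ℂ) + 1‖ = (j : ℝ) + 1 := by
        have := Complex.norm_natCast (j + 1)
        push_cast at this
        exact this
      rw [this]
      gcongr
    have : etaGamma (k' + 1) s = etaBase (k' + 1) s * (Complex.Gamma s)⁻¹ := rfl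
    rw [Nat.succ_eq_add_one] at *
    rw [this, ← choose_mul_zeta_eq_etaBase hsk, norm_mul, norm_mul]
    calc _ ≤ (B * ρ ^ (k' + 1)) * ζ₂ * M := by
          have h1 := hch.trans (hB (k' + 1))
          have h2 := hζ _ hre
          have h3 := hM s hs
          gcongr
      _ = (B * ζ₂ * M) * ρ ^ (k' + 1) := by ring
      _ ≤ _ := by
        gcongr
        exact le_add_of_nonneg_right (Finset.sum_nonneg fun _ _ => abs_nonneg _)

/-- The entire function `1 / ((w + k) Γ(w))`. -/
def gammaInvDiv (k : ℕ) (w : ℂ) : ℂ :=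
  (∏ j ∈ Finset.range k, (w + j)) * (Complex.Gamma (w + k + 1))⁻¹

theorem gammaInvDiv_mul (k : ℕ) (w : ℂ) : (w + k) * gammaInvDiv k w = (Complex.Gamma w)⁻¹ := by
  have h : ∀ k : ℕ, (∏ j ∈ Finset.range k, (w + j)) * (Complex.Gamma (w + k))⁻¹
      = (Complex.Gamma w)⁻¹ := by
    intro k
    induction k with
    | zero => simp
    | succ k ih =>
      rw [← ih, Finset.prod_range_succ, Complex.one_div_Gamma_eq_self_mul_one_div_Gamma_add_one
        (w + k)]
      push_cast
      ring_nf
  rw [gammaInvDiv, ← h k, Complex.one_div_Gamma_eq_self_mul_one_div_Gamma_add_one (w + k)]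
  ring

theorem gammaInvDiv_eq {k : ℕ} {w : ℂ} (h : w + k ≠ 0) :
    gammaInvDiv k w = (Complex.Gamma w)⁻¹ / (w + k) := by
  rw [← gammaInvDiv_mul k w]
  field_simp

/-- The value is ∏ (j - k) over j < k, the derivative of 1/Γ at its zero -k. It reappears as the
factor of the residue on s + t = 1 - k. -/
theorem gammaInvDiv_neg (k : ℕ) : gammaInvDiv k (-k) ≠ 0 := by
  rw [gammaInvDiv]
  simp only [neg_add_cancel, zero_add, Complex.Gamma_one, inv_one, mul_one]
  refine Finset.prod_ne_zero_iff.2 fun j hj => ?_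
  have : (j : ℂ) ≠ k := by exact_mod_cast (Finset.mem_range.1 hj).ne
  intro h
  exact this (by linear_combination h)

theorem differentiable_gammaInvDiv (k : ℕ) : Differentiable ℂ (gammaInvDiv k) := by
  have : Differentiable ℂ fun w : ℂ => (Complex.Gamma (w + k + 1))⁻¹ :=
    Complex.differentiable_one_div_Gamma.comp
      (by fun_prop : Differentiable ℂ fun w : ℂ => w + k + 1)
  unfold gammaInvDiv
  fun_prop

/-- The factorization 1/Γ(w) = (w + k) · `gammaInvDiv k w` shows that the zero at -k is simple. -/
theorem deriv_gamma_inv_ne_zero {w : ℂ} (h : (Complex.Gamma w)⁻¹ = 0) :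
    deriv (fun w => (Complex.Gamma w)⁻¹) w ≠ 0 := by
  obtain ⟨k, rfl⟩ := Complex.Gamma_eq_zero_iff w |>.1 (inv_eq_zero.1 h)
  have h1 : (fun w => (Complex.Gamma w)⁻¹) = fun w => (w + k) * gammaInvDiv k w :=
    funext fun w => (gammaInvDiv_mul k w).symm
  have h2 : HasDerivAt (fun w : ℂ => w + k) 1 (-k : ℂ) := (hasDerivAt_id _).add_const _
  have h3 := h2.fun_mul (differentiable_gammaInvDiv k (-k)).hasDerivAt
  rw [h1, h3.deriv]
  simpa using gammaInvDiv_neg k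

/-- Uniformity in k holds because |w + k| ≥ 1 as soon as k ≥ R + 1, so that dividing 1/Γ(w) by it
does no harm; finitely many k remain. -/
theorem exists_bound_gammaInvDiv (R : ℝ) :
    ∃ C : ℝ, 0 ≤ C ∧ ∀ k : ℕ, ∀ w : ℂ, ‖w‖ ≤ R → ‖gammaInvDiv k w‖ ≤ C := by
  have hcomp : ∀ f : ℂ → ℂ, Continuous f → ∃ C : ℝ, ∀ s : ℂ, ‖s‖ ≤ R → ‖f s‖ ≤ C := by
    intro f hf
    obtain ⟨C, hC⟩ := (isCompact_closedBall (0 : ℂ) R).exists_bound_of_continuousOn hf.continuousOn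
    exact ⟨C, fun s hs => hC s (by simpa using hs)⟩
  choose c hc using fun k => hcomp _ (differentiable_gammaInvDiv k).continuous
  obtain ⟨M, hM⟩ := hcomp _ Complex.differentiable_one_div_Gamma.continuous
  obtain ⟨K, hK⟩ := exists_nat_ge (R + 1)
  set c' : ℕ → ℝ := fun k => |c k|
  refine ⟨|M| + ∑ k ∈ Finset.range K, c' k, by positivity, fun k w hw => ?_⟩
  rcases lt_or_ge k K with hk | hk
  · calc ‖gammaInvDiv k w‖ ≤ c' k := (hc k w hw).trans (le_abs_self _)
      _ ≤ ∑ k ∈ Finset.range K, c' k :=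
        Finset.single_le_sum (f := c') (fun _ _ => abs_nonneg _) (Finset.mem_range.2 hk)
      _ ≤ _ := le_add_of_nonneg_left (by positivity)
  · have hkR : R + 1 ≤ k := hK.trans (by exact_mod_cast hk)
    have h1 : 1 ≤ ‖w + k‖ := by
      have := norm_sub_le_norm_add (k : ℂ) w
      rw [Complex.norm_natCast, add_comm] at this
      linarith
    have hne : w + k ≠ 0 := norm_pos_iff.1 (by linarith)
    rw [gammaInvDiv_eq hne, norm_div]
    calc _ ≤ ‖(Complex.Gamma w)⁻¹‖ := div_le_self (norm_nonneg _) h1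
      _ ≤ |M| := (hM w hw).trans (le_abs_self _)
      _ ≤ _ := le_add_of_nonneg_right (Finset.sum_nonneg fun _ _ => abs_nonneg _)

/-! ### Rapidly convergent families of holomorphic functions -/

/-- A family of holomorphic functions on `D` that decays geometrically in the degree, locally
uniformly, with every ratio `r > 1/2`. -/
structure RapidFamily {ι : Type} (D : Set (ℂ × ℂ × ℂ)) (deg : ι → ℕ)
    (h : ι → ℂ × ℂ × ℂ → ℂ) : Prop where
  differentiableOn : ∀ i, DifferentiableOn ℂ (h i) D
  bound : ∀ p ∈ D, ∀ r : ℝ, 1 / 2 < r → ∃ C : ℝ, ∀ᶠ q in 𝓝 p, ∀ i, ‖h i q‖ ≤ C * r ^ deg i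

section

variable {ι : Type} {D : Set (ℂ × ℂ × ℂ)} {deg : ι → ℕ} {h : ι → ℂ × ℂ × ℂ → ℂ}

theorem RapidFamily.mono (hh : RapidFamily D deg h) {D' : Set (ℂ × ℂ × ℂ)} (hD : D' ⊆ D) :
    RapidFamily D' deg h :=
  ⟨fun i => (hh.differentiableOn i).mono hD, fun p hp => hh.bound p (hD hp)⟩

theorem RapidFamily.comp (hh : RapidFamily D deg h) {σ : ℂ × ℂ × ℂ → ℂ × ℂ × ℂ}
    (hσ : Differentiable ℂ σ) {D' : Set (ℂ × ℂ × ℂ)} (hD : ∀ p ∈ D', σ p ∈ D) :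
    RapidFamily D' deg fun i p => h i (σ p) := by
  refine ⟨fun i => (hh.differentiableOn i).comp hσ.differentiableOn hD, fun p hp r hr => ?_⟩
  obtain ⟨C, hC⟩ := hh.bound (σ p) (hD p hp) r hr
  exact ⟨C, hσ.continuous.continuousAt.eventually hC⟩

theorem RapidFamily.summable (hh : RapidFamily D deg h)
    (hdeg : Summable fun i => (3 / 4 : ℝ) ^ deg i) {p : ℂ × ℂ × ℂ} (hp : p ∈ D) :
    Summable fun i => h i p := by
  obtain ⟨C, hC⟩ := hh.bound p hp (3 / 4) (by norm_num)
  exact Summable.of_norm_bounded (hdeg.mul_left C) hC.self_of_nhds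

theorem RapidFamily.differentiableOn_tsum (hh : RapidFamily D deg h) (hD : IsOpen D)
    (hdeg : Summable fun i => (3 / 4 : ℝ) ^ deg i) :
    DifferentiableOn ℂ (fun p => ∑' i, h i p) D := by
  refine differentiableOn_tsum_of_locally_bounded hD hh.differentiableOn fun p hp => ?_
  obtain ⟨C, hC⟩ := hh.bound p hp (3 / 4) (by norm_num)
  exact ⟨_, hdeg.mul_left C, hC⟩

end

theorem lineCocountable_regularPoints : LineCocountable regularPoints := by
  have h : regularPoints = ⋂ n : ℕ, (({p | ContinuousLinearMap.fst ℂ ℂ (ℂ × ℂ) p ≠ -(n : ℂ)} ∩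
      {p | ((ContinuousLinearMap.fst ℂ ℂ ℂ).comp (ContinuousLinearMap.snd ℂ ℂ (ℂ × ℂ))) p
        ≠ -(n : ℂ)}) ∩
      {p | ((ContinuousLinearMap.snd ℂ ℂ ℂ).comp (ContinuousLinearMap.snd ℂ ℂ (ℂ × ℂ))) p
        ≠ -(n : ℂ)}) := by
    ext ⟨s, t, u⟩
    simp [regularPoints, and_assoc]
  rw [h]
  exact .iInter fun n => ((lineCocountable_ne _ _).inter (lineCocountable_ne _ _)).inter
    (lineCocountable_ne _ _)

theorem one_mem_regularPoints : ((1, 1, 1) : ℂ × ℂ × ℂ) ∈ regularPoints := by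
  intro n
  have : (1 : ℂ) ≠ -n := fun h => by
    have := congrArg Complex.re h
    simp at this
    linarith [(n.cast_nonneg : (0 : ℝ) ≤ n)]
  exact ⟨this, this, this⟩

theorem dense_regularPoints : Dense regularPoints :=
  lineCocountable_regularPoints.dense ⟨_, one_mem_regularPoints⟩

section

variable {ι : Type} {D : Set (ℂ × ℂ × ℂ)} {deg : ι → ℕ} {h : ι → ℂ × ℂ × ℂ → ℂ}
  {a : ℂ → ℂ → ℂ → ι → ℂ}

/-- The regular points are dense and h i is continuous on the open set D, so the extension by
continuity can only be h i. -/
theorem RapidFamily.regG_eq (hh : RapidFamily D deg h) (hD : IsOpen D)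
    (ha : ∀ i s t u, (s, t, u) ∈ D → (s, t, u) ∈ regularPoints →
      G s t u * a s t u i = h i (s, t, u)) (i : ι) {s t u : ℂ} (hp : (s, t, u) ∈ D) :
    regG (fun s t u => a s t u i) s t u = h i (s, t, u) := by
  refine extendFrom_eq (dense_regularPoints _) ?_
  have h1 : Tendsto (h i) (𝓝 (s, t, u)) (𝓝 (h i (s, t, u))) :=
    ((hh.differentiableOn i).continuousOn.continuousAt (hD.mem_nhds hp)).tendsto
  refine (h1.mono_left nhdsWithin_le_nhds).congr' ?_
  filter_upwards [self_mem_nhdsWithin, mem_nhdsWithin_of_mem_nhds (hD.mem_nhds hp)] with q hq hqD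
  obtain ⟨s', t', u'⟩ := q
  exact (ha i s' t' u' hqD hq).symm

theorem RapidFamily.rapidOn (hh : RapidFamily D deg h) (hD : IsOpen D)
    (hdeg : Summable fun i => (3 / 4 : ℝ) ^ deg i)
    (ha : ∀ i s t u, (s, t, u) ∈ D → (s, t, u) ∈ regularPoints →
      G s t u * a s t u i = h i (s, t, u)) : RapidOn D deg a := by
  refine ⟨fun i => ?_, fun i s t u hp hr => ?_, fun s t u hp r hr => ?_, fun s t u hp => ?_⟩
  · refine (hh.differentiableOn i).congr ?_
    rintro ⟨s, t, u⟩ hp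
    exact hh.regG_eq hD ha i hp
  · rw [hh.regG_eq hD ha i hp, ha i s t u hp hr]
  · obtain ⟨C, hC⟩ := hh.bound _ hp r hr
    refine ⟨C, fun i => ?_⟩
    rw [hh.regG_eq hD ha i hp]
    exact hC.self_of_nhds i
  · refine (hh.summable hdeg hp).congr fun i => ?_
    rw [hh.regG_eq hD ha i hp]

theorem RapidFamily.sumG_eq (hh : RapidFamily D deg h) (hD : IsOpen D)
    (ha : ∀ i s t u, (s, t, u) ∈ D → (s, t, u) ∈ regularPoints →
      G s t u * a s t u i = h i (s, t, u)) {s t u : ℂ} (hp : (s, t, u) ∈ D) :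
    sumG a s t u = ∑' i, h i (s, t, u) :=
  tsum_congr fun i => hh.regG_eq hD ha i hp

theorem G_mul_tsum_eq
    (ha : ∀ i s t u, (s, t, u) ∈ D → (s, t, u) ∈ regularPoints →
      G s t u * a s t u i = h i (s, t, u)) {s t u : ℂ} (hp : (s, t, u) ∈ D)
    (hr : (s, t, u) ∈ regularPoints) :
    G s t u * ∑' i, a s t u i = ∑' i, h i (s, t, u) := by
  rw [← tsum_mul_left]
  exact tsum_congr fun i => ha i s t u hp hr

end

/-- Any ratio strictly between 1/2 and 1 would do; 3/4 is the one used for all summability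
statements. -/
theorem summable_pow_id : Summable fun n : ℕ => (3 / 4 : ℝ) ^ id n :=
  summable_geometric_of_lt_one (by norm_num) (by norm_num)

theorem summable_pow_deg₂ : Summable fun i : ℕ × ℕ => (3 / 4 : ℝ) ^ deg₂ i := by
  have h := summable_pow_id
  have := h.mul_of_nonneg h (fun _ => by positivity) (fun _ => by positivity)
  simpa [deg₂, pow_add] using this

theorem summable_pow_deg₃ : Summable fun i : ℕ × ℕ × ℕ => (3 / 4 : ℝ) ^ deg₃ i := by
  have := summable_pow_id.mul_of_nonneg summable_pow_deg₂ (fun _ => by positivity)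
    (fun _ => by positivity)
  simpa [deg₂, deg₃, pow_add, mul_assoc] using this

/-! ### The terms of the expansions, multiplied by `G` -/

/-- The numerator `e^{-π i (s+t+u)/2} (2π)^{s+t+u}` of `G`. -/
def gNum (p : ℂ × ℂ × ℂ) : ℂ :=
  Complex.exp (-(Real.pi * Complex.I * (p.1 + p.2.1 + p.2.2) / 2))
    * (2 * Real.pi : ℂ) ^ (p.1 + p.2.1 + p.2.2)

theorem G_eq (s t u : ℂ) : G s t u = gNum (s, t, u) * (Complex.Gamma s)⁻¹ * (Complex.Gamma t)⁻¹
    * (Complex.Gamma u)⁻¹ := by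
  simp only [G, gNum, div_eq_mul_inv, mul_inv]
  ring

theorem complex_two_pi_ne_zero : (2 * Real.pi : ℂ) ≠ 0 := by
  exact_mod_cast Real.two_pi_pos.ne'

theorem differentiable_gNum : Differentiable ℂ gNum := by
  unfold gNum
  refine Differentiable.mul (by fun_prop) ?_
  exact Differentiable.const_cpow (by fun_prop) (Or.inl complex_two_pi_ne_zero)

/-- `G` times the general term of a triple series. -/
def tripleTerm (a b c : ℂ) (i : ℕ × ℕ × ℕ) (p : ℂ × ℂ × ℂ) : ℂ :=
  gNum p * (kappa i.1 i.2.1 i.2.2 / (i.1 + i.2.1 + i.2.2 + 1))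
    * (a ^ (-(i.1 : ℤ)) * etaGamma i.1 p.1) * (b ^ (-(i.2.1 : ℤ)) * etaGamma i.2.1 p.2.1)
    * (c ^ (-(i.2.2 : ℤ)) * etaGamma i.2.2 p.2.2)

/-- `G` times the general term of a double series. -/
def doubleTerm (a b : ℂ) (i : ℕ × ℕ) (p : ℂ × ℂ × ℂ) : ℂ :=
  gNum p * (2 : ℂ) ^ (-p.1) * gammaInvDiv (i.1 + i.2) p.1
    * (a ^ (-(i.1 : ℤ)) * etaGamma i.1 p.2.1) * (b ^ (-(i.2 : ℤ)) * etaGamma i.2 p.2.2)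

/-- `G` times the general term of a single series, without the factor `1 / (s + t + n - 1)`. -/
def singleNum (a : ℂ) (n : ℕ) (p : ℂ × ℂ × ℂ) : ℂ :=
  gNum p * (2 : ℂ) ^ (1 - p.1 - p.2.1) * (Complex.Gamma p.1)⁻¹ * (Complex.Gamma p.2.1)⁻¹
    * (a ^ (-(n : ℤ)) * etaGamma n p.2.2)

/-- `G` times the general term of a single series. -/
def singleTerm (a : ℂ) (n : ℕ) (p : ℂ × ℂ × ℂ) : ℂ :=
  singleNum a n p / (p.1 + p.2.1 + n - 1)

/-- `G / Γ(s + t - 1)` times the general term of a single series. -/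
def singleTermReg (a : ℂ) (n : ℕ) (p : ℂ × ℂ × ℂ) : ℂ :=
  singleNum a n p * gammaInvDiv n (p.1 + p.2.1 - 1)

/-- Take ρ = 2r > 1 in the bound for `etaGamma`; the weight a^{-k} contributes 2^{-k}. -/
theorem exists_bound_etaGamma_weighted {a : ℂ} (ha : ‖a‖ = 2) (R : ℝ) {r : ℝ} (hr : 1 / 2 < r) :
    ∃ C : ℝ, 0 ≤ C ∧ ∀ k : ℕ, ∀ s : ℂ, ‖s‖ ≤ R →
      ‖a ^ (-(k : ℤ)) * etaGamma k s‖ ≤ C * r ^ k := by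
  obtain ⟨C, hC0, hC⟩ := exists_bound_etaGamma R (ρ := 2 * r) (by linarith)
  refine ⟨C, hC0, fun k s hs => ?_⟩
  rw [norm_mul, norm_zpow, ha, zpow_neg, zpow_natCast]
  calc _ ≤ ((2 : ℝ) ^ k)⁻¹ * (C * (2 * r) ^ k) := by gcongr; exact hC k s hs
    _ = C * r ^ k := by rw [mul_pow]; field_simp

theorem eventually_norm_le (p : ℂ × ℂ × ℂ) : ∀ᶠ q in 𝓝 p,
    ‖q.1‖ ≤ ‖p‖ + 1 ∧ ‖q.2.1‖ ≤ ‖p‖ + 1 ∧ ‖q.2.2‖ ≤ ‖p‖ + 1 := by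
  filter_upwards [continuous_norm.continuousAt.eventually (gt_mem_nhds (lt_add_one ‖p‖))] with q hq
  have h1 : ‖q.1‖ ≤ ‖q‖ := norm_fst_le q
  have h2 : ‖q.2‖ ≤ ‖q‖ := norm_snd_le q
  have h3 : ‖q.2.1‖ ≤ ‖q.2‖ := norm_fst_le q.2
  have h4 : ‖q.2.2‖ ≤ ‖q.2‖ := norm_snd_le q.2
  refine ⟨?_, ?_, ?_⟩ <;> linarith

theorem exists_eventually_norm_le {f : ℂ × ℂ × ℂ → ℂ} {p : ℂ × ℂ × ℂ} (hf : ContinuousAt f p) :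
    ∃ C : ℝ, 0 ≤ C ∧ ∀ᶠ q in 𝓝 p, ‖f q‖ ≤ C := by
  refine ⟨‖f p‖ + 1, by positivity, ?_⟩
  filter_upwards [hf.norm.eventually (gt_mem_nhds (lt_add_one ‖f p‖))] with q hq using hq.le

theorem norm_kappa_div_le (l m n : ℕ) : ‖kappa l m n / (l + m + n + 1)‖ ≤ 1 := by
  rw [norm_div]
  have h1 : ‖kappa l m n‖ ≤ 1 := by
    unfold kappa
    split <;> simp
  have h2 : ‖(l + m + n + 1 : ℂ)‖ = l + m + n + 1 := by
    have := Complex.norm_natCast (l + m + n + 1)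
    push_cast at this
    exact this
  rw [h2]
  exact div_le_one_of_le₀ (h1.trans (by
    have : (0 : ℝ) ≤ l + m + n := by positivity
    linarith)) (by positivity)

theorem differentiable_etaGamma_comp (k : ℕ) {ℓ : ℂ × ℂ × ℂ → ℂ} (hℓ : Differentiable ℂ ℓ) :
    Differentiable ℂ fun p => etaGamma k (ℓ p) := (differentiable_etaGamma k).comp hℓ

theorem rapidFamily_tripleTerm {a b c : ℂ} (ha : ‖a‖ = 2) (hb : ‖b‖ = 2) (hc : ‖c‖ = 2) :
    RapidFamily univ deg₃ (tripleTerm a b c) := by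
  refine ⟨fun i => ?_, fun p _ r hr => ?_⟩
  · have h1 := differentiable_gNum
    have h2 := differentiable_etaGamma_comp i.1 (ℓ := fun p => p.1) (by fun_prop)
    have h3 := differentiable_etaGamma_comp i.2.1 (ℓ := fun p => p.2.1) (by fun_prop)
    have h4 := differentiable_etaGamma_comp i.2.2 (ℓ := fun p => p.2.2) (by fun_prop)
    exact (((h1.mul_const _).mul (h2.const_mul _)).mul (h3.const_mul _)).mul
      (h4.const_mul _) |>.differentiableOn
  · obtain ⟨M, hM0, hM⟩ := exists_eventually_norm_le (differentiable_gNum.continuous.continuousAt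
      (x := p))
    obtain ⟨A, hA0, hA⟩ := exists_bound_etaGamma_weighted ha (‖p‖ + 1) hr
    obtain ⟨B, hB0, hB⟩ := exists_bound_etaGamma_weighted hb (‖p‖ + 1) hr
    obtain ⟨C, hC0, hC⟩ := exists_bound_etaGamma_weighted hc (‖p‖ + 1) hr
    refine ⟨M * A * B * C, ?_⟩
    filter_upwards [hM, eventually_norm_le p] with q hq ⟨h1, h2, h3⟩ i
    simp only [tripleTerm, norm_mul (_ * _) (_ * _), norm_mul (gNum q)]
    calc _ ≤ M * 1 * (A * r ^ i.1) * (B * r ^ i.2.1) * (C * r ^ i.2.2) := by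
          have h4 := norm_kappa_div_le i.1 i.2.1 i.2.2
          have h5 := hA i.1 _ h1
          have h6 := hB i.2.1 _ h2
          have h7 := hC i.2.2 _ h3
          gcongr
      _ = _ := by rw [deg₃, pow_add, pow_add]; ring

theorem differentiable_two_cpow {f : ℂ × ℂ × ℂ → ℂ} (hf : Differentiable ℂ f) :
    Differentiable ℂ fun p => (2 : ℂ) ^ f p :=
  hf.const_cpow (Or.inl two_ne_zero)

theorem rapidFamily_doubleTerm {a b : ℂ} (ha : ‖a‖ = 2) (hb : ‖b‖ = 2) :
    RapidFamily univ deg₂ (doubleTerm a b) := by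
  have hg : Differentiable ℂ fun p : ℂ × ℂ × ℂ => gNum p * (2 : ℂ) ^ (-p.1) :=
    differentiable_gNum.mul (differentiable_two_cpow (by fun_prop))
  refine ⟨fun i => ?_, fun p _ r hr => ?_⟩
  · have h2 : Differentiable ℂ fun p : ℂ × ℂ × ℂ => gammaInvDiv (i.1 + i.2) p.1 :=
      (differentiable_gammaInvDiv _).comp differentiable_fst
    have h3 := differentiable_etaGamma_comp i.1 (ℓ := fun p => p.2.1) (by fun_prop)
    have h4 := differentiable_etaGamma_comp i.2 (ℓ := fun p => p.2.2) (by fun_prop)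
    exact ((hg.mul h2).mul (h3.const_mul _)).mul (h4.const_mul _) |>.differentiableOn
  · obtain ⟨M, hM0, hM⟩ := exists_eventually_norm_le (hg.continuous.continuousAt (x := p))
    obtain ⟨A, hA0, hA⟩ := exists_bound_etaGamma_weighted ha (‖p‖ + 1) hr
    obtain ⟨B, hB0, hB⟩ := exists_bound_etaGamma_weighted hb (‖p‖ + 1) hr
    obtain ⟨C, hC0, hC⟩ := exists_bound_gammaInvDiv (‖p‖ + 1)
    refine ⟨M * A * B * C, ?_⟩
    filter_upwards [hM, eventually_norm_le p] with q hq ⟨h1, h2, h3⟩ i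
    have e : ‖doubleTerm a b i q‖ = ‖gNum q * (2 : ℂ) ^ (-q.1)‖ * ‖gammaInvDiv (i.1 + i.2) q.1‖
        * ‖a ^ (-(i.1 : ℤ)) * etaGamma i.1 q.2.1‖ * ‖b ^ (-(i.2 : ℤ)) * etaGamma i.2 q.2.2‖ := by
      rw [doubleTerm, norm_mul, norm_mul, norm_mul]
    rw [e]
    calc _ ≤ M * C * (A * r ^ i.1) * (B * r ^ i.2) := by
          have h4 := hC (i.1 + i.2) _ h1
          have h5 := hA i.1 _ h2
          have h6 := hB i.2 _ h3
          gcongr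
      _ = _ := by rw [deg₂, pow_add]; ring

theorem rapidFamily_singleNum {a : ℂ} (ha : ‖a‖ = 2) : RapidFamily univ id (singleNum a) := by
  have hg : Differentiable ℂ fun p : ℂ × ℂ × ℂ => gNum p * (2 : ℂ) ^ (1 - p.1 - p.2.1)
      * (Complex.Gamma p.1)⁻¹ * (Complex.Gamma p.2.1)⁻¹ :=
    ((differentiable_gNum.mul (differentiable_two_cpow (by fun_prop))).mul
      (Complex.differentiable_one_div_Gamma.comp differentiable_fst)).mul
      (Complex.differentiable_one_div_Gamma.comp (differentiable_fst.comp differentiable_snd))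
  refine ⟨fun i => ?_, fun p _ r hr => ?_⟩
  · have h4 := differentiable_etaGamma_comp i (ℓ := fun p => p.2.2) (by fun_prop)
    exact (hg.mul (h4.const_mul _)).differentiableOn
  · obtain ⟨M, hM0, hM⟩ := exists_eventually_norm_le (hg.continuous.continuousAt (x := p))
    obtain ⟨A, hA0, hA⟩ := exists_bound_etaGamma_weighted ha (‖p‖ + 1) hr
    refine ⟨M * A, ?_⟩
    filter_upwards [hM, eventually_norm_le p] with q hq ⟨h1, h2, h3⟩ i
    rw [singleNum, norm_mul]
    calc _ ≤ M * (A * r ^ i) := by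
          have h5 := hA i _ h3
          gcongr
      _ = _ := by rw [id]; ring

/-- The factor 1/Γ(s + t - 1) turns every pole 1/(s + t + n - 1) into an entire function bounded
uniformly in n, so the regularized series converges on the whole space, singular hyperplanes
included. -/
theorem rapidFamily_singleTermReg {a : ℂ} (ha : ‖a‖ = 2) :
    RapidFamily univ id (singleTermReg a) := by
  refine ⟨fun i => ?_, fun p _ r hr => ?_⟩
  · exact ((rapidFamily_singleNum ha).differentiableOn i).mul ((differentiable_gammaInvDiv i).comp
      (by fun_prop : Differentiable ℂ fun p : ℂ × ℂ × ℂ => p.1 + p.2.1 - 1)).differentiableOn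
  · obtain ⟨A, hA⟩ := (rapidFamily_singleNum ha).bound p trivial r hr
    obtain ⟨C, hC0, hC⟩ := exists_bound_gammaInvDiv (‖p‖ + 1 + (‖p‖ + 1) + 1)
    refine ⟨A * C, ?_⟩
    filter_upwards [hA, eventually_norm_le p] with q hq ⟨h1, h2, h3⟩ i
    have h4 : ‖q.1 + q.2.1 - 1‖ ≤ ‖p‖ + 1 + (‖p‖ + 1) + 1 :=
      (norm_sub_le _ _).trans (by
        rw [norm_one]
        have := norm_add_le q.1 q.2.1
        linarith)
    rw [singleTermReg, norm_mul]
    have h5 := hC i _ h4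
    have h6 := hq i
    calc _ ≤ (A * r ^ id i) * C :=
          mul_le_mul h6 h5 (norm_nonneg _) ((norm_nonneg _).trans h6)
      _ = _ := by ring

theorem isClosed_intLeOne : IsClosed {z : ℂ | IsIntLeOne z} := by
  have h : {z : ℂ | IsIntLeOne z} = (fun n : ℤ => (n : ℂ)) '' {n | n ≤ 1} := by
    ext z
    simp only [IsIntLeOne, mem_ofPred_eq, mem_image]
    exact ⟨fun ⟨n, h1, h2⟩ => ⟨n, h1, h2.symm⟩, fun ⟨n, h1, h2⟩ => ⟨n, h1, h2.symm⟩⟩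
  rw [h]
  exact Complex.isClosedEmbedding_intCast.isClosedMap _ (isClosed_discrete _)

theorem isOpen_not_intLeOne {f : ℂ × ℂ × ℂ → ℂ} (hf : Continuous f) :
    IsOpen {p | ¬ IsIntLeOne (f p)} :=
  isClosed_intLeOne.isOpen_compl.preimage hf

theorem add_natCast_sub_one_ne_zero {z : ℂ} (hz : ¬ IsIntLeOne z) (n : ℕ) : z + n - 1 ≠ 0 := by
  intro h
  exact hz ⟨1 - n, by omega, by push_cast; linear_combination h⟩

theorem isOpen_D₁ : IsOpen D₁ := isOpen_not_intLeOne (f := fun p => p.1 + p.2.1) (by fun_prop)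

theorem rapidFamily_singleTerm {a : ℂ} (ha : ‖a‖ = 2) : RapidFamily D₁ id (singleTerm a) := by
  have hne : ∀ p ∈ D₁, ∀ n : ℕ, p.1 + p.2.1 + n - 1 ≠ 0 := fun p hp n =>
    add_natCast_sub_one_ne_zero (show ¬ IsIntLeOne (p.1 + p.2.1) from hp) n
  refine ⟨fun i p hp => ?_, fun p hp r hr => ?_⟩
  · have h1 := ((rapidFamily_singleNum ha).differentiableOn i).differentiableAt
      (x := p) univ_mem
    have h2 : DifferentiableAt ℂ (fun p : ℂ × ℂ × ℂ => (p.1 + p.2.1 + i - 1)⁻¹) p :=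
      DifferentiableAt.fun_inv (by fun_prop) (hne p hp i)
    exact (h1.mul h2).differentiableWithinAt
  · obtain ⟨A, hA⟩ := (rapidFamily_singleNum ha).bound p trivial r hr
    -- For n ≥ N the denominator s + t + n - 1 has norm at least 1 near p; the finitely many smaller
    -- n are bounded by continuity.
    obtain ⟨N, hN⟩ := exists_nat_ge (‖p‖ + 1 + (‖p‖ + 1) + 2)
    have hsmall : ∀ n : ℕ, ∃ C : ℝ, 0 ≤ C ∧
        ∀ᶠ q in 𝓝 p, ‖(fun q : ℂ × ℂ × ℂ => (q.1 + q.2.1 + n - 1)⁻¹) q‖ ≤ C := fun n =>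
      exists_eventually_norm_le (ContinuousAt.inv₀ (by fun_prop) (hne p hp n))
    choose c hc0 hc using hsmall
    have hev : ∀ᶠ q in 𝓝 p, ∀ n ∈ Finset.range N, ‖(q.1 + q.2.1 + (n : ℂ) - 1)⁻¹‖ ≤ c n :=
      (Finset.eventually_all (Finset.range N)).2 fun n _ => hc n
    set C := 1 + ∑ n ∈ Finset.range N, c n
    have hC0 : 0 ≤ C := add_nonneg zero_le_one (Finset.sum_nonneg fun n _ => hc0 n)
    refine ⟨A * C, ?_⟩
    filter_upwards [hA, eventually_norm_le p, hev] with q hq ⟨h1, h2, h3⟩ hn n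
    have h5 : ‖(q.1 + q.2.1 + n - 1)⁻¹‖ ≤ C := by
      rcases lt_or_ge n N with h | h
      · refine (hn n (Finset.mem_range.2 h)).trans ?_
        refine (Finset.single_le_sum (f := c) (fun n _ => hc0 n) (Finset.mem_range.2 h)).trans ?_
        exact le_add_of_nonneg_left zero_le_one
      · have h6 : 1 ≤ ‖q.1 + q.2.1 + n - 1‖ := by
          have e : q.1 + q.2.1 + n - 1 = (n : ℂ) - (1 - (q.1 + q.2.1)) := by ring
          have h7 := norm_sub_norm_le (n : ℂ) (1 - (q.1 + q.2.1))
          have h8 := norm_sub_le 1 (q.1 + q.2.1)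
          have h9 := norm_add_le q.1 q.2.1
          have h10 : (N : ℝ) ≤ n := by exact_mod_cast h
          rw [Complex.norm_natCast] at h7
          rw [norm_one] at h8
          rw [e]
          linarith
        rw [norm_inv]
        refine (inv_le_one_of_one_le₀ h6).trans ?_
        exact le_add_of_nonneg_right (Finset.sum_nonneg fun n _ => hc0 n)
    have h6 := hq n
    rw [singleTerm, div_eq_mul_inv, norm_mul]
    calc _ ≤ (A * r ^ id n) * C :=
          mul_le_mul h6 h5 (norm_nonneg _) ((norm_nonneg _).trans h6)
      _ = _ := by ring

theorem singleTermReg_eq (a : ℂ) (n : ℕ) {p : ℂ × ℂ × ℂ} (hp : p ∈ D₁) :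
    singleTermReg a n p = (Complex.Gamma (p.1 + p.2.1 - 1))⁻¹ * singleTerm a n p := by
  have hne : p.1 + p.2.1 + n - 1 ≠ 0 :=
    add_natCast_sub_one_ne_zero (show ¬ IsIntLeOne (p.1 + p.2.1) from hp) n
  have e : p.1 + p.2.1 - 1 + n = p.1 + p.2.1 + n - 1 := by ring
  rw [singleTermReg, singleTerm, gammaInvDiv_eq (by rwa [e]), e]
  ring

theorem G_mul_triple (a b c : ℂ) (i : ℕ × ℕ × ℕ) {s t u : ℂ} (hr : (s, t, u) ∈ regularPoints) :
    G s t u * triple (eta a) (eta b) (eta c) s t u i = tripleTerm a b c i (s, t, u) := by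
  have h0 := hr 0
  simp only [Nat.cast_zero, neg_zero] at h0
  obtain ⟨hs, ht, hu⟩ := h0
  simp only [triple, tripleTerm, eta_eq (Or.inr hs), eta_eq (Or.inr ht), eta_eq (Or.inr hu),
    ← etaBase_mul_gamma_inv hs, ← etaBase_mul_gamma_inv ht, ← etaBase_mul_gamma_inv hu, G_eq]
  ring

theorem G_mul_double (a b : ℂ) (i : ℕ × ℕ) {s t u : ℂ} (hr : (s, t, u) ∈ regularPoints) :
    G s t u * double (eta a) (eta b) s t u i = doubleTerm a b i (s, t, u) := by
  have h0 := hr 0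
  simp only [Nat.cast_zero, neg_zero] at h0
  obtain ⟨hs, ht, hu⟩ := h0
  have hne : s + ((i.1 + i.2 : ℕ) : ℂ) ≠ 0 := fun h =>
    (hr (i.1 + i.2)).1 (eq_neg_of_add_eq_zero_left h)
  simp only [double, doubleTerm, eta_eq (Or.inr ht), eta_eq (Or.inr hu), gammaInvDiv_eq hne,
    ← etaBase_mul_gamma_inv ht, ← etaBase_mul_gamma_inv hu, G_eq, Complex.cpow_neg]
  push_cast
  rw [← add_assoc]
  simp only [div_eq_mul_inv, mul_inv]
  ring

theorem G_mul_single (a : ℂ) (n : ℕ) {s t u : ℂ} (hr : (s, t, u) ∈ regularPoints) :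
    G s t u * single (eta a) s t u n = singleTerm a n (s, t, u) := by
  have h0 := hr 0
  simp only [Nat.cast_zero, neg_zero] at h0
  obtain ⟨-, -, hu⟩ := h0
  simp only [single, singleTerm, singleNum, eta_eq (Or.inr hu), ← etaBase_mul_gamma_inv hu, G_eq]
  ring

/-! ### Taylor expansion of the Hurwitz zeta function in its parameter -/

theorem hasSum_choose_mul_pow (w : ℂ) {x : ℂ} (hx : ‖x‖ < 1) :
    HasSum (fun k : ℕ => Ring.choose (w + k - 1) k * x ^ k) (1 / (1 - x) ^ w) := by
  have hx' : x ∈ Metric.eball (0 : ℂ) 1 := by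
    rw [Metric.mem_eball, edist_zero_right, ← ofReal_norm, ENNReal.ofReal_lt_one]
    exact hx
  have h := (Complex.one_div_one_sub_cpow_hasFPowerSeriesOnBall_zero w).hasSum hx'
  simpa [FormalMultilinearSeries.ofScalars_apply_eq, mul_comm] using h

theorem summable_norm_choose_mul_pow (w : ℂ) {x : ℂ} (hx : ‖x‖ < 1) :
    Summable fun k : ℕ => ‖Ring.choose (w + k - 1) k * x ^ k‖ := by
  exact (hasSum_choose_mul_pow w hx).summable.norm

/-- Write n + 1 - y = (n + 1)(1 - y/(n + 1)), expand the second factor by the binomial series and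
exchange the summations. For fixed k the sum over n is ζ(k + 1 - s); Re s < 0 makes the double
series absolutely convergent. -/
theorem hasSum_one_div_natCast_add_sub_cpow {s : ℂ} (hs : s.re < 0) {y : ℝ} (hy : |y| < 1) :
    HasSum (fun n : ℕ => 1 / ((n : ℂ) + 1 - y) ^ (1 - s)) (∑' k, (y : ℂ) ^ k * etaBase k s) := by
  set w : ℂ := 1 - s with hw
  have hw1 : 1 < w.re := by simp [hw]; linarith
  set f : ℕ × ℕ → ℂ := fun i =>
    (1 / ((i.1 : ℂ) + 1) ^ w) * (Ring.choose (w + i.2 - 1) i.2 * ((y : ℂ) / (i.1 + 1)) ^ i.2)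
  have hn1 : ∀ n : ℕ, ‖(n : ℂ) + 1‖ = (n : ℝ) + 1 := fun n => by
    have := Complex.norm_natCast (n + 1)
    push_cast at this
    exact this
  have hn0 : ∀ n : ℕ, (n : ℂ) + 1 ≠ 0 := fun n => by exact_mod_cast n.succ_ne_zero
  have hyn : ∀ n : ℕ, ‖(y : ℂ) / (n + 1)‖ ≤ |y| := fun n => by
    rw [norm_div, Complex.norm_real, Real.norm_eq_abs, hn1]
    exact div_le_self (abs_nonneg _) (by linarith [(n.cast_nonneg : (0 : ℝ) ≤ n)])
  have hz : ∀ v : ℂ, 1 < v.re → HasSum (fun n : ℕ => 1 / ((n : ℂ) + 1) ^ v) (riemannZeta v) := by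
    intro v hv
    rw [zeta_eq_tsum_one_div_nat_add_one_cpow hv]
    have := (summable_nat_add_iff 1).2 (Complex.summable_one_div_nat_cpow.2 hv)
    refine Summable.hasSum ?_
    simpa using this
  -- Since |y/(n + 1)| ≤ |y|, the double series is dominated by the product of a zeta series and a
  -- binomial series.
  have hf : Summable f := by
    have hy' : ‖(y : ℂ)‖ < 1 := by simpa using hy
    have h1 := (hz w hw1).summable.norm.mul_of_nonneg (summable_norm_choose_mul_pow w hy')
      (fun _ => norm_nonneg _) (fun _ => norm_nonneg _)
    refine Summable.of_norm_bounded h1 fun i => ?_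
    simp only [f, norm_mul]
    gcongr
    rw [norm_pow, norm_pow]
    gcongr
    simpa using hyn i.1
  have hrow : ∀ n : ℕ, HasSum (fun k => f (n, k)) (1 / ((n : ℂ) + 1 - y) ^ w) := by
    intro n
    have h1 := (hasSum_choose_mul_pow w ((hyn n).trans_lt hy)).mul_left (1 / ((n : ℂ) + 1) ^ w)
    have h2 : ((n : ℂ) + 1 - y) = (((n + 1 : ℝ)) : ℂ) * ((1 - y / (n + 1) : ℝ) : ℂ) := by
      push_cast
      have := hn0 n
      field_simp
    have h3 : 0 ≤ 1 - y / ((n : ℝ) + 1) := by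
      have := hyn n
      rw [norm_div, Complex.norm_real, Real.norm_eq_abs, hn1] at this
      have h4 : y / ((n : ℝ) + 1) ≤ |y| / ((n : ℝ) + 1) := by gcongr; exact le_abs_self y
      linarith
    rw [one_div_mul_one_div] at h1
    rw [h2, Complex.mul_cpow_ofReal_nonneg (by positivity) h3]
    push_cast
    exact h1
  have hcol : ∀ k : ℕ, HasSum (fun n => f (n, k)) ((y : ℂ) ^ k * etaBase k s) := by
    intro k
    have hsk : s ≠ k := by
      rintro rfl
      simp at hs
      linarith [(k.cast_nonneg : (0 : ℝ) ≤ k)]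
    have h1 := (hz (w + k) (by simp; linarith [(k.cast_nonneg : (0 : ℝ) ≤ k)])).mul_left
      ((y : ℂ) ^ k * Ring.choose (w + k - 1) k)
    have e1 : w + k - 1 = k - s := by rw [hw]; ring
    have e2 : w + k = k + 1 - s := by rw [hw]; ring
    rw [e1] at h1
    nth_rewrite 2 [e2] at h1
    rw [mul_assoc, choose_mul_zeta_eq_etaBase hsk] at h1
    refine h1.congr_fun fun n => ?_
    simp only [f]
    rw [e1, Complex.cpow_add _ _ (hn0 n), Complex.cpow_natCast, div_pow]
    simp only [div_eq_mul_inv, mul_inv]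
    ring
  have h1 := hf.hasSum.prod_fiberwise hrow
  have h2 := ((Equiv.prodComm ℕ ℕ).hasSum_iff.2 hf.hasSum).prod_fiberwise (g := fun k =>
    (y : ℂ) ^ k * etaBase k s) (fun k => hcol k)
  rw [h2.tsum_eq]
  exact h1

theorem exists_bound_pow_mul_etaGamma {y : ℂ} (hy : ‖y‖ < 1) (R : ℝ) :
    ∃ u : ℕ → ℝ, Summable u ∧ ∀ k : ℕ, ∀ s : ℂ, ‖s‖ ≤ R → ‖y ^ k * etaGamma k s‖ ≤ u k := by
  -- Chosen so that ρ > 1 while ρ‖y‖ < 1.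
  set ρ := 2 / (1 + ‖y‖) with hρ
  have hy0 := norm_nonneg y
  have hρ1 : 1 < ρ := by rw [hρ, lt_div_iff₀ (by positivity)]; linarith
  obtain ⟨C, hC0, hC⟩ := exists_bound_etaGamma R hρ1
  refine ⟨fun k => C * (ρ * ‖y‖) ^ k, (summable_geometric_of_lt_one (by positivity) ?_).mul_left C,
    fun k s hs => ?_⟩
  · rw [hρ, div_mul_eq_mul_div, div_lt_one (by positivity)]
    linarith
  · rw [norm_mul, norm_pow]
    calc _ ≤ ‖y‖ ^ k * (C * ρ ^ k) := by gcongr; exact hC k s hs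
      _ = C * (ρ * ‖y‖) ^ k := by rw [mul_pow]; ring

theorem differentiable_tsum_pow_mul_etaGamma {y : ℂ} (hy : ‖y‖ < 1) :
    Differentiable ℂ fun s => ∑' k, y ^ k * etaGamma k s := by
  rw [← differentiableOn_univ]
  refine differentiableOn_tsum_of_locally_bounded isOpen_univ
    (fun k => ((differentiable_etaGamma k).const_mul _).differentiableOn) fun s _ => ?_
  obtain ⟨u, hu, hb⟩ := exists_bound_pow_mul_etaGamma hy (‖s‖ + 1)
  refine ⟨u, hu, ?_⟩
  filter_upwards [continuous_norm.continuousAt.eventually (gt_mem_nhds (lt_add_one ‖s‖))]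
    with q hq k using hb k q hq.le

/-- The Hurwitz function of 1 - s is given by its Dirichlet series for Re s < 0. The point 0 is left
out because of the pole there. -/
theorem eqOn_ne_zero_of_eqOn_re_neg {f g : ℂ → ℂ} (hf : ∀ s ≠ 0, DifferentiableAt ℂ f s)
    (hg : ∀ s ≠ 0, DifferentiableAt ℂ g s) (h : ∀ s : ℂ, s.re < 0 → f s = g s) {s : ℂ}
    (hs : s ≠ 0) : f s = g s := by
  have hD : LineCocountable {s : ℂ | s ≠ 0} := lineCocountable_ne (ContinuousLinearMap.id ℂ ℂ) 0
  refine hD.eqOn isOpen_ne (fun s hs => (hf s hs).differentiableWithinAt)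
    (fun s hs => (hg s hs).differentiableWithinAt) (q := -1) (by simp) ?_ hs
  filter_upwards [(isOpen_lt Complex.continuous_re continuous_const).mem_nhds
    (show (-1 : ℂ).re < 0 by simp)] with z hz using h z hz

theorem differentiableAt_hurwitzZeta_one_sub (a : UnitAddCircle) {s : ℂ} (hs : s ≠ 0) :
    DifferentiableAt ℂ (fun s => HurwitzZeta.hurwitzZeta a (1 - s)) s :=
  DifferentiableAt.comp (f := fun s : ℂ => 1 - s) s
    (HurwitzZeta.differentiableAt_hurwitzZeta a (by simpa using hs)) (by fun_prop)

/-- Modulo 1 the parameter -y is 1 - y, so for Re s < 0 the Dirichlet series runs over n + 1 - y;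
the Taylor expansion then continues to all s ≠ 0. -/
theorem gamma_inv_mul_hurwitzZeta_neg {s : ℂ} (hs : s ≠ 0) {y : ℝ} (hy0 : 0 ≤ y) (hy1 : y < 1) :
    (Complex.Gamma s)⁻¹ * HurwitzZeta.hurwitzZeta (-y : ℝ) (1 - s)
      = ∑' k, (y : ℂ) ^ k * etaGamma k s := by
  have hy : |y| < 1 := by rwa [abs_of_nonneg hy0]
  refine eqOn_ne_zero_of_eqOn_re_neg (f := fun s => (Complex.Gamma s)⁻¹ *
    HurwitzZeta.hurwitzZeta (-y : ℝ) (1 - s)) (g := fun s => ∑' k, (y : ℂ) ^ k * etaGamma k s)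
    (fun s hs => (Complex.differentiable_one_div_Gamma s).mul
      (differentiableAt_hurwitzZeta_one_sub _ hs))
    (fun s _ => differentiable_tsum_pow_mul_etaGamma (by simpa using hy) s) ?_ hs
  intro s hs
  have hs0 : s ≠ 0 := by rintro rfl; simp at hs
  have e : ((-y : ℝ) : UnitAddCircle) = ((1 - y : ℝ) : UnitAddCircle) := by
    rw [sub_eq_add_neg, AddCircle.coe_add, AddCircle.coe_period, zero_add]
  have h1 := HurwitzZeta.hasSum_hurwitzZeta_of_one_lt_re (a := 1 - y) ⟨by linarith, by linarith⟩
    (s := 1 - s) (by simp; linarith)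
  have h2 := hasSum_one_div_natCast_add_sub_cpow hs hy
  rw [e, ← h1.tsum_eq]
  simp only [← etaBase_mul_gamma_inv hs0, ← mul_assoc, tsum_mul_right]
  rw [← h2.tsum_eq, mul_comm]
  congr 1
  refine tsum_congr fun n => ?_
  push_cast
  rw [add_sub_assoc]

theorem gamma_inv_mul_hurwitzZeta {s : ℂ} (hs : s ≠ 0) {x : ℝ} (hx0 : 0 < x) (hx1 : x < 1) :
    (Complex.Gamma s)⁻¹ * HurwitzZeta.hurwitzZeta x (1 - s)
      = (x : ℂ) ^ (s - 1) * (Complex.Gamma s)⁻¹ + ∑' k, (-x : ℂ) ^ k * etaGamma k s := by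
  have hx : |(-x)| < 1 := by rwa [abs_neg, abs_of_pos hx0]
  have hxc : (x : ℂ) ≠ 0 := by exact_mod_cast hx0.ne'
  refine eqOn_ne_zero_of_eqOn_re_neg (f := fun s => (Complex.Gamma s)⁻¹ *
    HurwitzZeta.hurwitzZeta x (1 - s)) (g := fun s => (x : ℂ) ^ (s - 1) * (Complex.Gamma s)⁻¹ +
      ∑' k, (-x : ℂ) ^ k * etaGamma k s)
    (fun s hs => (Complex.differentiable_one_div_Gamma s).mul
      (differentiableAt_hurwitzZeta_one_sub _ hs))
    (fun s _ => ?_) ?_ hs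
  · refine DifferentiableAt.add (DifferentiableAt.mul ?_ (Complex.differentiable_one_div_Gamma s)) ?_
    · exact DifferentiableAt.const_cpow (by fun_prop) (Or.inl hxc)
    · exact differentiable_tsum_pow_mul_etaGamma (y := -x) (by simpa using hx) s
  intro s hs
  have hs0 : s ≠ 0 := by rintro rfl; simp at hs
  have h1 := HurwitzZeta.hasSum_hurwitzZeta_of_one_lt_re (a := x) ⟨by linarith, by linarith⟩
    (s := 1 - s) (by simp; linarith)
  have h2 := hasSum_one_div_natCast_add_sub_cpow hs hx
  -- The term n = 0 is the singular part x^{s-1}; the rest is the Taylor expansion at y = -x.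
  rw [← h1.tsum_eq, h1.summable.tsum_eq_zero_add]
  simp only [← etaBase_mul_gamma_inv hs0, ← mul_assoc, tsum_mul_right]
  have h3 : ∑' k, (-x : ℂ) ^ k * etaBase k s = ∑' n : ℕ, 1 / (((n + 1 : ℕ) : ℂ) + x) ^ (1 - s) := by
    have := h2.tsum_eq
    push_cast at this
    rw [← this]
    refine tsum_congr fun n => ?_
    push_cast
    rw [sub_neg_eq_add]
  rw [h3, ← neg_sub 1 s, Complex.cpow_neg]
  push_cast
  rw [zero_add]
  ring

/-! ### The Tornheim series in its region of absolute convergence -/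

/-- For n ≤ m the sum m + n is comparable to m, so the exponents are a + c on m and b on n. Since
n^δ ≤ m^δ, an amount δ can be moved from m to n to make both exceed 1. -/
theorem exists_bound_tornheim_half {a b c : ℝ} (h1 : 1 < a + c) (h2 : 2 < a + b + c) :
    ∃ K x y : ℝ, 0 ≤ K ∧ 1 < x ∧ 1 < y ∧ ∀ m n : ℝ, 1 ≤ n → n ≤ m →
      m ^ (-a) * n ^ (-b) * (m + n) ^ (-c) ≤ K * (m ^ (-x) * n ^ (-y)) := by
  -- The lower bounds give δ > 0 and b + δ > 1, the upper bound gives a + c - δ > 1; the two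
  -- hypotheses are exactly what leaves room.
  obtain ⟨δ, hδ1, hδ2⟩ : ∃ δ, max 0 (1 - b) < δ ∧ δ < a + c - 1 :=
    exists_between (max_lt (by linarith) (by linarith))
  have hδ0 : 0 < δ := (le_max_left _ _).trans_lt hδ1
  have hδb : 1 - b < δ := (le_max_right _ _).trans_lt hδ1
  refine ⟨2 ^ |c|, a + c - δ, b + δ, by positivity, by linarith, by linarith, fun m n hn hnm => ?_⟩
  have hn0 : 0 < n := by linarith
  have hm0 : 0 < m := by linarith
  have hsum : (m + n) ^ (-c) ≤ 2 ^ |c| * m ^ (-c) := by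
    rcases le_or_gt 0 c with hc | hc
    · calc (m + n) ^ (-c) ≤ m ^ (-c) :=
            Real.rpow_le_rpow_of_nonpos hm0 (by linarith) (by linarith)
        _ ≤ 2 ^ |c| * m ^ (-c) := le_mul_of_one_le_left (by positivity)
            (Real.one_le_rpow one_le_two (abs_nonneg c))
    · rw [abs_of_neg hc, ← Real.mul_rpow zero_le_two hm0.le]
      exact Real.rpow_le_rpow (by positivity) (by linarith) (by linarith)
  have hδmn : n ^ δ ≤ m ^ δ := Real.rpow_le_rpow hn0.le hnm hδ0.le
  have e1 : n ^ (-b) = n ^ (-(b + δ)) * n ^ δ := by rw [← Real.rpow_add hn0]; ring_nf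
  have e2 : m ^ (-(a + c - δ)) = m ^ (-a) * m ^ (-c) * m ^ δ := by
    rw [← Real.rpow_add hm0, ← Real.rpow_add hm0]; ring_nf
  calc m ^ (-a) * n ^ (-b) * (m + n) ^ (-c)
      ≤ m ^ (-a) * (n ^ (-(b + δ)) * m ^ δ) * (2 ^ |c| * m ^ (-c)) := by
        rw [e1]; gcongr
    _ = _ := by rw [e2]; ring

theorem summable_rpow_neg_succ {x : ℝ} (hx : 1 < x) :
    Summable fun n : ℕ => ((n : ℝ) + 1) ^ (-x) := by
  have := (summable_nat_add_iff 1).2 (Real.summable_nat_rpow.2 (by linarith : -x < -1))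
  simpa using this

theorem summable_tornheim_real {a b c : ℝ} (h1 : 1 < a + c) (h2 : 1 < b + c)
    (h3 : 2 < a + b + c) : Summable fun i : ℕ × ℕ =>
      ((i.1 : ℝ) + 1) ^ (-a) * ((i.2 : ℝ) + 1) ^ (-b)
        * (((i.1 : ℝ) + 1) + ((i.2 : ℝ) + 1)) ^ (-c) := by
  obtain ⟨K, x, y, hK, hx, hy, hb⟩ := exists_bound_tornheim_half h1 h3
  obtain ⟨K', x', y', hK', hx', hy', hb'⟩ := exists_bound_tornheim_half (a := b) (b := a) (c := c)
    h2 (by linarith)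
  have s1 := ((summable_rpow_neg_succ hx).mul_of_nonneg (summable_rpow_neg_succ hy)
    (fun _ => by positivity) (fun _ => by positivity)).mul_left K
  have s2 := ((summable_rpow_neg_succ hy').mul_of_nonneg (summable_rpow_neg_succ hx')
    (fun _ => by positivity) (fun _ => by positivity)).mul_left K'
  refine Summable.of_nonneg_of_le (fun _ => by positivity) (fun i => ?_) (s1.add s2)
  have p1 : (1 : ℝ) ≤ (i.1 : ℝ) + 1 := by simp
  have p2 : (1 : ℝ) ≤ (i.2 : ℝ) + 1 := by simp
  rcases le_total ((i.2 : ℝ) + 1) ((i.1 : ℝ) + 1) with h | h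
  · exact (hb _ _ p2 h).trans (le_add_of_nonneg_right (by positivity))
  · have := hb' _ _ p1 h
    rw [add_comm ((i.2 : ℝ) + 1), mul_comm (((i.2 : ℝ) + 1) ^ (-b)),
      mul_comm (((i.2 : ℝ) + 1) ^ (-x'))] at this
    exact this.trans (le_add_of_nonneg_left (by positivity))

theorem seriesTerm_eq (s t u : ℂ) (i : ℕ × ℕ) : seriesTerm s t u i =
    ((i.1 + 1 : ℕ) : ℂ) ^ (-s) * ((i.2 + 1 : ℕ) : ℂ) ^ (-t)
      * (((i.1 + 1) + (i.2 + 1) : ℕ) : ℂ) ^ (-u) := by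
  simp only [seriesTerm, Complex.cpow_neg, one_div, mul_inv]

theorem norm_seriesTerm (s t u : ℂ) (i : ℕ × ℕ) : ‖seriesTerm s t u i‖ =
    ((i.1 : ℝ) + 1) ^ (-s.re) * ((i.2 : ℝ) + 1) ^ (-t.re)
        * (((i.1 : ℝ) + 1) + ((i.2 : ℝ) + 1)) ^ (-u.re) := by
  rw [seriesTerm_eq, norm_mul, norm_mul, Complex.norm_natCast_cpow_of_pos (by omega),
    Complex.norm_natCast_cpow_of_pos (by omega), Complex.norm_natCast_cpow_of_pos (by omega)]
  push_cast
  rfl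

/-- The sum of the Tornheim series. -/
def seriesSum (p : ℂ × ℂ × ℂ) : ℂ := ∑' i, seriesTerm p.1 p.2.1 p.2.2 i

theorem mem_convergenceRegion {p : ℂ × ℂ × ℂ} : p ∈ convergenceRegion ↔
    1 < (p.1 + p.2.2).re ∧ 1 < (p.2.1 + p.2.2).re ∧ 2 < (p.1 + p.2.1 + p.2.2).re := Iff.rfl

theorem hasSum_seriesTerm {p : ℂ × ℂ × ℂ} (hp : p ∈ convergenceRegion) :
    HasSum (seriesTerm p.1 p.2.1 p.2.2) (seriesSum p) := by
  obtain ⟨h1, h2, h3⟩ := mem_convergenceRegion.1 hp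
  simp only [Complex.add_re] at h1 h2 h3
  refine (Summable.of_norm ?_).hasSum
  simpa only [norm_seriesTerm] using summable_tornheim_real h1 h2 h3

theorem isOpen_convergenceRegion : IsOpen convergenceRegion := by
  have h1 : Continuous fun p : ℂ × ℂ × ℂ => (p.1 + p.2.2).re := by fun_prop
  have h2 : Continuous fun p : ℂ × ℂ × ℂ => (p.2.1 + p.2.2).re := by fun_prop
  have h3 : Continuous fun p : ℂ × ℂ × ℂ => (p.1 + p.2.1 + p.2.2).re := by fun_prop
  exact (isOpen_lt continuous_const h1).inter
    ((isOpen_lt continuous_const h2).inter (isOpen_lt continuous_const h3))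

theorem convex_convergenceRegion : Convex ℝ convergenceRegion := by
  intro p hp q hq a b ha hb hab
  obtain ⟨h1, h2, h3⟩ := mem_convergenceRegion.1 hp
  obtain ⟨h4, h5, h6⟩ := mem_convergenceRegion.1 hq
  rw [mem_convergenceRegion]
  simp only [Prod.fst_add, Prod.snd_add, Prod.smul_fst, Prod.smul_snd, Complex.add_re,
    Complex.real_smul, Complex.re_ofReal_mul] at *
  have hb' : b = 1 - a := by linarith
  have key : ∀ X Y C : ℝ, C < X → C < Y → C < a * X + b * Y := by
    intro X Y C hX hY
    rcases eq_or_lt_of_le ha with h | h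
    · rw [← h] at hb' ⊢
      rw [hb']
      linarith
    · have e : C = a * C + b * C := by rw [← add_mul, hab, one_mul]
      rw [e]
      exact add_lt_add_of_lt_of_le (by gcongr) (by gcongr)
  have k1 := key _ _ _ h1 h4
  have k2 := key _ _ _ h2 h5
  have k3 := key _ _ _ h3 h6
  refine ⟨?_, ?_, ?_⟩ <;> linarith

theorem differentiable_natCast_cpow {n : ℕ} (hn : n ≠ 0) {f : ℂ × ℂ × ℂ → ℂ}
    (hf : Differentiable ℂ f) : Differentiable ℂ fun p => (n : ℂ) ^ f p :=
  hf.const_cpow (Or.inl (by exact_mod_cast hn))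

theorem differentiableOn_seriesSum : DifferentiableOn ℂ seriesSum convergenceRegion := by
  refine differentiableOn_tsum_of_locally_bounded isOpen_convergenceRegion
    (f := fun i p => seriesTerm p.1 p.2.1 p.2.2 i) (fun i => ?_) fun p hp => ?_
  · simp only [seriesTerm_eq]
    exact (((differentiable_natCast_cpow (by omega) (by fun_prop)).mul
      (differentiable_natCast_cpow (by omega) (by fun_prop))).mul
      (differentiable_natCast_cpow (by omega) (by fun_prop))).differentiableOn
  · obtain ⟨h1, h2, h3⟩ := mem_convergenceRegion.1 hp
    simp only [Complex.add_re] at h1 h2 h3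
    -- Lowering each real part by ε costs at most 3ε in each condition. All bases are at least 1, so
    -- the terms with lowered exponents dominate those at nearby points.
    obtain ⟨ε, hε0, hε⟩ : ∃ ε : ℝ, 0 < ε ∧ 3 * ε < min (min (p.1.re + p.2.2.re - 1)
        (p.2.1.re + p.2.2.re - 1)) (p.1.re + p.2.1.re + p.2.2.re - 2) := by
      set m := min (min (p.1.re + p.2.2.re - 1) (p.2.1.re + p.2.2.re - 1))
        (p.1.re + p.2.1.re + p.2.2.re - 2) with hm
      have hm0 : 0 < m := lt_min (lt_min (by linarith) (by linarith)) (by linarith)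
      exact ⟨m / 4, by positivity, by linarith⟩
    have hε1 := hε.trans_le ((min_le_left _ _).trans (min_le_left _ _))
    have hε2 := hε.trans_le ((min_le_left _ _).trans (min_le_right _ _))
    have hε3 := hε.trans_le (min_le_right _ _)
    refine ⟨_, summable_tornheim_real (a := p.1.re - ε) (b := p.2.1.re - ε) (c := p.2.2.re - ε)
      (by linarith) (by linarith) (by linarith), ?_⟩
    have c1 : Continuous fun q : ℂ × ℂ × ℂ => q.1.re := by fun_prop
    have c2 : Continuous fun q : ℂ × ℂ × ℂ => q.2.1.re := by fun_prop
    have c3 : Continuous fun q : ℂ × ℂ × ℂ => q.2.2.re := by fun_prop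
    filter_upwards [c1.continuousAt.eventually (lt_mem_nhds (sub_lt_self p.1.re hε0)),
      c2.continuousAt.eventually (lt_mem_nhds (sub_lt_self p.2.1.re hε0)),
      c3.continuousAt.eventually (lt_mem_nhds (sub_lt_self p.2.2.re hε0))] with q q1 q2 q3 i
    rw [norm_seriesTerm]
    have p1 : (1 : ℝ) ≤ (i.1 : ℝ) + 1 := by simp
    have p2 : (1 : ℝ) ≤ (i.2 : ℝ) + 1 := by simp
    have p3 : (1 : ℝ) ≤ ((i.1 : ℝ) + 1) + ((i.2 : ℝ) + 1) := by linarith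
    gcongr

/-! ### The periodic zeta function and its triple products -/

/-- The term `e^{2π i (n+1) x} / (n+1)^s`. -/
def perTerm (s : ℂ) (x : ℝ) (n : ℕ) : ℂ :=
  Complex.exp (2 * Real.pi * Complex.I * x * (n + 1 : ℕ)) / ((n + 1 : ℕ) : ℂ) ^ s

/-- The periodic zeta function `∑ e^{2π i m x} / m^s`. -/
def perZeta (s : ℂ) (x : ℝ) : ℂ := ∑' n, perTerm s x n

theorem norm_perTerm (s : ℂ) (x : ℝ) (n : ℕ) : ‖perTerm s x n‖ = ((n : ℝ) + 1) ^ (-s.re) := by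
  have h : 2 * Real.pi * Complex.I * x * (n + 1 : ℕ)
      = ((2 * Real.pi * x * (n + 1 : ℕ) : ℝ) : ℂ) * Complex.I := by
    push_cast
    ring
  rw [perTerm, norm_div, h, Complex.norm_exp_ofReal_mul_I,
    Complex.norm_natCast_cpow_of_pos n.succ_pos, Real.rpow_neg (by positivity), one_div]
  push_cast
  rfl

theorem continuous_perTerm (s : ℂ) (n : ℕ) : Continuous fun x => perTerm s x n := by
  unfold perTerm
  fun_prop

theorem continuous_perZeta {s : ℂ} (hs : 1 < s.re) : Continuous (perZeta s) :=
  continuous_tsum (continuous_perTerm s) (summable_rpow_neg_succ hs)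
    fun n x => (norm_perTerm s x n).le

theorem expZeta_eq_perZeta {s : ℂ} (hs : 1 < s.re) (x : ℝ) :
    HurwitzZeta.expZeta x s = perZeta s x := by
  have h := HurwitzZeta.hasSum_expZeta_of_one_lt_re x hs
  have hs0 : s ≠ 0 := by rintro rfl; simp at hs; linarith
  rw [← h.tsum_eq, h.summable.tsum_eq_zero_add]
  simp [perZeta, perTerm, Complex.zero_cpow hs0]

theorem perZeta_add_one (s : ℂ) (x : ℝ) : perZeta s (x + 1) = perZeta s x := by
  refine tsum_congr fun n => ?_
  have h : 2 * Real.pi * Complex.I * ((x + 1 : ℝ) : ℂ) * (n + 1 : ℕ)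
      = 2 * Real.pi * Complex.I * x * (n + 1 : ℕ) + ((n + 1 : ℕ) : ℂ) * (2 * Real.pi * Complex.I) := by
    push_cast
    ring
  rw [perTerm, perTerm, h, Complex.exp_add, Complex.exp_nat_mul_two_pi_mul_I, mul_one]

theorem integral_exp_two_pi_int (N : ℤ) :
    ∫ x in (0 : ℝ)..1, Complex.exp (2 * Real.pi * Complex.I * N * x) = if N = 0 then 1 else 0 := by
  split_ifs with h
  · simp [h]
  · have hc : 2 * Real.pi * Complex.I * N ≠ 0 := by
      have : (N : ℂ) ≠ 0 := by exact_mod_cast h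
      have := Complex.two_pi_I_ne_zero
      positivity
    rw [integral_exp_mul_complex hc]
    have : 2 * Real.pi * Complex.I * N * (1 : ℝ) = N * (2 * Real.pi * Complex.I) := by
      push_cast
      ring
    rw [this, Complex.exp_int_mul_two_pi_mul_I]
    simp

/-- Absolute convergence permits termwise integration, and orthogonality of the exponentials keeps
only the vanishing total frequencies. -/
theorem integral_perZeta_mul_mul {s t u : ℂ} (hs : 1 < s.re) (ht : 1 < t.re) (hu : 1 < u.re)
    (a b c : ℤ) :
    ∫ x in (0 : ℝ)..1, perZeta s (a * x) * perZeta t (b * x) * perZeta u (c * x) =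
      ∑' i : ℕ × ℕ × ℕ, if a * (i.1 + 1) + b * (i.2.1 + 1) + c * (i.2.2 + 1) = 0 then
        1 / (((i.1 + 1 : ℕ) : ℂ) ^ s * ((i.2.1 + 1 : ℕ) : ℂ) ^ t * ((i.2.2 + 1 : ℕ) : ℂ) ^ u)
      else 0 := by
  set f : ℕ × ℕ × ℕ → ℝ → ℂ := fun i x =>
    perTerm s (a * x) i.1 * (perTerm t (b * x) i.2.1 * perTerm u (c * x) i.2.2) with hf
  set B : ℕ × ℕ × ℕ → ℝ := fun i => ((i.1 : ℝ) + 1) ^ (-s.re) * (((i.2.1 : ℝ) + 1) ^ (-t.re)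
    * ((i.2.2 : ℝ) + 1) ^ (-u.re)) with hB
  have hBsum : Summable B :=
    (summable_rpow_neg_succ hs).mul_of_nonneg ((summable_rpow_neg_succ ht).mul_of_nonneg
      (summable_rpow_neg_succ hu) (fun _ => by positivity) (fun _ => by positivity))
      (fun _ => by positivity) (fun _ => by simp only [Pi.zero_apply]; positivity)
  have hfB : ∀ i x, ‖f i x‖ ≤ B i := fun i x => by
    simp only [hf, hB, norm_mul, norm_perTerm]
    exact le_rfl
  have hfsum : ∀ x, HasSum (fun i => f i x)
      (perZeta s (a * x) * perZeta t (b * x) * perZeta u (c * x)) := by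
    intro x
    have n1 : ∀ {s : ℂ}, 1 < s.re → ∀ y, Summable fun n => ‖perTerm s y n‖ := fun hs y => by
      simpa only [norm_perTerm] using summable_rpow_neg_succ hs
    have e : perZeta s (a * x) * perZeta t (b * x) * perZeta u (c * x) = ∑' i, f i x := by
      rw [mul_assoc, perZeta, perZeta, perZeta, tsum_mul_tsum_of_summable_norm (n1 ht _) (n1 hu _),
        tsum_mul_tsum_of_summable_norm (n1 hs _)]
      exact (Summable.mul_norm (n1 ht _) (n1 hu _))
    rw [e]
    exact (Summable.of_norm_bounded hBsum fun i => hfB i x).hasSum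
  have hcont : ∀ i, Continuous (f i) := fun i =>
    ((continuous_perTerm s i.1).comp (by fun_prop : Continuous fun x : ℝ => (a : ℝ) * x)).mul
      (((continuous_perTerm t i.2.1).comp (by fun_prop : Continuous fun x : ℝ => (b : ℝ) * x)).mul
        ((continuous_perTerm u i.2.2).comp (by fun_prop : Continuous fun x : ℝ => (c : ℝ) * x)))
  have key := intervalIntegral.hasSum_integral_of_dominated_convergence (a := 0) (b := 1)
    (μ := MeasureTheory.volume) (F := f) (fun i _ => B i)
    (fun i => (hcont i).aestronglyMeasurable) (fun i => .of_forall fun x _ => hfB i x)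
    (.of_forall fun x _ => hBsum) intervalIntegrable_const (.of_forall fun x _ => hfsum x)
  rw [← key.tsum_eq]
  refine tsum_congr fun i => ?_
  have hfi : ∀ x, f i x = 1 / (((i.1 + 1 : ℕ) : ℂ) ^ s * ((i.2.1 + 1 : ℕ) : ℂ) ^ t
      * ((i.2.2 + 1 : ℕ) : ℂ) ^ u) * Complex.exp (2 * Real.pi * Complex.I
        * ((a * (i.1 + 1) + b * (i.2.1 + 1) + c * (i.2.2 + 1) : ℤ) : ℂ) * x) := by
    intro x
    have e : 2 * Real.pi * Complex.I
        * ((a * (i.1 + 1) + b * (i.2.1 + 1) + c * (i.2.2 + 1) : ℤ) : ℂ) * x =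
        2 * Real.pi * Complex.I * ((a * x : ℝ) : ℂ) * (i.1 + 1 : ℕ) +
        (2 * Real.pi * Complex.I * ((b * x : ℝ) : ℂ) * (i.2.1 + 1 : ℕ) +
        2 * Real.pi * Complex.I * ((c * x : ℝ) : ℂ) * (i.2.2 + 1 : ℕ)) := by
      push_cast
      ring
    rw [e, Complex.exp_add, Complex.exp_add]
    simp only [hf, perTerm, div_eq_mul_inv, mul_inv]
    ring
  simp only [hfi]
  rw [intervalIntegral.integral_const_mul, integral_exp_two_pi_int]
  split_ifs <;> simp

theorem integral_perZeta_eq_zero {s t u : ℂ} (hs : 1 < s.re) (ht : 1 < t.re) (hu : 1 < u.re)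
    {ε : ℤ} (hε : ε ≠ 0) :
    ∫ x in (0 : ℝ)..1, perZeta s (ε * x) * perZeta t (ε * x) * perZeta u (ε * x) = 0 := by
  rw [integral_perZeta_mul_mul hs ht hu]
  refine (tsum_congr fun i => if_neg ?_).trans tsum_zero
  rw [← mul_add, ← mul_add]
  exact mul_ne_zero hε (by omega)

theorem integral_perZeta_eq_seriesSum {s t u : ℂ} (hs : 1 < s.re) (ht : 1 < t.re) (hu : 1 < u.re)
    {ε : ℤ} (hε : ε ≠ 0) :
    ∫ x in (0 : ℝ)..1, perZeta s (ε * x) * perZeta t (ε * x) * perZeta u ((-ε : ℤ) * x)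
      = seriesSum (s, t, u) := by
  rw [integral_perZeta_mul_mul hs ht hu, seriesSum]
  -- The indices are shifted by one: k = m + n with m = i.1 + 1 and n = i.2 + 1 means that the third
  -- index is i.1 + i.2 + 1.
  have hinj : Function.Injective fun i : ℕ × ℕ => (i.1, i.2, i.1 + i.2 + 1) := by
    rintro ⟨a, b⟩ ⟨c, d⟩ h
    simp only [Prod.mk.injEq] at h
    exact Prod.ext h.1 h.2.1
  have hiff : ∀ i : ℕ × ℕ × ℕ, ε * ((i.1 : ℤ) + 1) + ε * (i.2.1 + 1) + -ε * (i.2.2 + 1) = 0 ↔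
      i.2.2 = i.1 + i.2.1 + 1 := by
    intro i
    have e : ε * ((i.1 : ℤ) + 1) + ε * (i.2.1 + 1) + -ε * (i.2.2 + 1)
        = ε * (i.1 + i.2.1 + 1 - i.2.2) := by ring
    rw [e, mul_eq_zero, or_iff_right hε]
    omega
  rw [← hinj.tsum_eq]
  · refine tsum_congr fun i => ?_
    rw [if_pos ((hiff _).2 rfl), seriesTerm]
    congr 4
    push_cast
    ring
  · intro i hi
    rw [Function.mem_support] at hi
    have h : i.2.2 = i.1 + i.2.1 + 1 := by
      by_contra h
      exact hi (if_neg fun h' => h ((hiff i).1 h'))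
    exact ⟨(i.1, i.2.1), by simp [← h]⟩

/-! ### Integrals of triple products of Hurwitz zeta functions -/

/-- Of the eight products, the two with equal signs integrate to 0, since a sum of three positive
integers is not 0. The other six pair up according to which factor carries the opposite sign, one
pair for each Tornheim series. -/
theorem integral_triple_product {s t u : ℂ} (hs : 1 < s.re) (ht : 1 < t.re) (hu : 1 < u.re)
    (a a' b b' c c' : ℂ) :
    ∫ x in (0 : ℝ)..1, (a * perZeta s x + a' * perZeta s (-x)) *
        (b * perZeta t x + b' * perZeta t (-x)) * (c * perZeta u x + c' * perZeta u (-x)) =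
      (a * b * c' + a' * b' * c) * seriesSum (s, t, u)
        + (a * b' * c + a' * b * c') * seriesSum (u, s, t)
        + (a' * b * c + a * b' * c') * seriesSum (t, u, s) := by
  have cs := continuous_perZeta hs
  have ct := continuous_perZeta ht
  have cu := continuous_perZeta hu
  have z1 := integral_perZeta_eq_zero hs ht hu (ε := 1) one_ne_zero
  have z2 := integral_perZeta_eq_zero hs ht hu (ε := -1) (by norm_num)
  have s1 := integral_perZeta_eq_seriesSum hs ht hu (ε := 1) one_ne_zero
  have s2 := integral_perZeta_eq_seriesSum hs ht hu (ε := -1) (by norm_num)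
  have s3 := integral_perZeta_eq_seriesSum hu hs ht (ε := 1) one_ne_zero
  have s4 := integral_perZeta_eq_seriesSum hu hs ht (ε := -1) (by norm_num)
  have s5 := integral_perZeta_eq_seriesSum ht hu hs (ε := 1) one_ne_zero
  have s6 := integral_perZeta_eq_seriesSum ht hu hs (ε := -1) (by norm_num)
  simp only [Int.cast_one, Int.cast_neg, one_mul, neg_mul, neg_neg] at z1 z2 s1 s2 s3 s4 s5 s6
  have e : ∀ x : ℝ, (a * perZeta s x + a' * perZeta s (-x)) *
        (b * perZeta t x + b' * perZeta t (-x)) * (c * perZeta u x + c' * perZeta u (-x)) =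
      a * b * c * (perZeta s x * perZeta t x * perZeta u x)
      + a' * b' * c' * (perZeta s (-x) * perZeta t (-x) * perZeta u (-x))
      + a * b * c' * (perZeta s x * perZeta t x * perZeta u (-x))
      + a' * b' * c * (perZeta s (-x) * perZeta t (-x) * perZeta u x)
      + a * b' * c * (perZeta u x * perZeta s x * perZeta t (-x))
      + a' * b * c' * (perZeta u (-x) * perZeta s (-x) * perZeta t x)
      + a' * b * c * (perZeta t x * perZeta u x * perZeta s (-x))
      + a * b' * c' * (perZeta t (-x) * perZeta u (-x) * perZeta s x) := fun x => by ring
  simp only [e]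
  rw [intervalIntegral.integral_add, intervalIntegral.integral_add, intervalIntegral.integral_add,
    intervalIntegral.integral_add, intervalIntegral.integral_add, intervalIntegral.integral_add,
    intervalIntegral.integral_add]
  · simp only [intervalIntegral.integral_const_mul, z1, z2, s1, s2, s3, s4, s5, s6]
    ring
  all_goals exact Continuous.intervalIntegrable (by fun_prop) _ _

/-- The function `ζ(1 - s, x) / Γ(s)`, by Hurwitz's formula. -/
def hurwitzNorm (s : ℂ) (x : ℝ) : ℂ :=
  (2 * Real.pi : ℂ) ^ (-s) * (Complex.exp (-(Real.pi * Complex.I * s / 2)) * perZeta s x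
    + Complex.exp (Real.pi * Complex.I * s / 2) * perZeta s (-x))

theorem continuous_hurwitzNorm {s : ℂ} (hs : 1 < s.re) : Continuous (hurwitzNorm s) := by
  have cs := continuous_perZeta hs
  unfold hurwitzNorm
  fun_prop

theorem hurwitzNorm_add_one (s : ℂ) (x : ℝ) : hurwitzNorm s (x + 1) = hurwitzNorm s x := by
  have h : perZeta s (-(x + 1)) = perZeta s (-x) := by
    rw [← perZeta_add_one s (-(x + 1))]
    ring_nf
  rw [hurwitzNorm, hurwitzNorm, perZeta_add_one, h]

theorem hurwitzNorm_eq {s : ℂ} (hs : 1 < s.re) (x : ℝ) :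
    hurwitzNorm s x = (Complex.Gamma s)⁻¹ * HurwitzZeta.hurwitzZeta x (1 - s) := by
  have hne : ∀ n : ℕ, s ≠ -n := fun n h => by
    rw [h] at hs
    simp at hs
    linarith [(n.cast_nonneg : (0 : ℝ) ≤ n)]
  have hs1 : s ≠ 1 := by rintro rfl; simp at hs
  have hG : Complex.Gamma s ≠ 0 := Complex.Gamma_ne_zero hne
  rw [HurwitzZeta.hurwitzZeta_one_sub _ hne (Or.inr hs1), ← AddCircle.coe_neg,
    expZeta_eq_perZeta hs, expZeta_eq_perZeta hs, hurwitzNorm]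
  field_simp

theorem e_eq_exp_sq (s : ℂ) : e s = Complex.exp (-(Real.pi * Complex.I * s / 2)) ^ 2 := by
  rw [e, ← Complex.exp_nat_mul]
  congr 1
  push_cast
  ring

theorem e_add (s t : ℂ) : e (s + t) = e s * e t := by
  rw [e, e, e, ← Complex.exp_add]
  congr 1
  ring

theorem gNum_eq (s t u : ℂ) : gNum (s, t, u) = Complex.exp (-(Real.pi * Complex.I * s / 2))
    * Complex.exp (-(Real.pi * Complex.I * t / 2)) * Complex.exp (-(Real.pi * Complex.I * u / 2))
    * ((2 * Real.pi : ℂ) ^ s * (2 * Real.pi : ℂ) ^ t * (2 * Real.pi : ℂ) ^ u) := by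
  simp only [gNum]
  rw [Complex.cpow_add _ _ complex_two_pi_ne_zero, Complex.cpow_add _ _ complex_two_pi_ne_zero,
    ← Complex.exp_add, ← Complex.exp_add]
  congr 2
  ring

theorem two_pi_cpow_ne_zero (z : ℂ) : (2 * Real.pi : ℂ) ^ z ≠ 0 := by
  simp [Complex.cpow_eq_zero_iff]

theorem gNum_mul_integral_same {s t u : ℂ} (hs : 1 < s.re) (ht : 1 < t.re) (hu : 1 < u.re) :
    gNum (s, t, u) * ∫ x in (0 : ℝ)..1, hurwitzNorm s x * hurwitzNorm t x * hurwitzNorm u x =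
      (e u + e (s + t)) * seriesSum (s, t, u) + (e t + e (u + s)) * seriesSum (u, s, t)
        + (e s + e (t + u)) * seriesSum (t, u, s) := by
  have h1 := integral_triple_product hs ht hu (Complex.exp (-(Real.pi * Complex.I * s / 2)))
    (Complex.exp (Real.pi * Complex.I * s / 2)) (Complex.exp (-(Real.pi * Complex.I * t / 2)))
    (Complex.exp (Real.pi * Complex.I * t / 2)) (Complex.exp (-(Real.pi * Complex.I * u / 2)))
    (Complex.exp (Real.pi * Complex.I * u / 2))
  have h2 : ∀ x, hurwitzNorm s x * hurwitzNorm t x * hurwitzNorm u x =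
      (2 * Real.pi : ℂ) ^ (-s) * (2 * Real.pi : ℂ) ^ (-t) * (2 * Real.pi : ℂ) ^ (-u) *
      ((Complex.exp (-(Real.pi * Complex.I * s / 2)) * perZeta s x
        + Complex.exp (Real.pi * Complex.I * s / 2) * perZeta s (-x)) *
      (Complex.exp (-(Real.pi * Complex.I * t / 2)) * perZeta t x
        + Complex.exp (Real.pi * Complex.I * t / 2) * perZeta t (-x)) *
      (Complex.exp (-(Real.pi * Complex.I * u / 2)) * perZeta u x
        + Complex.exp (Real.pi * Complex.I * u / 2) * perZeta u (-x))) := fun x => by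
    simp only [hurwitzNorm]; ring
  simp only [h2]
  rw [intervalIntegral.integral_const_mul, h1, gNum_eq]
  simp only [e_add]
  simp only [e_eq_exp_sq, Complex.exp_neg, Complex.cpow_neg]
  clear h1 h2
  have := two_pi_cpow_ne_zero s
  have := two_pi_cpow_ne_zero t
  have := two_pi_cpow_ne_zero u
  have := Complex.exp_ne_zero (Real.pi * Complex.I * s / 2)
  have := Complex.exp_ne_zero (Real.pi * Complex.I * t / 2)
  have := Complex.exp_ne_zero (Real.pi * Complex.I * u / 2)
  generalize (2 * Real.pi : ℂ) ^ s = A at *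
  generalize (2 * Real.pi : ℂ) ^ t = B at *
  generalize (2 * Real.pi : ℂ) ^ u = C at *
  generalize Complex.exp (Real.pi * Complex.I * s / 2) = a at *
  generalize Complex.exp (Real.pi * Complex.I * t / 2) = b at *
  generalize Complex.exp (Real.pi * Complex.I * u / 2) = c at *
  field_simp
  ring

/-- Reversing the argument of the third factor exchanges its two phases e^{±πiu/2}, which turns the
coefficients of S₂ into those of S₁. -/
theorem gNum_mul_integral_opposite {s t u : ℂ} (hs : 1 < s.re) (ht : 1 < t.re) (hu : 1 < u.re) :
    gNum (s, t, u) * ∫ x in (0 : ℝ)..1, hurwitzNorm s x * hurwitzNorm t x * hurwitzNorm u (-x) =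
      (1 + e (s + t + u)) * seriesSum (s, t, u) + (e s + e (u + t)) * seriesSum (u, s, t)
        + (e t + e (u + s)) * seriesSum (t, u, s) := by
  have h1 := integral_triple_product hs ht hu (Complex.exp (-(Real.pi * Complex.I * s / 2)))
    (Complex.exp (Real.pi * Complex.I * s / 2)) (Complex.exp (-(Real.pi * Complex.I * t / 2)))
    (Complex.exp (Real.pi * Complex.I * t / 2)) (Complex.exp (Real.pi * Complex.I * u / 2))
    (Complex.exp (-(Real.pi * Complex.I * u / 2)))
  have h2 : ∀ x, hurwitzNorm s x * hurwitzNorm t x * hurwitzNorm u (-x) =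
      (2 * Real.pi : ℂ) ^ (-s) * (2 * Real.pi : ℂ) ^ (-t) * (2 * Real.pi : ℂ) ^ (-u) *
      ((Complex.exp (-(Real.pi * Complex.I * s / 2)) * perZeta s x
        + Complex.exp (Real.pi * Complex.I * s / 2) * perZeta s (-x)) *
      (Complex.exp (-(Real.pi * Complex.I * t / 2)) * perZeta t x
        + Complex.exp (Real.pi * Complex.I * t / 2) * perZeta t (-x)) *
      (Complex.exp (Real.pi * Complex.I * u / 2) * perZeta u x
        + Complex.exp (-(Real.pi * Complex.I * u / 2)) * perZeta u (-x))) := fun x => by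
    simp only [hurwitzNorm, neg_neg]; ring
  simp only [h2]
  rw [intervalIntegral.integral_const_mul, h1, gNum_eq]
  simp only [e_add]
  simp only [e_eq_exp_sq, Complex.exp_neg, Complex.cpow_neg]
  clear h1 h2
  have := two_pi_cpow_ne_zero s
  have := two_pi_cpow_ne_zero t
  have := two_pi_cpow_ne_zero u
  have := Complex.exp_ne_zero (Real.pi * Complex.I * s / 2)
  have := Complex.exp_ne_zero (Real.pi * Complex.I * t / 2)
  have := Complex.exp_ne_zero (Real.pi * Complex.I * u / 2)
  generalize (2 * Real.pi : ℂ) ^ s = A at *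
  generalize (2 * Real.pi : ℂ) ^ t = B at *
  generalize (2 * Real.pi : ℂ) ^ u = C at *
  generalize Complex.exp (Real.pi * Complex.I * s / 2) = a at *
  generalize Complex.exp (Real.pi * Complex.I * t / 2) = b at *
  generalize Complex.exp (Real.pi * Complex.I * u / 2) = c at *
  field_simp
  ring

theorem integral_zero_one_eq_half {f : ℝ → ℂ} (hf : Continuous f) (hp : ∀ x, f (x + 1) = f x) :
    ∫ x in (0 : ℝ)..1, f x = (∫ x in (0 : ℝ)..(1 / 2), f x) + ∫ x in (0 : ℝ)..(1 / 2), f (-x) := by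
  have h1 := intervalIntegral.integral_add_adjacent_intervals
    (hf.intervalIntegrable (μ := MeasureTheory.volume) 0 (1 / 2)) (hf.intervalIntegrable (1 / 2) 1)
  rw [← h1]
  congr 1
  have h2 : ∀ x, f (-x) = f (1 - x) := fun x => by rw [← hp (-x)]; congr 1; ring
  simp only [h2]
  rw [intervalIntegral.integral_comp_sub_left]
  norm_num

/-! ### Expansion near the end points -/

/-- The power series `∑ c^{-k} binom(k - s, k) ζ(k + 1 - s) / Γ(s) (2x)^k`. -/
def tailSeries (c s : ℂ) (x : ℝ) : ℂ :=
  ∑' k : ℕ, c ^ (-(k : ℤ)) * etaGamma k s * ((2 * x : ℝ) : ℂ) ^ k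

/-- The function `x^{s-1} / Γ(s)`. -/
def headTerm (s : ℂ) (x : ℝ) : ℂ := (x : ℂ) ^ (s - 1) * (Complex.Gamma s)⁻¹

theorem hurwitzNorm_neg_eq_tailSeries {s : ℂ} (hs : 1 < s.re) {x : ℝ} (h0 : 0 < x)
    (h1 : x ≤ 1 / 2) : hurwitzNorm s (-x) = tailSeries 2 s x := by
  have hs0 : s ≠ 0 := by rintro rfl; simp at hs; linarith
  rw [hurwitzNorm_eq hs, gamma_inv_mul_hurwitzZeta_neg hs0 h0.le (by linarith)]
  refine tsum_congr fun k => ?_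
  push_cast
  rw [mul_pow, zpow_neg, zpow_natCast]
  field_simp

theorem hurwitzNorm_eq_headTerm_add {s : ℂ} (hs : 1 < s.re) {x : ℝ} (h0 : 0 < x)
    (h1 : x ≤ 1 / 2) : hurwitzNorm s x = headTerm s x + tailSeries (-2) s x := by
  have hs0 : s ≠ 0 := by rintro rfl; simp at hs; linarith
  rw [hurwitzNorm_eq hs, gamma_inv_mul_hurwitzZeta hs0 h0 (by linarith), headTerm]
  congr 1
  refine tsum_congr fun k => ?_
  push_cast
  have e : (-x : ℂ) = (-2 : ℂ)⁻¹ * (2 * x) := by ring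
  rw [e, mul_pow, inv_pow, zpow_neg, zpow_natCast]
  ring

theorem summable_norm_etaGamma {c : ℂ} (hc : ‖c‖ = 2) (s : ℂ) :
    Summable fun k : ℕ => ‖c ^ (-(k : ℤ)) * etaGamma k s‖ := by
  obtain ⟨C, hC0, hC⟩ := exists_bound_etaGamma_weighted hc ‖s‖ (r := 3 / 4) (by norm_num)
  exact Summable.of_nonneg_of_le (fun _ => norm_nonneg _) (fun k => hC k s le_rfl)
    (summable_pow_id.mul_left C)

theorem norm_mul_pow_le {x : ℝ} (h0 : 0 ≤ x) (h1 : x ≤ 1 / 2) (z : ℂ) (k : ℕ) :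
    ‖z * ((2 * x : ℝ) : ℂ) ^ k‖ ≤ ‖z‖ := by
  rw [norm_mul, norm_pow, Complex.norm_real, Real.norm_of_nonneg (by positivity)]
  exact mul_le_of_le_one_right (norm_nonneg _) (pow_le_one₀ (by positivity) (by linarith))

theorem continuousOn_tailSeries {c : ℂ} (hc : ‖c‖ = 2) (s : ℂ) :
    ContinuousOn (tailSeries c s) (Icc 0 (1 / 2)) :=
  continuousOn_tsum (fun k => by fun_prop) (summable_norm_etaGamma hc s)
    fun k x hx => norm_mul_pow_le hx.1 hx.2 _ k

theorem continuous_headTerm {s : ℂ} (hs : 1 < s.re) : Continuous (headTerm s) :=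
  (Complex.continuous_ofReal_cpow_const (by simpa using hs)).mul continuous_const

/-- Termwise integration of `x^α ∑ c_i (2x)^{d_i}` over `[0, 1/2]`. -/
theorem integral_cpow_mul_tsum {ι : Type*} [Countable ι] {α : ℂ} (hα : 0 ≤ α.re) {c : ι → ℂ}
    (hc : Summable fun i => ‖c i‖) (d : ι → ℕ) {f : ℝ → ℂ}
    (hf : ∀ x ∈ Ioc (0 : ℝ) (1 / 2), f x = (x : ℂ) ^ α * ∑' i, c i * ((2 * x : ℝ) : ℂ) ^ d i) :
    ∫ x in (0 : ℝ)..(1 / 2), f x = ∑' i, c i * (2 : ℂ) ^ (-α - 1) / (α + 1 + d i) := by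
  set F : ι → ℝ → ℂ := fun i x => (x : ℂ) ^ α * (c i * ((2 * x : ℝ) : ℂ) ^ d i) with hF
  have hI : uIoc (0 : ℝ) (1 / 2) = Ioc 0 (1 / 2) := uIoc_of_le (by norm_num)
  have hFc : ∀ x ∈ Ioc (0 : ℝ) (1 / 2), ∀ i, ‖F i x‖ ≤ ‖c i‖ := by
    intro x hx i
    simp only [hF]
    rw [norm_mul]
    refine (mul_le_of_le_one_left (norm_nonneg _) ?_).trans (norm_mul_pow_le hx.1.le hx.2 _ _)
    rw [Complex.norm_cpow_eq_rpow_re_of_pos hx.1]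
    exact Real.rpow_le_one hx.1.le (by linarith [hx.2]) hα
  have key := intervalIntegral.hasSum_integral_of_dominated_convergence (a := 0) (b := 1 / 2)
    (μ := MeasureTheory.volume) (F := F) (f := f) (fun i _ => ‖c i‖)
    (fun i => by
      refine Measurable.aestronglyMeasurable ?_
      have : Measurable fun x : ℝ => (x : ℂ) ^ α := Complex.measurable_ofReal.pow_const α
      fun_prop)
    (fun i => .of_forall fun x hx => hFc x (hI ▸ hx) i)
    (.of_forall fun x _ => hc) intervalIntegrable_const
    (.of_forall fun x hx => by
      rw [hI] at hx
      rw [hf x hx]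
      refine (Summable.hasSum ?_).mul_left _
      exact Summable.of_norm_bounded hc fun i => norm_mul_pow_le hx.1.le hx.2 _ _)
  rw [← key.tsum_eq]
  refine tsum_congr fun i => ?_
  have hne : α + d i + 1 ≠ 0 := fun h => by
    have := congrArg Complex.re h
    simp at this
    linarith [((d i).cast_nonneg : (0 : ℝ) ≤ d i)]
  have h1 : ∀ x ∈ uIoc (0 : ℝ) (1 / 2), F i x = c i * 2 ^ d i * (x : ℂ) ^ (α + d i) := by
    intro x hx
    rw [hI] at hx
    have hx0 : (x : ℂ) ≠ 0 := by exact_mod_cast hx.1.ne'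
    simp only [hF]
    rw [Complex.cpow_add _ _ hx0, Complex.cpow_natCast]
    push_cast
    ring
  rw [intervalIntegral.integral_congr_ae (.of_forall h1), intervalIntegral.integral_const_mul,
    integral_cpow (Or.inl (by
      simp only [Complex.add_re, Complex.natCast_re]
      linarith [((d i).cast_nonneg : (0 : ℝ) ≤ d i)]))]
  -- The power 2^{-d} coming from the end point 1/2 cancels the 2^d in (2x)^d; this is why the
  -- expansions are normalized in powers of 2x.
  have h2 : (((1 / 2 : ℝ) : ℝ) : ℂ) ^ (α + d i + 1) = (2 : ℂ) ^ (-α - 1) * (2 ^ d i)⁻¹ := by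
    have : (((1 / 2 : ℝ) : ℝ) : ℂ) = (2 : ℂ)⁻¹ := by push_cast; norm_num
    rw [this, Complex.inv_cpow _ _ (by
      rw [show (2 : ℂ) = ((2 : ℝ) : ℂ) by norm_num, Complex.arg_ofReal_of_nonneg zero_le_two]
      exact Real.pi_pos.ne), ← Complex.cpow_neg, ← Complex.cpow_natCast, ← Complex.cpow_neg,
      ← Complex.cpow_add _ _ two_ne_zero]
    congr 1
    ring
  rw [h2, Complex.ofReal_zero, Complex.zero_cpow hne, sub_zero,
    show α + 1 + d i = α + d i + 1 by ring]
  field_simp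

/-! ### The expansions for large real parts -/

theorem tsum_mul_pow_mul_tsum_mul_pow {ι ι' : Type*} {c : ι → ℂ} {c' : ι' → ℂ}
    (hc : Summable fun i => ‖c i‖) (hc' : Summable fun i => ‖c' i‖) (d : ι → ℕ) (d' : ι' → ℕ)
    {x : ℝ} (h0 : 0 ≤ x) (h1 : x ≤ 1 / 2) :
    (∑' i, c i * ((2 * x : ℝ) : ℂ) ^ d i) * (∑' i, c' i * ((2 * x : ℝ) : ℂ) ^ d' i) =
      ∑' i : ι × ι', c i.1 * c' i.2 * ((2 * x : ℝ) : ℂ) ^ (d i.1 + d' i.2) := by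
  rw [tsum_mul_tsum_of_summable_norm
    (Summable.of_nonneg_of_le (fun _ => norm_nonneg _) (fun i => norm_mul_pow_le h0 h1 _ _) hc)
    (Summable.of_nonneg_of_le (fun _ => norm_nonneg _) (fun i => norm_mul_pow_le h0 h1 _ _) hc')]
  refine tsum_congr fun i => ?_
  rw [pow_add]
  ring

theorem integral_tailSeries_triple {a b c : ℂ} (ha : ‖a‖ = 2) (hb : ‖b‖ = 2) (hc : ‖c‖ = 2)
    (s t u : ℂ) :
    ∫ x in (0 : ℝ)..(1 / 2), tailSeries a s x * tailSeries b t x * tailSeries c u x =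
      ∑' i : ℕ × ℕ × ℕ, (a ^ (-(i.1 : ℤ)) * etaGamma i.1 s) *
        ((b ^ (-(i.2.1 : ℤ)) * etaGamma i.2.1 t) * (c ^ (-(i.2.2 : ℤ)) * etaGamma i.2.2 u))
        / (2 * (i.1 + i.2.1 + i.2.2 + 1)) := by
  have h1 := summable_norm_etaGamma ha s
  have h2 := summable_norm_etaGamma hb t
  have h3 := summable_norm_etaGamma hc u
  rw [integral_cpow_mul_tsum (α := 0) le_rfl (h1.mul_norm (h2.mul_norm h3))
    (fun i => i.1 + (i.2.1 + i.2.2))]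
  · refine tsum_congr fun i => ?_
    rw [show (-0 - 1 : ℂ) = -1 by ring, Complex.cpow_neg_one]
    push_cast
    rw [show (0 + 1 + ((i.1 : ℂ) + (i.2.1 + i.2.2))) = (i.1 + i.2.1 + i.2.2 + 1 : ℂ) by ring]
    rw [mul_comm (2 : ℂ), ← div_div]
    ring
  · intro x hx
    rw [Complex.cpow_zero, one_mul, mul_assoc, tailSeries, tailSeries, tailSeries,
      tsum_mul_pow_mul_tsum_mul_pow h2 h3 (fun k => k) (fun k => k) hx.1.le hx.2,
      tsum_mul_pow_mul_tsum_mul_pow h1 (h2.mul_norm h3) (fun k => k) (fun i => i.1 + i.2)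
        hx.1.le hx.2]

theorem headTerm_eq {s : ℂ} {x : ℝ} : headTerm s x = (Complex.Gamma s)⁻¹ * (x : ℂ) ^ (s - 1) :=
  mul_comm _ _

theorem gNum_mul_integral_double {a b : ℂ} (ha : ‖a‖ = 2) (hb : ‖b‖ = 2) {s : ℂ} (hs : 1 < s.re)
    (t u : ℂ) :
    gNum (s, t, u) * ∫ x in (0 : ℝ)..(1 / 2), headTerm s x * tailSeries a t x * tailSeries b u x =
      ∑' i, doubleTerm a b i (s, t, u) := by
  have h2 := summable_norm_etaGamma ha t
  have h3 := summable_norm_etaGamma hb u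
  rw [integral_cpow_mul_tsum (α := s - 1) (by simp; linarith)
    ((h2.mul_norm h3).mul_left ‖(Complex.Gamma s)⁻¹‖ |>.congr fun i => (norm_mul _ _).symm)
    (fun i => i.1 + i.2), ← tsum_mul_left]
  · refine tsum_congr fun i => ?_
    have hne : s + ((i.1 + i.2 : ℕ) : ℂ) ≠ 0 := fun h => by
      have := congrArg Complex.re h
      simp at this
      have h4 : (0 : ℝ) ≤ (i.1 : ℝ) + i.2 := by positivity
      linarith
    simp only [doubleTerm]
    rw [gammaInvDiv_eq hne]
    rw [show -(s - 1) - 1 = -s by ring, show s - 1 + 1 + ((i.1 + i.2 : ℕ) : ℂ)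
      = s + ((i.1 + i.2 : ℕ) : ℂ) by ring]
    ring
  · intro x hx
    rw [headTerm_eq, tailSeries, tailSeries, mul_assoc,
      tsum_mul_pow_mul_tsum_mul_pow h2 h3 (fun k => k) (fun k => k) hx.1.le hx.2, mul_assoc,
      mul_left_comm, ← tsum_mul_left]
    simp only [mul_assoc]

theorem gNum_mul_integral_single {a : ℂ} (ha : ‖a‖ = 2) {s t : ℂ} (hs : 1 < s.re) (ht : 1 < t.re)
    (u : ℂ) :
    gNum (s, t, u) * ∫ x in (0 : ℝ)..(1 / 2), headTerm s x * headTerm t x * tailSeries a u x =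
      ∑' n, singleTerm a n (s, t, u) := by
  have h3 := summable_norm_etaGamma ha u
  rw [integral_cpow_mul_tsum (α := (s - 1) + (t - 1)) (by simp; linarith)
    (h3.mul_left ‖(Complex.Gamma s)⁻¹ * (Complex.Gamma t)⁻¹‖ |>.congr fun i => (norm_mul _ _).symm)
    (fun i => i), ← tsum_mul_left]
  · refine tsum_congr fun i => ?_
    simp only [singleTerm, singleNum]
    rw [show -(s - 1 + (t - 1)) - 1 = 1 - s - t by ring, show s - 1 + (t - 1) + 1 + (i : ℂ)
      = s + t + i - 1 by ring]
    ring
  · intro x hx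
    have hx0 : (x : ℂ) ≠ 0 := by exact_mod_cast hx.1.ne'
    rw [headTerm_eq, headTerm_eq, tailSeries, Complex.cpow_add _ _ hx0]
    simp only [mul_assoc ((Complex.Gamma s)⁻¹ * (Complex.Gamma t)⁻¹), tsum_mul_left]
    ring

theorem gNum_mul_integral_headTerm {s t u : ℂ} (hs : 1 < s.re) (ht : 1 < t.re) (hu : 1 < u.re) :
    gNum (s, t, u) * ∫ x in (0 : ℝ)..(1 / 2), headTerm s x * headTerm t x * headTerm u x =
      G s t u * ((2 : ℂ) ^ (2 - s - t - u) / (s + t + u - 2)) := by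
  rw [integral_cpow_mul_tsum (ι := Unit) (α := (s - 1) + (t - 1) + (u - 1)) (by simp; linarith)
    (c := fun _ => (Complex.Gamma s)⁻¹ * (Complex.Gamma t)⁻¹ * (Complex.Gamma u)⁻¹)
    (Summable.of_finite) (fun _ => 0)]
  · simp only [tsum_fintype, Finset.univ_unique, Finset.sum_singleton, Nat.cast_zero, G_eq]
    rw [show -(s - 1 + (t - 1) + (u - 1)) - 1 = 2 - s - t - u by ring,
      show s - 1 + (t - 1) + (u - 1) + 1 + 0 = s + t + u - 2 by ring]
    ring
  · intro x hx
    have hx0 : (x : ℂ) ≠ 0 := by exact_mod_cast hx.1.ne'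
    simp only [headTerm_eq, tsum_fintype, Finset.univ_unique, Finset.sum_singleton, pow_zero]
    rw [Complex.cpow_add _ _ hx0, Complex.cpow_add _ _ hx0]
    ring

theorem kappa_eq (l m n : ℕ) : kappa l m n = (1 + (-1) ^ (l + m + n)) / 2 := by
  unfold kappa
  split_ifs with h
  · rw [h.neg_one_pow]; norm_num
  · rw [(Nat.not_even_iff_odd.1 h).neg_one_pow]; norm_num

/-- The two halves of the period contribute the same monomial, with signs (-1)^{l+m+n} and 1. Their
sum is 2κ, and the 2 cancels the 1/2 in ∫ (2x)^d = 1 / (2(d + 1)). -/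
theorem gNum_mul_integral_triple {a b c : ℂ} (ha : ‖a‖ = 2) (hb : ‖b‖ = 2) (hc : ‖c‖ = 2)
    (s t u : ℂ) :
    gNum (s, t, u) *
      ((∫ x in (0 : ℝ)..(1 / 2), tailSeries (-a) s x * tailSeries (-b) t x * tailSeries (-c) u x)
      + ∫ x in (0 : ℝ)..(1 / 2), tailSeries a s x * tailSeries b t x * tailSeries c u x) =
      ∑' i, tripleTerm a b c i (s, t, u) := by
  have hsum : ∀ {a b c : ℂ}, ‖a‖ = 2 → ‖b‖ = 2 → ‖c‖ = 2 →
      Summable fun i : ℕ × ℕ × ℕ => (a ^ (-(i.1 : ℤ)) * etaGamma i.1 s) *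
        ((b ^ (-(i.2.1 : ℤ)) * etaGamma i.2.1 t) * (c ^ (-(i.2.2 : ℤ)) * etaGamma i.2.2 u))
        / (2 * (i.1 + i.2.1 + i.2.2 + 1)) := by
    intro a b c ha hb hc
    refine Summable.of_norm_bounded ((summable_norm_etaGamma ha s).mul_norm
      ((summable_norm_etaGamma hb t).mul_norm (summable_norm_etaGamma hc u))) fun i => ?_
    rw [norm_div]
    refine div_le_self (norm_nonneg _) ?_
    have h2 : ‖(2 * (i.1 + i.2.1 + i.2.2 + 1) : ℂ)‖ = 2 * (i.1 + i.2.1 + i.2.2 + 1) := by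
      have := Complex.norm_natCast (2 * (i.1 + i.2.1 + i.2.2 + 1))
      push_cast at this
      exact this
    rw [h2]
    have : (0 : ℝ) ≤ (i.1 : ℝ) + i.2.1 + i.2.2 := by positivity
    linarith
  rw [integral_tailSeries_triple (by rwa [norm_neg]) (by rwa [norm_neg]) (by rwa [norm_neg]),
    integral_tailSeries_triple ha hb hc, ← Summable.tsum_add (hsum (by rwa [norm_neg])
      (by rwa [norm_neg]) (by rwa [norm_neg])) (hsum ha hb hc), ← tsum_mul_left]
  refine tsum_congr fun i => ?_
  have hneg : ∀ (a : ℂ) (k : ℕ), (-a) ^ (-(k : ℤ)) = (-1) ^ k * a ^ (-(k : ℤ)) := by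
    intro a k
    rw [zpow_neg, zpow_natCast, zpow_neg, zpow_natCast, neg_pow, mul_inv, ← inv_pow]
    norm_num
  simp only [tripleTerm, kappa_eq, hneg, pow_add]
  rw [mul_comm (2 : ℂ), ← div_div, ← div_div]
  ring

/-- The sum of the five series in the expansion of `S₁`, with `G` multiplied in. -/
def W₁ (p : ℂ × ℂ × ℂ) : ℂ :=
  ∑' i, tripleTerm 2 2 (-2) i p + ∑' n, singleTerm 2 n p + ∑' i, doubleTerm (-2) 2 i p
    + ∑' i, doubleTerm (-2) 2 i (p.2.1, p.1, p.2.2) + ∑' i, doubleTerm 2 2 i (p.2.2, p.1, p.2.1)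

/-- The part of the expansion of `S₂` that does not involve the hyperplanes `s + t = 1 - n`. -/
def W₂Main (p : ℂ × ℂ × ℂ) : ℂ :=
  G p.1 p.2.1 p.2.2 * ((2 : ℂ) ^ (2 - p.1 - p.2.1 - p.2.2) / (p.1 + p.2.1 + p.2.2 - 2))
    + ∑' i, tripleTerm 2 2 2 i p + ∑' i, doubleTerm (-2) (-2) i (p.2.2, p.1, p.2.1)
    + ∑' i, doubleTerm (-2) (-2) i p + ∑' i, doubleTerm (-2) (-2) i (p.2.1, p.2.2, p.1)
    + ∑' n, singleTerm (-2) n (p.2.1, p.2.2, p.1) + ∑' n, singleTerm (-2) n (p.2.2, p.1, p.2.1)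

/-- The expansion of `S₂`, with `G` multiplied in. -/
def W₂ (p : ℂ × ℂ × ℂ) : ℂ := W₂Main p + ∑' n, singleTerm (-2) n p

theorem norm_two : ‖(2 : ℂ)‖ = 2 := by simp

theorem norm_neg_two : ‖(-2 : ℂ)‖ = 2 := by simp

theorem gNum_swap₁₂ (s t u : ℂ) : gNum (t, s, u) = gNum (s, t, u) := by
  simp only [gNum, add_comm t s]

theorem gNum_rotate (s t u : ℂ) : gNum (u, s, t) = gNum (s, t, u) := by
  simp only [gNum]
  rw [show u + s + t = s + t + u by ring]

theorem intervalIntegrable_mul_mul {f g h : ℝ → ℂ} {a b : ℝ} (hf : ContinuousOn f (uIcc a b))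
    (hg : ContinuousOn g (uIcc a b)) (hh : ContinuousOn h (uIcc a b)) :
    IntervalIntegrable (fun x => f x * g x * h x) MeasureTheory.volume a b :=
  ((hf.mul hg).mul hh).intervalIntegrable

/-- On (0, 1/2] the factors of s and t carry a singular part and that of u does not; on the
reflected half only u does. Multiplying out gives six products: the two purely regular ones make the
triple series, the others are the single and double series. -/
theorem gNum_mul_integral_opposite_eq_W₁ {s t u : ℂ} (hs : 1 < s.re) (ht : 1 < t.re)
    (hu : 1 < u.re) :
    gNum (s, t, u) * ∫ x in (0 : ℝ)..1, hurwitzNorm s x * hurwitzNorm t x * hurwitzNorm u (-x) =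
      W₁ (s, t, u) := by
  have cs := continuous_hurwitzNorm hs
  have ct := continuous_hurwitzNorm ht
  have cu := continuous_hurwitzNorm hu
  have hs' := (continuous_headTerm hs).continuousOn (s := uIcc 0 (1 / 2))
  have ht' := (continuous_headTerm ht).continuousOn (s := uIcc 0 (1 / 2))
  have hu' := (continuous_headTerm hu).continuousOn (s := uIcc 0 (1 / 2))
  have hI : uIcc (0 : ℝ) (1 / 2) = Icc 0 (1 / 2) := uIcc_of_le (by norm_num)
  have hIo : uIoc (0 : ℝ) (1 / 2) = Ioc 0 (1 / 2) := uIoc_of_le (by norm_num)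
  have hP : ∀ z, ContinuousOn (tailSeries 2 z) (uIcc 0 (1 / 2)) := fun z => by
    rw [hI]; exact continuousOn_tailSeries norm_two z
  have hM : ∀ z, ContinuousOn (tailSeries (-2) z) (uIcc 0 (1 / 2)) := fun z => by
    rw [hI]; exact continuousOn_tailSeries norm_neg_two z
  rw [integral_zero_one_eq_half (f := fun x => hurwitzNorm s x * hurwitzNorm t x *
    hurwitzNorm u (-x)) (by fun_prop) (fun x => by
      rw [hurwitzNorm_add_one, hurwitzNorm_add_one, ← hurwitzNorm_add_one u (-(x + 1)),
        neg_add, neg_add_cancel_right])]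
  have e1 : ∫ x in (0 : ℝ)..(1 / 2), hurwitzNorm s x * hurwitzNorm t x * hurwitzNorm u (-x) =
      ∫ x in (0 : ℝ)..(1 / 2), (headTerm s x * headTerm t x * tailSeries 2 u x
        + headTerm s x * tailSeries (-2) t x * tailSeries 2 u x
        + headTerm t x * tailSeries (-2) s x * tailSeries 2 u x
        + tailSeries (-2) s x * tailSeries (-2) t x * tailSeries 2 u x) := by
    refine intervalIntegral.integral_congr_ae (.of_forall fun x hx => ?_)
    rw [hIo] at hx
    rw [hurwitzNorm_eq_headTerm_add hs hx.1 hx.2, hurwitzNorm_eq_headTerm_add ht hx.1 hx.2,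
      hurwitzNorm_neg_eq_tailSeries hu hx.1 hx.2]
    ring
  have e2 : ∫ x in (0 : ℝ)..(1 / 2), hurwitzNorm s (-x) * hurwitzNorm t (-x) *
        hurwitzNorm u (- -x) =
      ∫ x in (0 : ℝ)..(1 / 2), (headTerm u x * tailSeries 2 s x * tailSeries 2 t x
        + tailSeries 2 s x * tailSeries 2 t x * tailSeries (-2) u x) := by
    refine intervalIntegral.integral_congr_ae (.of_forall fun x hx => ?_)
    rw [hIo] at hx
    rw [hurwitzNorm_neg_eq_tailSeries hs hx.1 hx.2, hurwitzNorm_neg_eq_tailSeries ht hx.1 hx.2,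
      neg_neg, hurwitzNorm_eq_headTerm_add hu hx.1 hx.2]
    ring
  have i1 := intervalIntegrable_mul_mul hs' ht' (hP u)
  have i2 := intervalIntegrable_mul_mul hs' (hM t) (hP u)
  have i3 := intervalIntegrable_mul_mul ht' (hM s) (hP u)
  have i4 := intervalIntegrable_mul_mul (hM s) (hM t) (hP u)
  have i5 := intervalIntegrable_mul_mul hu' (hP s) (hP t)
  have i6 := intervalIntegrable_mul_mul (hP s) (hP t) (hM u)
  rw [e1, e2, intervalIntegral.integral_add ((i1.add i2).add i3) i4,
    intervalIntegral.integral_add (i1.add i2) i3, intervalIntegral.integral_add i1 i2,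
    intervalIntegral.integral_add i5 i6]
  · have k1 := gNum_mul_integral_single norm_two hs ht u
    have k2 := gNum_mul_integral_double norm_neg_two norm_two hs t u
    have k3 := gNum_mul_integral_double norm_neg_two norm_two ht s u
    have k4 := gNum_mul_integral_double norm_two norm_two hu s t
    have k5 := gNum_mul_integral_triple norm_two norm_two norm_neg_two s t u
    rw [gNum_swap₁₂] at k3
    rw [gNum_rotate] at k4
    rw [neg_neg] at k5
    simp only [W₁]
    linear_combination k1 + k2 + k3 + k4 + k5

/-- Here all three singular parts occur on the same half. Their product is the new term with
denominator s + t + u - 2, and the reflected half contributes to the triple series alone. -/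
theorem gNum_mul_integral_same_eq_W₂ {s t u : ℂ} (hs : 1 < s.re) (ht : 1 < t.re)
    (hu : 1 < u.re) :
    gNum (s, t, u) * ∫ x in (0 : ℝ)..1, hurwitzNorm s x * hurwitzNorm t x * hurwitzNorm u x =
      W₂ (s, t, u) := by
  have cs := continuous_hurwitzNorm hs
  have ct := continuous_hurwitzNorm ht
  have cu := continuous_hurwitzNorm hu
  have hs' := (continuous_headTerm hs).continuousOn (s := uIcc 0 (1 / 2))
  have ht' := (continuous_headTerm ht).continuousOn (s := uIcc 0 (1 / 2))
  have hu' := (continuous_headTerm hu).continuousOn (s := uIcc 0 (1 / 2))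
  have hI : uIcc (0 : ℝ) (1 / 2) = Icc 0 (1 / 2) := uIcc_of_le (by norm_num)
  have hIo : uIoc (0 : ℝ) (1 / 2) = Ioc 0 (1 / 2) := uIoc_of_le (by norm_num)
  have hM : ∀ z, ContinuousOn (tailSeries (-2) z) (uIcc 0 (1 / 2)) := fun z => by
    rw [hI]; exact continuousOn_tailSeries norm_neg_two z
  rw [integral_zero_one_eq_half (f := fun x => hurwitzNorm s x * hurwitzNorm t x *
    hurwitzNorm u x) (by fun_prop) (fun x => by
      rw [hurwitzNorm_add_one, hurwitzNorm_add_one, hurwitzNorm_add_one])]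
  have e1 : ∫ x in (0 : ℝ)..(1 / 2), hurwitzNorm s x * hurwitzNorm t x * hurwitzNorm u x =
      ∫ x in (0 : ℝ)..(1 / 2), (headTerm s x * headTerm t x * headTerm u x
        + headTerm s x * headTerm t x * tailSeries (-2) u x
        + headTerm t x * headTerm u x * tailSeries (-2) s x
        + headTerm u x * headTerm s x * tailSeries (-2) t x
        + headTerm s x * tailSeries (-2) t x * tailSeries (-2) u x
        + headTerm t x * tailSeries (-2) u x * tailSeries (-2) s x
        + headTerm u x * tailSeries (-2) s x * tailSeries (-2) t x
        + tailSeries (-2) s x * tailSeries (-2) t x * tailSeries (-2) u x) := by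
    refine intervalIntegral.integral_congr_ae (.of_forall fun x hx => ?_)
    rw [hIo] at hx
    rw [hurwitzNorm_eq_headTerm_add hs hx.1 hx.2, hurwitzNorm_eq_headTerm_add ht hx.1 hx.2,
      hurwitzNorm_eq_headTerm_add hu hx.1 hx.2]
    ring
  have e2 : ∫ x in (0 : ℝ)..(1 / 2), hurwitzNorm s (-x) * hurwitzNorm t (-x) *
        hurwitzNorm u (-x) =
      ∫ x in (0 : ℝ)..(1 / 2), tailSeries 2 s x * tailSeries 2 t x * tailSeries 2 u x := by
    refine intervalIntegral.integral_congr_ae (.of_forall fun x hx => ?_)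
    rw [hIo] at hx
    rw [hurwitzNorm_neg_eq_tailSeries hs hx.1 hx.2, hurwitzNorm_neg_eq_tailSeries ht hx.1 hx.2,
      hurwitzNorm_neg_eq_tailSeries hu hx.1 hx.2]
  have i0 := intervalIntegrable_mul_mul hs' ht' hu'
  have i1 := i0.add (intervalIntegrable_mul_mul hs' ht' (hM u))
  have i2 := i1.add (intervalIntegrable_mul_mul ht' hu' (hM s))
  have i3 := i2.add (intervalIntegrable_mul_mul hu' hs' (hM t))
  have i4 := i3.add (intervalIntegrable_mul_mul hs' (hM t) (hM u))
  have i5 := i4.add (intervalIntegrable_mul_mul ht' (hM u) (hM s))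
  have i6 := i5.add (intervalIntegrable_mul_mul hu' (hM s) (hM t))
  rw [e1, e2, intervalIntegral.integral_add i6 (intervalIntegrable_mul_mul (hM s) (hM t) (hM u)),
    intervalIntegral.integral_add i5 (intervalIntegrable_mul_mul hu' (hM s) (hM t)),
    intervalIntegral.integral_add i4 (intervalIntegrable_mul_mul ht' (hM u) (hM s)),
    intervalIntegral.integral_add i3 (intervalIntegrable_mul_mul hs' (hM t) (hM u)),
    intervalIntegral.integral_add i2 (intervalIntegrable_mul_mul hu' hs' (hM t)),
    intervalIntegral.integral_add i1 (intervalIntegrable_mul_mul ht' hu' (hM s)),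
    intervalIntegral.integral_add i0 (intervalIntegrable_mul_mul hs' ht' (hM u))]
  · have k0 := gNum_mul_integral_headTerm hs ht hu
    have k1 := gNum_mul_integral_single norm_neg_two hs ht u
    have k2 := gNum_mul_integral_single norm_neg_two ht hu s
    have k3 := gNum_mul_integral_single norm_neg_two hu hs t
    have k4 := gNum_mul_integral_double norm_neg_two norm_neg_two hs t u
    have k5 := gNum_mul_integral_double norm_neg_two norm_neg_two ht u s
    have k6 := gNum_mul_integral_double norm_neg_two norm_neg_two hu s t
    have k7 := gNum_mul_integral_triple norm_two norm_two norm_two s t u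
    rw [← gNum_rotate] at k2 k5
    rw [gNum_rotate] at k3 k6
    simp only [W₂, W₂Main]
    linear_combination k0 + k1 + k2 + k3 + k4 + k5 + k6 + k7

/-! ### The domains -/

theorem isIntLeOne_iff {z : ℂ} : IsIntLeOne z ↔ ∃ n : ℕ, z = 1 - n := by
  constructor
  · rintro ⟨n, hn, rfl⟩
    refine ⟨(1 - n).toNat, ?_⟩
    have : (((1 - n).toNat : ℤ) : ℂ) = ((1 - n : ℤ) : ℂ) := by rw [Int.toNat_of_nonneg (by omega)]
    rw [← Int.cast_natCast, this]
    push_cast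
    ring
  · rintro ⟨n, rfl⟩
    exact ⟨1 - n, by omega, by push_cast; rfl⟩

theorem not_isIntLeOne_of_one_lt_re {z : ℂ} (h : 1 < z.re) : ¬ IsIntLeOne z := by
  rintro ⟨n, hn, rfl⟩
  have : (n : ℝ) ≤ 1 := by exact_mod_cast hn
  simp at h
  linarith

theorem lineCocountable_not_isIntLeOne (ℓ : ℂ × ℂ × ℂ →L[ℂ] ℂ) :
    LineCocountable {p | ¬ IsIntLeOne (ℓ p)} := by
  have h : {p | ¬ IsIntLeOne (ℓ p)} = ⋂ n : ℕ, {p | ℓ p ≠ 1 - (n : ℂ)} := by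
    ext p
    simp [isIntLeOne_iff]
  rw [h]
  exact .iInter fun n => lineCocountable_ne _ _

/-- The first coordinate. -/
def cs : ℂ × ℂ × ℂ →L[ℂ] ℂ := ContinuousLinearMap.fst ℂ ℂ (ℂ × ℂ)

/-- The second coordinate. -/
def ct : ℂ × ℂ × ℂ →L[ℂ] ℂ :=
  (ContinuousLinearMap.fst ℂ ℂ ℂ).comp (ContinuousLinearMap.snd ℂ ℂ (ℂ × ℂ))

/-- The third coordinate. -/
def cu : ℂ × ℂ × ℂ →L[ℂ] ℂ :=
  (ContinuousLinearMap.snd ℂ ℂ ℂ).comp (ContinuousLinearMap.snd ℂ ℂ (ℂ × ℂ))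

theorem isOpen_domT : IsOpen domT :=
  (isOpen_not_intLeOne (f := fun p => p.1 + p.2.2) (by fun_prop)).inter
    ((isOpen_not_intLeOne (f := fun p => p.2.1 + p.2.2) (by fun_prop)).inter
      (isOpen_ne_fun (f := fun p : ℂ × ℂ × ℂ => p.1 + p.2.1 + p.2.2) (by fun_prop)
        continuous_const))

theorem isOpen_D₂ : IsOpen D₂ :=
  isOpen_D₁.inter ((isOpen_not_intLeOne (f := fun p => p.2.1 + p.2.2) (by fun_prop)).inter
    ((isOpen_not_intLeOne (f := fun p => p.2.2 + p.1) (by fun_prop)).inter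
      (isOpen_ne_fun (f := fun p : ℂ × ℂ × ℂ => p.1 + p.2.1 + p.2.2) (by fun_prop)
        continuous_const)))

theorem lineCocountable_domT : LineCocountable domT :=
  (lineCocountable_not_isIntLeOne (cs + cu)).inter
    ((lineCocountable_not_isIntLeOne (ct + cu)).inter (lineCocountable_ne (cs + ct + cu) 2))

theorem lineCocountable_D₂ : LineCocountable D₂ :=
  (lineCocountable_not_isIntLeOne (cs + ct)).inter
    ((lineCocountable_not_isIntLeOne (ct + cu)).inter
      ((lineCocountable_not_isIntLeOne (cu + cs)).inter (lineCocountable_ne (cs + ct + cu) 2)))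

theorem D₂_subset_D₁ : D₂ ⊆ D₁ := fun _ h => h.1

theorem D₂_subset_domT : D₂ ⊆ domT := fun p h =>
  ⟨by have := h.2.2.1; rwa [add_comm] at this, h.2.1, h.2.2.2⟩

theorem mem_D₂_iff {p : ℂ × ℂ × ℂ} : p ∈ D₂ ↔ p ∈ D₁ ∧ p ∈ domT :=
  ⟨fun h => ⟨D₂_subset_D₁ h, D₂_subset_domT h⟩, fun ⟨h1, h2⟩ =>
    ⟨h1, h2.2.1, by have := h2.1; rwa [add_comm] at this, h2.2.2⟩⟩

theorem rotate_mem_D₂ {s t u : ℂ} (h : (s, t, u) ∈ D₂) : (t, u, s) ∈ D₂ :=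
  ⟨h.2.1, h.2.2.1, h.1, by
    have := h.2.2.2
    rwa [show t + u + s = s + t + u by ring]⟩

theorem convergenceRegion_subset_domT : convergenceRegion ⊆ domT := fun p hp =>
  ⟨not_isIntLeOne_of_one_lt_re hp.1, not_isIntLeOne_of_one_lt_re hp.2.1, fun h => by
    have := (mem_convergenceRegion.1 hp).2.2
    rw [h] at this
    simp at this⟩

/-- The region in which all real parts exceed `1`. -/
def largeRegion : Set (ℂ × ℂ × ℂ) := {p | 1 < p.1.re ∧ 1 < p.2.1.re ∧ 1 < p.2.2.re}

theorem isOpen_largeRegion : IsOpen largeRegion := by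
  have h1 : Continuous fun p : ℂ × ℂ × ℂ => p.1.re := by fun_prop
  have h2 : Continuous fun p : ℂ × ℂ × ℂ => p.2.1.re := by fun_prop
  have h3 : Continuous fun p : ℂ × ℂ × ℂ => p.2.2.re := by fun_prop
  exact (isOpen_lt continuous_const h1).inter
    ((isOpen_lt continuous_const h2).inter (isOpen_lt continuous_const h3))

theorem two_mem_largeRegion : ((2, 2, 2) : ℂ × ℂ × ℂ) ∈ largeRegion := by
  refine ⟨?_, ?_, ?_⟩ <;> simp

theorem largeRegion_subset_convergenceRegion : largeRegion ⊆ convergenceRegion := fun p hp => by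
  obtain ⟨h1, h2, h3⟩ := hp
  rw [mem_convergenceRegion]
  simp only [Complex.add_re]
  refine ⟨?_, ?_, ?_⟩ <;> linarith

theorem largeRegion_subset_D₂ : largeRegion ⊆ D₂ := fun p hp =>
  mem_D₂_iff.2 ⟨not_isIntLeOne_of_one_lt_re (by
    obtain ⟨h1, h2, h3⟩ := hp
    rw [Complex.add_re]
    linarith), convergenceRegion_subset_domT (largeRegion_subset_convergenceRegion hp)⟩

theorem dense_D₂ : Dense D₂ :=
  lineCocountable_D₂.dense ⟨_, largeRegion_subset_D₂ two_mem_largeRegion⟩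

theorem dense_D₁ : Dense D₁ := dense_D₂.mono D₂_subset_D₁

/-! ### The expansions as holomorphic functions -/

theorem differentiable_rotate : Differentiable ℂ fun p : ℂ × ℂ × ℂ => (p.2.1, p.2.2, p.1) := by
  fun_prop

theorem differentiable_rotate' : Differentiable ℂ fun p : ℂ × ℂ × ℂ => (p.2.2, p.1, p.2.1) := by
  fun_prop

theorem differentiable_swap : Differentiable ℂ fun p : ℂ × ℂ × ℂ => (p.2.1, p.1, p.2.2) := by
  fun_prop

theorem differentiable_tsum_tripleTerm {a b c : ℂ} (ha : ‖a‖ = 2) (hb : ‖b‖ = 2) (hc : ‖c‖ = 2) :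
    Differentiable ℂ fun p => ∑' i, tripleTerm a b c i p :=
  differentiableOn_univ.1
    ((rapidFamily_tripleTerm ha hb hc).differentiableOn_tsum isOpen_univ summable_pow_deg₃)

theorem differentiable_tsum_doubleTerm {a b : ℂ} (ha : ‖a‖ = 2) (hb : ‖b‖ = 2) :
    Differentiable ℂ fun p => ∑' i, doubleTerm a b i p :=
  differentiableOn_univ.1
    ((rapidFamily_doubleTerm ha hb).differentiableOn_tsum isOpen_univ summable_pow_deg₂)

theorem differentiable_tsum_singleTermReg {a : ℂ} (ha : ‖a‖ = 2) :
    Differentiable ℂ fun p => ∑' n, singleTermReg a n p :=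
  differentiableOn_univ.1
    ((rapidFamily_singleTermReg ha).differentiableOn_tsum isOpen_univ summable_pow_id)

theorem differentiableOn_tsum_singleTerm {a : ℂ} (ha : ‖a‖ = 2) :
    DifferentiableOn ℂ (fun p => ∑' n, singleTerm a n p) D₁ :=
  (rapidFamily_singleTerm ha).differentiableOn_tsum isOpen_D₁ summable_pow_id

/-- `W₁` without its single series. -/
def W₁Entire (p : ℂ × ℂ × ℂ) : ℂ :=
  ∑' i, tripleTerm 2 2 (-2) i p + ∑' i, doubleTerm (-2) 2 i p
    + ∑' i, doubleTerm (-2) 2 i (p.2.1, p.1, p.2.2) + ∑' i, doubleTerm 2 2 i (p.2.2, p.1, p.2.1)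

theorem W₁_eq (p : ℂ × ℂ × ℂ) : W₁ p = W₁Entire p + ∑' n, singleTerm 2 n p := by
  rw [W₁, W₁Entire]
  ring

theorem differentiable_W₁Entire : Differentiable ℂ W₁Entire := by
  have h1 := differentiable_tsum_tripleTerm norm_two norm_two norm_neg_two
  have h2 := differentiable_tsum_doubleTerm norm_neg_two norm_two
  have h3 := differentiable_tsum_doubleTerm norm_two norm_two
  exact ((h1.add h2).add (h2.comp differentiable_swap)).add (h3.comp differentiable_rotate')

theorem differentiableOn_W₁ : DifferentiableOn ℂ W₁ D₁ :=
  (differentiable_W₁Entire.differentiableOn.add (differentiableOn_tsum_singleTerm norm_two)).congr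
    fun p _ => W₁_eq p

/-- The part of the expansion of `S₂` that is holomorphic near `s + t + u = 2`. -/
def W₂Core (p : ℂ × ℂ × ℂ) : ℂ :=
  ∑' i, tripleTerm 2 2 2 i p + ∑' i, doubleTerm (-2) (-2) i (p.2.2, p.1, p.2.1)
    + ∑' i, doubleTerm (-2) (-2) i p + ∑' i, doubleTerm (-2) (-2) i (p.2.1, p.2.2, p.1)
    + ∑' n, singleTerm (-2) n (p.2.1, p.2.2, p.1) + ∑' n, singleTerm (-2) n (p.2.2, p.1, p.2.1)

theorem W₂Main_eq (p : ℂ × ℂ × ℂ) : W₂Main p =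
    G p.1 p.2.1 p.2.2 * (2 : ℂ) ^ (2 - p.1 - p.2.1 - p.2.2) * (p.1 + p.2.1 + p.2.2 - 2)⁻¹
      + W₂Core p := by
  rw [W₂Main, W₂Core]
  ring

/-- The complement of the hyperplanes `s + u = 1 - n`, `t + u = 1 - n`. -/
def D₃ : Set (ℂ × ℂ × ℂ) := {p | ¬ IsIntLeOne (p.2.1 + p.2.2) ∧ ¬ IsIntLeOne (p.2.2 + p.1)}

theorem isOpen_D₃ : IsOpen D₃ :=
  (isOpen_not_intLeOne (f := fun p => p.2.1 + p.2.2) (by fun_prop)).inter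
    (isOpen_not_intLeOne (f := fun p => p.2.2 + p.1) (by fun_prop))

theorem domT_subset_D₃ : domT ⊆ D₃ := fun p hp =>
  ⟨hp.2.1, by have := hp.1; rwa [add_comm] at this⟩

theorem differentiableOn_W₂Core : DifferentiableOn ℂ W₂Core D₃ := by
  have h1 := differentiable_tsum_tripleTerm norm_two norm_two norm_two
  have h2 := differentiable_tsum_doubleTerm norm_neg_two norm_neg_two
  have h3 := differentiableOn_tsum_singleTerm norm_neg_two
  refine ((((h1.add (h2.comp differentiable_rotate')).add h2).add
    (h2.comp differentiable_rotate)).differentiableOn.add ?_).add ?_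
  · exact h3.comp differentiable_rotate.differentiableOn fun p hp => hp.1
  · exact h3.comp differentiable_rotate'.differentiableOn fun p hp => hp.2

theorem differentiable_G : Differentiable ℂ fun p : ℂ × ℂ × ℂ => G p.1 p.2.1 p.2.2 := by
  simp only [G_eq]
  have h := Complex.differentiable_one_div_Gamma
  exact ((differentiable_gNum.mul (h.comp differentiable_fst)).mul
    (h.comp (differentiable_fst.comp differentiable_snd))).mul
    (h.comp (differentiable_snd.comp differentiable_snd))

theorem differentiable_G_mul_two_cpow : Differentiable ℂ fun p : ℂ × ℂ × ℂ =>
    G p.1 p.2.1 p.2.2 * (2 : ℂ) ^ (2 - p.1 - p.2.1 - p.2.2) :=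
  differentiable_G.mul (differentiable_two_cpow (by fun_prop))

theorem differentiableOn_W₂Main : DifferentiableOn ℂ W₂Main domT := by
  refine ((differentiable_G_mul_two_cpow.differentiableOn.mul ?_).add
    (differentiableOn_W₂Core.mono domT_subset_D₃)).congr fun p _ => W₂Main_eq p
  intro p hp
  refine DifferentiableWithinAt.fun_inv (by fun_prop) ?_
  exact sub_ne_zero.2 hp.2.2

theorem differentiableOn_W₂ : DifferentiableOn ℂ W₂ D₂ :=
  (differentiableOn_W₂Main.mono D₂_subset_domT).add
    ((differentiableOn_tsum_singleTerm norm_neg_two).mono D₂_subset_D₁)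

/-- The entire function `1 / Γ(s + t - 1)`. -/
def gammaST (p : ℂ × ℂ × ℂ) : ℂ := (Complex.Gamma (p.1 + p.2.1 - 1))⁻¹

theorem differentiable_gammaST : Differentiable ℂ gammaST :=
  Complex.differentiable_one_div_Gamma.comp
    (by fun_prop : Differentiable ℂ fun p : ℂ × ℂ × ℂ => p.1 + p.2.1 - 1)

/-- The holomorphic continuation of `W₁ / Γ(s + t - 1)`. -/
def W₁Reg (p : ℂ × ℂ × ℂ) : ℂ := gammaST p * W₁Entire p + ∑' n, singleTermReg 2 n p

/-- The holomorphic continuation of `W₂ / Γ(s + t - 1)` to `domT`. -/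
def W₂Reg (p : ℂ × ℂ × ℂ) : ℂ := gammaST p * W₂Main p + ∑' n, singleTermReg (-2) n p

theorem W₁Reg_eq {p : ℂ × ℂ × ℂ} (hp : p ∈ D₁) : W₁Reg p = gammaST p * W₁ p := by
  rw [W₁Reg, W₁_eq, mul_add, ← tsum_mul_left]
  congr 1
  exact tsum_congr fun n => singleTermReg_eq 2 n hp

theorem W₂Reg_eq {p : ℂ × ℂ × ℂ} (hp : p ∈ D₁) : W₂Reg p = gammaST p * W₂ p := by
  rw [W₂Reg, W₂, mul_add, ← tsum_mul_left]
  congr 1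
  exact tsum_congr fun n => singleTermReg_eq (-2) n hp

theorem differentiable_W₁Reg : Differentiable ℂ W₁Reg :=
  (differentiable_gammaST.mul differentiable_W₁Entire).add (differentiable_tsum_singleTermReg norm_two)

theorem differentiableOn_W₂Reg : DifferentiableOn ℂ W₂Reg domT :=
  (differentiable_gammaST.differentiableOn.mul differentiableOn_W₂Main).add
    (differentiable_tsum_singleTermReg norm_neg_two).differentiableOn

/-! ### Continuation of the Tornheim series -/

theorem W₁_eq_of_mem_largeRegion {s t u : ℂ} (h : (s, t, u) ∈ largeRegion) : W₁ (s, t, u) =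
    (1 + e (s + t + u)) * seriesSum (s, t, u) + (e s + e (u + t)) * seriesSum (u, s, t)
      + (e t + e (u + s)) * seriesSum (t, u, s) := by
  rw [← gNum_mul_integral_opposite_eq_W₁ h.1 h.2.1 h.2.2,
    gNum_mul_integral_opposite h.1 h.2.1 h.2.2]

theorem W₂_eq_of_mem_largeRegion {s t u : ℂ} (h : (s, t, u) ∈ largeRegion) : W₂ (s, t, u) =
    (e u + e (s + t)) * seriesSum (s, t, u) + (e t + e (u + s)) * seriesSum (u, s, t)
      + (e s + e (t + u)) * seriesSum (t, u, s) := by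
  rw [← gNum_mul_integral_same_eq_W₂ h.1 h.2.1 h.2.2, gNum_mul_integral_same h.1 h.2.1 h.2.2]

/-- The entire function `e^{-2π i w} - 1`. -/
def eSq (w : ℂ) : ℂ := e w ^ 2 - 1

theorem differentiable_e : Differentiable ℂ e := by
  unfold e
  fun_prop

theorem differentiable_eSq : Differentiable ℂ eSq := by
  have := differentiable_e
  unfold eSq
  fun_prop

theorem deriv_eSq_ne_zero (w : ℂ) : deriv eSq w ≠ 0 := by
  have h1 : HasDerivAt (fun w : ℂ => -(Real.pi * Complex.I * w)) (-(Real.pi * Complex.I * 1)) w :=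
    ((hasDerivAt_id w).const_mul _).neg
  have h2 : HasDerivAt e (e w * -(Real.pi * Complex.I * 1)) w := h1.cexp
  have h3 : HasDerivAt eSq (2 * e w * (e w * -(Real.pi * Complex.I * 1))) w := by
    have := (h2.fun_pow 2).sub_const 1
    convert! this using 1
    ring
  rw [h3.deriv]
  have h4 : e w ≠ 0 := Complex.exp_ne_zero _
  have h5 : (Real.pi : ℂ) ≠ 0 := by exact_mod_cast Real.pi_ne_zero
  simp [h4, h5]

/-- A multiple of the Tornheim function, as a combination of the expansions. -/
def contNum (p : ℂ × ℂ × ℂ) : ℂ :=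
  (e p.1 * e p.2.1 * e p.2.2 - 1) * W₁Reg p - (e p.1 * e p.2.1 - e p.2.2) * W₂Reg p
    - gammaST p * ((e p.2.1 * e p.2.2 - e p.1) * W₁ (p.2.2, p.1, p.2.1)
      + (e p.1 * e p.2.2 - e p.2.1) * W₁ (p.2.1, p.2.2, p.1))

theorem differentiableOn_contNum : DifferentiableOn ℂ contNum domT := by
  have h1 : Differentiable ℂ fun p : ℂ × ℂ × ℂ => e p.1 := differentiable_e.comp differentiable_fst
  have h2 : Differentiable ℂ fun p : ℂ × ℂ × ℂ => e p.2.1 :=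
    differentiable_e.comp (differentiable_fst.comp differentiable_snd)
  have h3 : Differentiable ℂ fun p : ℂ × ℂ × ℂ => e p.2.2 :=
    differentiable_e.comp (differentiable_snd.comp differentiable_snd)
  have h4 : DifferentiableOn ℂ (fun p : ℂ × ℂ × ℂ => W₁ (p.2.2, p.1, p.2.1)) domT :=
    differentiableOn_W₁.comp differentiable_rotate'.differentiableOn fun p hp =>
      (domT_subset_D₃ hp).2
  have h5 : DifferentiableOn ℂ (fun p : ℂ × ℂ × ℂ => W₁ (p.2.1, p.2.2, p.1)) domT :=
    differentiableOn_W₁.comp differentiable_rotate.differentiableOn fun p hp =>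
      (domT_subset_D₃ hp).1
  refine DifferentiableOn.sub (DifferentiableOn.sub ?_ ?_) ?_
  · exact ((((h1.mul h2).mul h3).sub_const 1).mul differentiable_W₁Reg).differentiableOn
  · exact ((h1.mul h2).sub h3).differentiableOn.mul differentiableOn_W₂Reg
  · exact differentiable_gammaST.differentiableOn.mul
      ((((h2.mul h3).sub h1).differentiableOn.mul h4).add
        (((h1.mul h3).sub h2).differentiableOn.mul h5))

/-- The elimination step. With a, b, c the values of `e` at s, t, u, the multipliers abc - 1, ab -
c, bc - a, ac - b are the coefficients of S₁ and S₂ with one sign changed. The coefficients of the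
two rotated series cancel identically, and that of the remaining one is (a² - 1)(b² - 1)(c² - 1). -/
theorem contNum_eq_of_mem_largeRegion {p : ℂ × ℂ × ℂ} (hp : p ∈ largeRegion) :
    contNum p = eSq p.1 * (eSq p.2.1 * (eSq p.2.2 * (gammaST p * seriesSum p))) := by
  obtain ⟨s, t, u⟩ := p
  have hD := D₂_subset_D₁ (largeRegion_subset_D₂ hp)
  have k1 := W₁_eq_of_mem_largeRegion hp
  have k2 := W₂_eq_of_mem_largeRegion hp
  have k3 := W₁_eq_of_mem_largeRegion (s := u) (t := s) (u := t) ⟨hp.2.2, hp.1, hp.2.1⟩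
  have k4 := W₁_eq_of_mem_largeRegion (s := t) (t := u) (u := s) ⟨hp.2.1, hp.2.2, hp.1⟩
  simp only [contNum, eSq]
  rw [W₁Reg_eq hD, W₂Reg_eq hD, k1, k2, k3, k4]
  simp only [e_add]
  ring

theorem differentiable_eSq_comp (ℓ : ℂ × ℂ × ℂ →L[ℂ] ℂ) : Differentiable ℂ fun p => eSq (ℓ p) :=
  differentiable_eSq.comp ℓ.differentiable

theorem contNum_eq {p : ℂ × ℂ × ℂ} (hp : p ∈ convergenceRegion) :
    contNum p = eSq p.1 * (eSq p.2.1 * (eSq p.2.2 * (gammaST p * seriesSum p))) := by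
  refine convex_convergenceRegion.eqOn_of_differentiableOn isOpen_convergenceRegion
    (f := contNum) (g := fun p => eSq p.1 * (eSq p.2.1 * (eSq p.2.2 * (gammaST p * seriesSum p))))
    (differentiableOn_contNum.mono convergenceRegion_subset_domT) ?_
    (largeRegion_subset_convergenceRegion two_mem_largeRegion) ?_ hp
  · exact (differentiable_eSq_comp cs).differentiableOn.mul
      ((differentiable_eSq_comp ct).differentiableOn.mul
        ((differentiable_eSq_comp cu).differentiableOn.mul
          (differentiable_gammaST.differentiableOn.mul differentiableOn_seriesSum)))
  · filter_upwards [isOpen_largeRegion.mem_nhds two_mem_largeRegion] with q hq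
      using contNum_eq_of_mem_largeRegion hq

/-- If `H = (φ ∘ ℓ) K` on a part `R` of `D` that meets all zero hyperplanes of `φ ∘ ℓ`, then `K`
extends holomorphically to `D`. -/
theorem exists_differentiableOn_eqOn_of_mul {D R : Set (ℂ × ℂ × ℂ)} (hD : IsOpen D)
    (hL : LineCocountable D) (hR : IsOpen R) (hRD : R ⊆ D) (ℓ : ℂ × ℂ × ℂ →L[ℂ] ℂ)
    {v : ℂ × ℂ × ℂ} (hv : ℓ v = 1) {φ : ℂ → ℂ} (hφ : Differentiable ℂ φ)
    (hsimple : ∀ w, φ w = 0 → deriv φ w ≠ 0) {H K : ℂ × ℂ × ℂ → ℂ}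
    (hH : DifferentiableOn ℂ H D) (hK : ContinuousOn K R)
    (hHK : ∀ p ∈ R, H p = φ (ℓ p) * K p) (hmeet : ∀ w : ℂ, ∃ q ∈ R, ℓ q = w) :
    ∃ H₁, DifferentiableOn ℂ H₁ D ∧ ∀ p ∈ R, H₁ p = K p := by
  have h0 : ∀ p ∈ D, φ (ℓ p) = 0 → H p = 0 := by
    intro p hp hp0
    -- The line from q to p lies in the level set of ℓ, on which φ ∘ ℓ = 0. So H vanishes on it near
    -- q, where H = (φ ∘ ℓ) K, and hence at p.
    obtain ⟨q, hq, hqp⟩ := hmeet (ℓ p)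
    have hc : Tendsto (fun z : ℂ => q + z • (p - q)) (𝓝 0) (𝓝 q) := by
      have : Continuous fun z : ℂ => q + z • (p - q) := by fun_prop
      simpa using this.tendsto 0
    have := eq_zero_of_line hD hH (hL.isPreconnected (hRD hq) (p - q)) (hRD hq)
      (by simpa using hp) (by
        filter_upwards [hc.eventually (hR.mem_nhds hq)] with z hz
        rw [hHK _ hz]
        simp [hqp, hp0])
    simpa using this
  obtain ⟨g, hg, hgH⟩ := exists_differentiableOn_mul_eq hD hH ℓ hv hφ hsimple h0
  refine ⟨g, hg, fun p hp => ?_⟩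
  have hne : ∀ q ∈ R, φ (ℓ q) ≠ 0 → g q = K q := fun q hq hq0 =>
    mul_left_cancel₀ hq0 (by rw [hgH q (hRD hq), hHK q hq])
  by_cases hp0 : φ (ℓ p) = 0
  swap
  · exact hne p hp hp0
  -- At a zero of φ ∘ ℓ equality follows by continuity, approaching p along v through points where
  -- division is allowed.
  have hz : ∀ᶠ z in 𝓝[≠] (0 : ℂ), φ (ℓ p + z) ≠ 0 := by
    have : HasDerivAt φ (deriv φ (ℓ p)) (ℓ p + 0) := by simpa using (hφ (ℓ p)).hasDerivAt
    simpa [hp0] using (this.comp_const_add (ℓ p) 0).eventually_ne (c := 0) (hsimple _ hp0)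
  have hc : Tendsto (fun z : ℂ => p + z • v) (𝓝[≠] 0) (𝓝 p) := by
    have : Continuous fun z : ℂ => p + z • v := by fun_prop
    simpa using (this.tendsto 0).mono_left nhdsWithin_le_nhds
  have t1 := (hg.continuousOn.continuousAt (hD.mem_nhds (hRD hp))).tendsto.comp hc
  have t2 := (hK.continuousAt (hR.mem_nhds hp)).tendsto.comp hc
  refine tendsto_nhds_unique (t1.congr' ?_) t2
  filter_upwards [hz, hc.eventually (hR.mem_nhds hp)] with z h1 h2
  exact hne _ h2 (by simpa [hv] using h1)

theorem exists_extension_domT_of_mul (ℓ : ℂ × ℂ × ℂ →L[ℂ] ℂ)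
    {v : ℂ × ℂ × ℂ} (hv : ℓ v = 1) {φ : ℂ → ℂ} (hφ : Differentiable ℂ φ)
    (hsimple : ∀ w, φ w = 0 → deriv φ w ≠ 0) {H K : ℂ × ℂ × ℂ → ℂ}
    (hH : DifferentiableOn ℂ H domT) (hK : ContinuousOn K convergenceRegion)
    (hHK : ∀ p ∈ convergenceRegion, H p = φ (ℓ p) * K p)
    (hmeet : ∀ w : ℂ, ∃ q ∈ convergenceRegion, ℓ q = w) :
    ∃ H₁, DifferentiableOn ℂ H₁ domT ∧ ∀ p ∈ convergenceRegion, H₁ p = K p :=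
  exists_differentiableOn_eqOn_of_mul isOpen_domT lineCocountable_domT isOpen_convergenceRegion
    convergenceRegion_subset_domT ℓ hv hφ hsimple hH hK hHK hmeet

theorem exists_three_lt_re (w : ℂ) : ∃ M : ℂ, 3 < M.re ∧ 3 < w.re + M.re := by
  refine ⟨((4 + |w.re| : ℝ) : ℂ), ?_, ?_⟩
  · rw [Complex.ofReal_re]
    linarith [abs_nonneg w.re]
  · rw [Complex.ofReal_re]
    linarith [neg_abs_le w.re]

/-- The factors in s, t, u are divided out one after another. Any prescribed value of one coordinate
occurs in the region of convergence once the other two have large real parts. -/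
theorem exists_extension_gammaST_mul_seriesSum : ∃ H, DifferentiableOn ℂ H domT ∧
    ∀ p ∈ convergenceRegion, H p = gammaST p * seriesSum p := by
  have c1 : ContinuousOn (fun p => gammaST p * seriesSum p) convergenceRegion :=
    differentiable_gammaST.continuous.continuousOn.mul differentiableOn_seriesSum.continuousOn
  have c2 : ContinuousOn (fun p => eSq (cu p) * (gammaST p * seriesSum p)) convergenceRegion :=
    (differentiable_eSq_comp cu).continuous.continuousOn.mul c1
  have c3 : ContinuousOn (fun p => eSq (ct p) * (eSq (cu p) * (gammaST p * seriesSum p)))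
      convergenceRegion := (differentiable_eSq_comp ct).continuous.continuousOn.mul c2
  have hsimple : ∀ w, eSq w = 0 → deriv eSq w ≠ 0 := fun w _ => deriv_eSq_ne_zero w
  obtain ⟨H₁, d1, e1⟩ := exists_extension_domT_of_mul cs (v := (1, 0, 0)) (by simp [cs])
    differentiable_eSq hsimple differentiableOn_contNum c3
    (fun p hp => (contNum_eq hp).trans (by simp [cs, ct, cu])) (fun w => by
      obtain ⟨M, h1, h2⟩ := exists_three_lt_re w
      refine ⟨(w, M, M), mem_convergenceRegion.2 ?_, by simp [cs]⟩
      simp only [Complex.add_re]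
      refine ⟨?_, ?_, ?_⟩ <;> linarith)
  obtain ⟨H₂, d2, e2⟩ := exists_extension_domT_of_mul ct (v := (0, 1, 0)) (by simp [ct])
    differentiable_eSq hsimple d1 c2 e1 (fun w => by
      obtain ⟨M, h1, h2⟩ := exists_three_lt_re w
      refine ⟨(M, w, M), mem_convergenceRegion.2 ?_, by simp [ct]⟩
      simp only [Complex.add_re]
      refine ⟨?_, ?_, ?_⟩ <;> linarith)
  exact exists_extension_domT_of_mul cu (v := (0, 0, 1)) (by simp [cu])
    differentiable_eSq hsimple d2 c1 e2 (fun w => by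
      obtain ⟨M, h1, h2⟩ := exists_three_lt_re w
      refine ⟨(M, M, w), mem_convergenceRegion.2 ?_, by simp [cu]⟩
      simp only [Complex.add_re]
      refine ⟨?_, ?_, ?_⟩ <;> linarith)

theorem differentiable_gamma_sub_one_inv :
    Differentiable ℂ fun w : ℂ => (Complex.Gamma (w - 1))⁻¹ :=
  Complex.differentiable_one_div_Gamma.comp (by fun_prop : Differentiable ℂ fun w : ℂ => w - 1)

theorem deriv_gamma_sub_one_inv_ne_zero (w : ℂ) (hw : (Complex.Gamma (w - 1))⁻¹ = 0) :
    deriv (fun w : ℂ => (Complex.Gamma (w - 1))⁻¹) w ≠ 0 := by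
  rw [deriv_comp_sub_const (f := fun w => (Complex.Gamma w)⁻¹)]
  exact deriv_gamma_inv_ne_zero hw

theorem exists_mem_convergenceRegion_add_eq (w : ℂ) :
    ∃ q ∈ convergenceRegion, (cs + ct) q = w := by
  obtain ⟨M, h1, h2⟩ := exists_three_lt_re w
  refine ⟨(w, 0, M), mem_convergenceRegion.2 ?_, by simp [cs, ct]⟩
  simp only [Complex.add_re, Complex.zero_re]
  refine ⟨?_, ?_, ?_⟩ <;> linarith

/-- The factor 1/Γ(s + t - 1) was introduced because W₁ and W₂ are singular on s + t = 1 - k,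
whereas T is not. It is removed in the same way, as s + t may take any value in the region of
convergence when Re u is large. -/
theorem exists_extension_seriesSum : ∃ F, DifferentiableOn ℂ F domT ∧
    ∀ p ∈ convergenceRegion, F p = seriesSum p := by
  obtain ⟨H, d3, e3⟩ := exists_extension_gammaST_mul_seriesSum
  have e4 : ∀ p ∈ convergenceRegion,
      H p = (Complex.Gamma ((cs + ct) p - 1))⁻¹ * seriesSum p := fun p hp => by
    rw [e3 p hp, gammaST]
    simp [cs, ct]
  exact exists_extension_domT_of_mul (cs + ct) (v := (1, 0, 0))
    (by simp [cs, ct]) differentiable_gamma_sub_one_inv deriv_gamma_sub_one_inv_ne_zero d3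
    differentiableOn_seriesSum.continuousOn e4 exists_mem_convergenceRegion_add_eq

theorem exists_isContinuation : ∃ F, IsContinuation F := by
  obtain ⟨F, d4, e4⟩ := exists_extension_seriesSum
  refine ⟨F, d4, fun s t u h => ?_⟩
  rw [e4 _ h]
  exact hasSum_seriesTerm (p := (s, t, u)) h

theorem isContinuation_T : IsContinuation fun (s, t, u) => T s t u :=
  Classical.epsilon_spec exists_isContinuation

/-! ### `S₁` and `S₂` as sums of the expansions -/

theorem differentiableOn_T :
    DifferentiableOn ℂ (fun p : ℂ × ℂ × ℂ => T p.1 p.2.1 p.2.2) domT :=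
  isContinuation_T.differentiableOn

theorem T_eq_seriesSum {s t u : ℂ} (h : (s, t, u) ∈ convergenceRegion) :
    T s t u = seriesSum (s, t, u) :=
  (isContinuation_T.hasSum s t u h).unique (hasSum_seriesTerm (p := (s, t, u)) h)

theorem T_eq_of_mem_largeRegion {s t u : ℂ} (h : (s, t, u) ∈ largeRegion) :
    T s t u = seriesSum (s, t, u) ∧ T u s t = seriesSum (u, s, t) ∧
      T t u s = seriesSum (t, u, s) :=
  ⟨T_eq_seriesSum (largeRegion_subset_convergenceRegion h),
    T_eq_seriesSum (largeRegion_subset_convergenceRegion ⟨h.2.2, h.1, h.2.1⟩),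
    T_eq_seriesSum (largeRegion_subset_convergenceRegion ⟨h.2.1, h.2.2, h.1⟩)⟩

/-- A combination of the three Tornheim functions with entire coefficients is holomorphic
on `D₂`. -/
theorem differentiableOn_combination {a b c : ℂ × ℂ × ℂ → ℂ} (ha : Differentiable ℂ a)
    (hb : Differentiable ℂ b) (hc : Differentiable ℂ c) :
    DifferentiableOn ℂ (fun p : ℂ × ℂ × ℂ => a p * T p.1 p.2.1 p.2.2 + b p * T p.2.2 p.1 p.2.1
      + c p * T p.2.1 p.2.2 p.1) D₂ := by
  have h1 := differentiableOn_T.mono D₂_subset_domT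
  have h2 : DifferentiableOn ℂ (fun p : ℂ × ℂ × ℂ => T p.2.2 p.1 p.2.1) D₂ :=
    differentiableOn_T.comp differentiable_rotate'.differentiableOn fun p hp =>
      D₂_subset_domT (rotate_mem_D₂ (rotate_mem_D₂ hp))
  have h3 : DifferentiableOn ℂ (fun p : ℂ × ℂ × ℂ => T p.2.1 p.2.2 p.1) D₂ :=
    differentiableOn_T.comp differentiable_rotate.differentiableOn fun p hp =>
      D₂_subset_domT (rotate_mem_D₂ hp)
  exact ((ha.differentiableOn.mul h1).add (hb.differentiableOn.mul h2)).add
    (hc.differentiableOn.mul h3)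

theorem differentiable_e_comp {f : ℂ × ℂ × ℂ → ℂ} (hf : Differentiable ℂ f) :
    Differentiable ℂ fun p => e (f p) := differentiable_e.comp hf

theorem differentiableOn_comb₁ :
    DifferentiableOn ℂ (fun p : ℂ × ℂ × ℂ => comb₁ p.1 p.2.1 p.2.2) D₂ :=
  differentiableOn_combination (a := fun p => 1 + e (p.1 + p.2.1 + p.2.2))
    (b := fun p => e p.1 + e (p.2.2 + p.2.1)) (c := fun p => e p.2.1 + e (p.2.2 + p.1))
    ((differentiable_const 1).add (differentiable_e_comp (by fun_prop)))
    ((differentiable_e_comp (by fun_prop)).add (differentiable_e_comp (by fun_prop)))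
    ((differentiable_e_comp (by fun_prop)).add (differentiable_e_comp (by fun_prop)))

theorem differentiableOn_S₂ :
    DifferentiableOn ℂ (fun p : ℂ × ℂ × ℂ => S₂ p.1 p.2.1 p.2.2) D₂ :=
  differentiableOn_combination (a := fun p => e p.2.2 + e (p.1 + p.2.1))
    (b := fun p => e p.2.1 + e (p.2.2 + p.1)) (c := fun p => e p.1 + e (p.2.1 + p.2.2))
    ((differentiable_e_comp (by fun_prop)).add (differentiable_e_comp (by fun_prop)))
    ((differentiable_e_comp (by fun_prop)).add (differentiable_e_comp (by fun_prop)))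
    ((differentiable_e_comp (by fun_prop)).add (differentiable_e_comp (by fun_prop)))

/-- Both sides are holomorphic on D₂ and agree where all real parts exceed 1, hence throughout D₂.
-/
theorem eqOn_comb₁_W₁ : EqOn (fun p : ℂ × ℂ × ℂ => comb₁ p.1 p.2.1 p.2.2) W₁ D₂ := by
  refine lineCocountable_D₂.eqOn isOpen_D₂ differentiableOn_comb₁
    (differentiableOn_W₁.mono D₂_subset_D₁) (largeRegion_subset_D₂ two_mem_largeRegion) ?_
  filter_upwards [isOpen_largeRegion.mem_nhds two_mem_largeRegion]
  rintro ⟨s, t, u⟩ hq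
  obtain ⟨h1, h2, h3⟩ := T_eq_of_mem_largeRegion hq
  rw [W₁_eq_of_mem_largeRegion hq, comb₁, h1, h2, h3]

theorem comb₁_eq_W₁ {s t u : ℂ} (h : (s, t, u) ∈ D₂) : comb₁ s t u = W₁ (s, t, u) := by
  have := eqOn_comb₁_W₁ h
  exact this

theorem eqOn_S₂_W₂ : EqOn (fun p : ℂ × ℂ × ℂ => S₂ p.1 p.2.1 p.2.2) W₂ D₂ := by
  refine lineCocountable_D₂.eqOn isOpen_D₂ differentiableOn_S₂ differentiableOn_W₂
    (largeRegion_subset_D₂ two_mem_largeRegion) ?_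
  filter_upwards [isOpen_largeRegion.mem_nhds two_mem_largeRegion]
  rintro ⟨s, t, u⟩ hq
  obtain ⟨h1, h2, h3⟩ := T_eq_of_mem_largeRegion hq
  rw [W₂_eq_of_mem_largeRegion hq, S₂, h1, h2, h3]

theorem S₂_eq_W₂ {s t u : ℂ} (h : (s, t, u) ∈ D₂) : S₂ s t u = W₂ (s, t, u) := by
  have := eqOn_S₂_W₂ h
  exact this

/-- The series is holomorphic on the larger set D₁ and D₂ is dense, so the extension by continuity
is W₁. -/
theorem S₁_eq_W₁ {s t u : ℂ} (h : (s, t, u) ∈ D₁) : S₁ s t u = W₁ (s, t, u) := by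
  refine extendFrom_eq (dense_D₂ _) ?_
  have h1 : Tendsto W₁ (𝓝 (s, t, u)) (𝓝 (W₁ (s, t, u))) :=
    (differentiableOn_W₁.continuousOn.continuousAt (isOpen_D₁.mem_nhds h)).tendsto
  refine (h1.mono_left nhdsWithin_le_nhds).congr' ?_
  filter_upwards [self_mem_nhdsWithin]
  rintro ⟨s', t', u'⟩ hq
  exact (comb₁_eq_W₁ hq).symm

theorem S₂_rotate (s t u : ℂ) : S₂ t u s = S₂ s t u := by
  rw [S₂, S₂]
  ring

/-! ### True singularities -/

/-- If `g = φ f` on `D`, where `φ` vanishes at a limit point of `D` and `g` does not, then `f` is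
unbounded near this point. -/
theorem exists_lt_norm_of_mul_eq {X : Type*} [TopologicalSpace X] {D : Set X} {f g φ : X → ℂ}
    {p : X} (hp : p ∈ closure D) (hg : ContinuousAt g p) (hφ : ContinuousAt φ p) (h0 : φ p = 0)
    (hg0 : g p ≠ 0) (h : ∀ q ∈ D, g q = φ q * f q) {U : Set X} (hU : U ∈ 𝓝 p) (C : ℝ) :
    ∃ q ∈ U ∩ D, C < ‖f q‖ := by
  by_contra! hC
  have := mem_closure_iff_nhdsWithin_neBot.1 hp
  have h1 : Tendsto (fun q => ‖g q‖) (𝓝[D] p) (𝓝 ‖g p‖) := hg.norm.tendsto.mono_left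
    nhdsWithin_le_nhds
  have h2 : Tendsto (fun q => ‖φ q‖ * C) (𝓝[D] p) (𝓝 (‖φ p‖ * C)) :=
    (hφ.norm.tendsto.mul_const C).mono_left nhdsWithin_le_nhds
  have h3 : ‖g p‖ ≤ ‖φ p‖ * C := by
    refine le_of_tendsto_of_tendsto h1 h2 ?_
    filter_upwards [self_mem_nhdsWithin, mem_nhdsWithin_of_mem_nhds hU] with q hqD hqU
    rw [h q hqD, norm_mul]
    exact mul_le_mul_of_nonneg_left (hC q ⟨hqU, hqD⟩) (norm_nonneg _)
  rw [h0, norm_zero, zero_mul] at h3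
  exact hg0 (norm_le_zero_iff.1 h3)

/-- The integers in `ℂ`. -/
def intSet : Set ℂ := range ((↑) : ℤ → ℂ)

theorem countable_intSet : intSet.Countable := countable_range _

theorem countable_preimage_intSet {f : ℂ → ℂ} (hf : Function.Injective f) :
    (f ⁻¹' intSet).Countable := countable_intSet.preimage_of_injOn hf.injOn

theorem exists_mem_notMem_of_countable {V S : Set ℂ} (hV : V ∈ 𝓝 (0 : ℂ)) (hS : S.Countable) :
    ∃ z ∈ V, z ∉ S := by
  obtain ⟨z, hz, hzS⟩ := mem_closure_iff_nhds.1 (hS.dense_compl ℂ (0 : ℂ)) V hV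
  exact ⟨z, hz, hzS⟩

theorem gamma_inv_ne_zero_of_notMem {z : ℂ} (hz : z ∉ intSet) : (Complex.Gamma z)⁻¹ ≠ 0 := by
  refine inv_ne_zero (Complex.Gamma_ne_zero fun n hn => hz ⟨-n, ?_⟩)
  rw [hn]
  push_cast
  rfl

theorem not_isIntLeOne_of_notMem {z : ℂ} (hz : z ∉ intSet) : ¬ IsIntLeOne z := by
  rintro ⟨n, -, rfl⟩
  exact hz ⟨n, rfl⟩

theorem gNum_ne_zero (p : ℂ × ℂ × ℂ) : gNum p ≠ 0 :=
  mul_ne_zero (Complex.exp_ne_zero _) (by simp [Complex.cpow_eq_zero_iff])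

/-- A witness that `etaGamma k` is not identically zero, whatever k is: at -1/2 the linear factors
have positive real part, the zeta argument has real part k + 3/2 > 1, and Γ has no pole. -/
theorem etaGamma_neg_half_ne_zero (k : ℕ) : etaGamma k (-(1 / 2)) ≠ 0 := by
  have hre : ∀ j : ℕ, ((j : ℂ) + 1 - -(1 / 2)).re = j + 3 / 2 := fun j => by
    simp
    ring
  have h0 : ∀ j : ℕ, (j : ℂ) + 1 - -(1 / 2) ≠ 0 := fun j hj => by
    have := hre j
    rw [hj, Complex.zero_re] at this
    linarith [(j.cast_nonneg : (0 : ℝ) ≤ j)]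
  have hk : (-(1 / 2) : ℂ) ≠ k := fun hk => by
    have := congrArg Complex.re hk
    simp at this
    linarith [(k.cast_nonneg : (0 : ℝ) ≤ k)]
  rw [← etaBase_mul_gamma_inv (by norm_num), ← choose_mul_zeta_eq_etaBase hk, choose_sub_eq_prod]
  refine mul_ne_zero (mul_ne_zero (div_ne_zero (Finset.prod_ne_zero_iff.2 fun j _ => h0 j)
    (by exact_mod_cast k.factorial_ne_zero)) (riemannZeta_ne_zero_of_one_lt_re ?_)) ?_
  · rw [hre]
    linarith [(k.cast_nonneg : (0 : ℝ) ≤ k)]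
  · refine inv_ne_zero (Complex.Gamma_ne_zero fun m hm => ?_)
    have h2 : ((1 : ℕ) : ℂ) = ((2 * m : ℕ) : ℂ) := by
      push_cast
      linear_combination (-2) * hm
    have h3 : 1 = 2 * m := by exact_mod_cast h2
    omega

theorem eventually_etaGamma_ne_zero (k : ℕ) (u : ℂ) : ∀ᶠ w in 𝓝[≠] u, etaGamma k w ≠ 0 := by
  have han : AnalyticOnNhd ℂ (etaGamma k) univ := fun z _ => (differentiable_etaGamma k).analyticAt z
  refine (han u trivial).eventually_eq_zero_or_eventually_ne_zero.resolve_left fun h => ?_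
  exact etaGamma_neg_half_ne_zero k
    (han.eqOn_zero_of_preconnected_of_eventuallyEq_zero isPreconnected_univ trivial h trivial)

/-- A perturbation within the hyperplane s + t = 1 - k: first s and t move oppositely to avoid the
zeros of 1/Γ, then u moves to avoid the zeros of `etaGamma k` and the hyperplanes outside `domT`.
Only countably many parameters are forbidden, apart from the isolated zeros. -/
theorem exists_mem_singleNum_ne_zero {a : ℂ} (ha : a ≠ 0) {s t u : ℂ} {k : ℕ}
    (hst : s + t = 1 - k) {U : Set (ℂ × ℂ × ℂ)} (hU : U ∈ 𝓝 (s, t, u)) :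
    ∃ p ∈ U, p.1 + p.2.1 = 1 - k ∧ singleNum a k p ≠ 0 ∧ p ∈ domT := by
  have c1 : ContinuousAt (fun z : ℂ => (s + z, t - z, u)) 0 := by fun_prop
  obtain ⟨z, hz, hzS⟩ := exists_mem_notMem_of_countable
    (V := {z | (s + z, t - z, u) ∈ interior U}) (c1 (isOpen_interior.mem_nhds (by
      simpa using mem_interior_iff_mem_nhds.2 hU)))
    ((countable_preimage_intSet (add_right_injective s)).union
      (countable_preimage_intSet (sub_right_injective (b := t))))
  obtain ⟨hs, ht⟩ : s + z ∉ intSet ∧ t - z ∉ intSet := by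
    simpa [not_or] using hzS
  have c2 : ContinuousAt (fun w : ℂ => (s + z, t - z, u + w)) 0 := by fun_prop
  have heta : ∀ᶠ w in 𝓝[≠] (0 : ℂ), etaGamma k (u + w) ≠ 0 := by
    have c3 : Tendsto (fun w : ℂ => u + w) (𝓝[≠] 0) (𝓝[≠] u) := by
      refine tendsto_nhdsWithin_iff.2 ⟨?_, ?_⟩
      · have : Continuous fun w : ℂ => u + w := by fun_prop
        simpa using (this.tendsto 0).mono_left nhdsWithin_le_nhds
      · filter_upwards [self_mem_nhdsWithin] with w hw
        simpa using hw
    exact c3.eventually (eventually_etaGamma_ne_zero k u)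
  rw [eventually_nhdsWithin_iff] at heta
  have hi1 : Function.Injective fun w => s + z + (u + w) := fun x y h => by simpa using h
  have hi2 : Function.Injective fun w => t - z + (u + w) := fun x y h => by simpa using h
  -- The value w = 0 is excluded since nonvanishing is known only on a punctured neighbourhood; the
  -- last singleton excludes s + t + u = 2, where s + t = 1 - k.
  obtain ⟨w, ⟨hwU, hw⟩, hwS⟩ := exists_mem_notMem_of_countable
    (inter_mem (c2 (isOpen_interior.mem_nhds (by simpa using hz))) heta)
    ((((countable_singleton (0 : ℂ)).union (countable_preimage_intSet hi1)).union
      (countable_preimage_intSet hi2)).union (countable_singleton (2 - (1 - k) - u)))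
  simp only [mem_union, not_or, mem_singleton_iff, mem_preimage] at hwS
  obtain ⟨⟨⟨hw0, h1⟩, h2⟩, h3⟩ := hwS
  refine ⟨(s + z, t - z, u + w), interior_subset hwU, ?_, ?_, not_isIntLeOne_of_notMem h1,
    not_isIntLeOne_of_notMem h2, fun h => h3 ?_⟩
  · linear_combination hst
  · refine mul_ne_zero (mul_ne_zero (mul_ne_zero (mul_ne_zero (gNum_ne_zero _) ?_)
      (gamma_inv_ne_zero_of_notMem hs)) (gamma_inv_ne_zero_of_notMem ht))
      (mul_ne_zero (zpow_ne_zero _ ha) (hw hw0))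
    simp [Complex.cpow_eq_zero_iff]
  · linear_combination h - hst

theorem gammaST_eq_zero {p : ℂ × ℂ × ℂ} {k : ℕ} (hp : p.1 + p.2.1 = 1 - k) : gammaST p = 0 := by
  rw [gammaST, hp, show (1 - k - 1 : ℂ) = -k by ring, Complex.Gamma_neg_nat_eq_zero, inv_zero]

/-- On this hyperplane 1/Γ(s + t - 1) = 1/Γ(-k) = 0, which kills every term except the one whose own
denominator vanishes, n = k. -/
theorem tsum_singleTermReg_eq {p : ℂ × ℂ × ℂ} {k : ℕ} (a : ℂ) (hp : p.1 + p.2.1 = 1 - k) :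
    ∑' n, singleTermReg a n p = singleNum a k p * gammaInvDiv k (-k) := by
  rw [tsum_eq_single k]
  · rw [singleTermReg, hp]
    congr 2
    ring
  · intro n hn
    rw [singleTermReg, hp, show (1 - k - 1 : ℂ) = -k by ring, gammaInvDiv_eq,
      Complex.Gamma_neg_nat_eq_zero]
    · simp
    · have : (n : ℂ) ≠ k := by exact_mod_cast hn
      intro h
      exact this (by linear_combination h)

theorem exists_lt_norm_S₁ {s t u : ℂ} (h : IsIntLeOne (s + t)) {U : Set (ℂ × ℂ × ℂ)}
    (hU : U ∈ 𝓝 (s, t, u)) (C : ℝ) : ∃ p ∈ U ∩ D₁, C < ‖S₁ p.1 p.2.1 p.2.2‖ := by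
  obtain ⟨k, hk⟩ := isIntLeOne_iff.1 h
  -- The interior of U is used so that U is also a neighbourhood of the perturbed point p.
  obtain ⟨p, hpU, hp, hne, -⟩ :=
    exists_mem_singleNum_ne_zero (a := 2) two_ne_zero hk (interior_mem_nhds.2 hU)
  refine exists_lt_norm_of_mul_eq (g := W₁Reg) (φ := gammaST) (dense_D₁ p)
    differentiable_W₁Reg.continuous.continuousAt differentiable_gammaST.continuous.continuousAt
    (gammaST_eq_zero hp) ?_ (fun q hq => ?_) (mem_interior_iff_mem_nhds.1 hpU) C
  · rw [W₁Reg, gammaST_eq_zero hp, zero_mul, zero_add, tsum_singleTermReg_eq 2 hp]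
    exact mul_ne_zero hne (gammaInvDiv_neg k)
  · rw [W₁Reg_eq hq, S₁_eq_W₁ hq]

/-- As for S₁, but W₂ has further singularities, so the perturbed point must also lie in `domT`,
where the regularized expansion is continuous. -/
theorem exists_lt_norm_S₂ {s t u : ℂ} (h : IsIntLeOne (s + t)) {U : Set (ℂ × ℂ × ℂ)}
    (hU : U ∈ 𝓝 (s, t, u)) (C : ℝ) : ∃ p ∈ U ∩ D₂, C < ‖S₂ p.1 p.2.1 p.2.2‖ := by
  obtain ⟨k, hk⟩ := isIntLeOne_iff.1 h
  obtain ⟨p, hpU, hp, hne, hpT⟩ :=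
    exists_mem_singleNum_ne_zero (a := -2) (by norm_num) hk (interior_mem_nhds.2 hU)
  refine exists_lt_norm_of_mul_eq (g := W₂Reg) (φ := gammaST) (dense_D₂ p)
    (differentiableOn_W₂Reg.continuousOn.continuousAt (isOpen_domT.mem_nhds hpT))
    differentiable_gammaST.continuous.continuousAt
    (gammaST_eq_zero hp) ?_ (fun q hq => ?_) (mem_interior_iff_mem_nhds.1 hpU) C
  · rw [W₂Reg, gammaST_eq_zero hp, zero_mul, zero_add, tsum_singleTermReg_eq (-2) hp]
    exact mul_ne_zero hne (gammaInvDiv_neg k)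
  · rw [W₂Reg_eq (D₂_subset_D₁ hq), S₂_eq_W₂ hq]

theorem exists_mem_add_eq_two {s t u : ℂ} (h : s + t + u = 2) {U : Set (ℂ × ℂ × ℂ)}
    (hU : U ∈ 𝓝 (s, t, u)) : ∃ p ∈ U, p.1 + p.2.1 + p.2.2 = 2 ∧ p.1 ∉ intSet ∧ p.2.1 ∉ intSet ∧
      p.2.2 ∉ intSet := by
  have c1 : ContinuousAt (fun z : ℂ => (s + z, t, u - z)) 0 := by fun_prop
  obtain ⟨z, hz, hzS⟩ := exists_mem_notMem_of_countable
    (V := {z | (s + z, t, u - z) ∈ interior U}) (c1 (isOpen_interior.mem_nhds (by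
      simpa using mem_interior_iff_mem_nhds.2 hU)))
    (countable_preimage_intSet (add_right_injective s))
  have c2 : ContinuousAt (fun w : ℂ => (s + z, t + w, u - z - w)) 0 := by fun_prop
  obtain ⟨w, hw, hwS⟩ := exists_mem_notMem_of_countable
    (V := {w | (s + z, t + w, u - z - w) ∈ interior U}) (c2 (isOpen_interior.mem_nhds (by
      simpa using hz)))
    ((countable_preimage_intSet (add_right_injective t)).union
      (countable_preimage_intSet (sub_right_injective (b := u - z))))
  simp only [mem_union, not_or, mem_preimage] at hwS
  exact ⟨_, interior_subset hw, by linear_combination h, hzS, hwS.1, hwS.2⟩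

theorem exists_lt_norm_S₂_of_add_eq_two {s t u : ℂ} (h : s + t + u = 2) {U : Set (ℂ × ℂ × ℂ)}
    (hU : U ∈ 𝓝 (s, t, u)) (C : ℝ) : ∃ p ∈ U ∩ D₂, C < ‖S₂ p.1 p.2.1 p.2.2‖ := by
  obtain ⟨⟨s', t', u'⟩, hpU, hp, hs, ht, hu⟩ := exists_mem_add_eq_two h (interior_mem_nhds.2 hU)
  -- On s + t + u = 2 each pair sum is 2 minus the third variable, so nonintegral coordinates keep
  -- the point off all the other singular hyperplanes.
  have hnotInt : ∀ x y : ℂ, x ∉ intSet → y + x = 2 → ¬ IsIntLeOne y := by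
    rintro x y hx hxy ⟨n, -, rfl⟩
    exact hx ⟨2 - n, by push_cast; linear_combination -hxy⟩
  have hD₃ : (s', t', u') ∈ D₃ :=
    ⟨hnotInt s' _ hs (by linear_combination hp), hnotInt t' _ ht (by linear_combination hp)⟩
  have hD₁ : (s', t', u') ∈ D₁ := hnotInt u' _ hu (by linear_combination hp)
  have c1 : ContinuousAt (fun p : ℂ × ℂ × ℂ => p.1 + p.2.1 + p.2.2 - 2) (s', t', u') := by
    fun_prop
  have c2 := (differentiableOn_W₂Core.continuousOn.continuousAt (isOpen_D₃.mem_nhds hD₃)).add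
    ((differentiableOn_tsum_singleTerm norm_neg_two).continuousOn.continuousAt
      (isOpen_D₁.mem_nhds hD₁))
  refine exists_lt_norm_of_mul_eq (g := fun p => G p.1 p.2.1 p.2.2 *
      (2 : ℂ) ^ (2 - p.1 - p.2.1 - p.2.2) + (p.1 + p.2.1 + p.2.2 - 2) * (W₂Core p +
        ∑' n, singleTerm (-2) n p)) (φ := fun p => p.1 + p.2.1 + p.2.2 - 2) (dense_D₂ (s', t', u'))
    (differentiable_G_mul_two_cpow.continuous.continuousAt.add (c1.mul c2)) c1 ?_ ?_
    (fun q hq => ?_) (mem_interior_iff_mem_nhds.1 hpU) C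
  · simpa [sub_eq_zero] using hp
  · have hp' : s' + t' + u' - 2 = 0 := sub_eq_zero.2 hp
    simp only [hp', zero_mul, add_zero, G_eq]
    refine mul_ne_zero (mul_ne_zero (mul_ne_zero (mul_ne_zero (gNum_ne_zero _) ?_) ?_) ?_) ?_
    · exact gamma_inv_ne_zero_of_notMem hs
    · exact gamma_inv_ne_zero_of_notMem ht
    · exact gamma_inv_ne_zero_of_notMem hu
    · simp [Complex.cpow_eq_zero_iff]
  · have hq0 : q.1 + q.2.1 + q.2.2 - 2 ≠ 0 := sub_ne_zero.2 hq.2.2.2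
    rw [S₂_eq_W₂ hq, W₂, W₂Main_eq]
    field_simp
    ring

theorem singularOff_S₁ : SingularOff D₁ S₁ := by
  rintro ⟨s, t, u⟩ hp U hU C
  obtain ⟨⟨s', t', u'⟩, hq, hC⟩ := exists_lt_norm_S₁ (not_not.1 hp) hU C
  exact ⟨s', t', u', hq, hC⟩

/-- S₂ and D₂ are invariant under cyclic rotation, which reduces the hyperplanes in t + u and u + s
to those in s + t. -/
theorem singularOff_S₂ : SingularOff D₂ S₂ := by
  rintro ⟨s, t, u⟩ hp U hU C
  by_cases h1 : IsIntLeOne (s + t)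
  · obtain ⟨⟨s', t', u'⟩, hq, hC⟩ := exists_lt_norm_S₂ h1 hU C
    exact ⟨s', t', u', hq, hC⟩
  by_cases h2 : IsIntLeOne (t + u)
  · obtain ⟨⟨t', u', s'⟩, hq, hC⟩ := exists_lt_norm_S₂ (u := s) h2
      (differentiable_rotate'.continuous.continuousAt.preimage_mem_nhds
        (x := (t, u, s)) hU) C
    exact ⟨s', t', u', ⟨hq.1, rotate_mem_D₂ (rotate_mem_D₂ hq.2)⟩, by rwa [← S₂_rotate]⟩
  by_cases h3 : IsIntLeOne (u + s)
  · obtain ⟨⟨u', s', t'⟩, hq, hC⟩ := exists_lt_norm_S₂ (u := t) h3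
      (differentiable_rotate.continuous.continuousAt.preimage_mem_nhds
        (x := (u, s, t)) hU) C
    exact ⟨s', t', u', ⟨hq.1, rotate_mem_D₂ hq.2⟩, by rwa [S₂_rotate]⟩
  by_cases h4 : s + t + u = 2
  · obtain ⟨⟨s', t', u'⟩, hq, hC⟩ := exists_lt_norm_S₂_of_add_eq_two h4 hU C
    exact ⟨s', t', u', hq, hC⟩
  exact absurd ⟨h1, h2, h3, h4⟩ hp

/-! ### The series in the expansions -/

/-- On `D`, the series with general term `a`, multiplied by `G`, converges rapidly and has the
sum `f`. -/
structure IsExpansion {ι : Type} (D : Set (ℂ × ℂ × ℂ)) (deg : ι → ℕ) (a : ℂ → ℂ → ℂ → ι → ℂ)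
    (f : ℂ × ℂ × ℂ → ℂ) : Prop where
  rapidOn : RapidOn D deg a
  sumG_eq : ∀ s t u, (s, t, u) ∈ D → sumG a s t u = f (s, t, u)
  mul_tsum_eq : ∀ s t u, (s, t, u) ∈ D → (s, t, u) ∈ regularPoints →
    G s t u * ∑' i, a s t u i = f (s, t, u)

theorem RapidFamily.isExpansion {ι : Type} {D : Set (ℂ × ℂ × ℂ)} {deg : ι → ℕ}
    {h : ι → ℂ × ℂ × ℂ → ℂ} {a : ℂ → ℂ → ℂ → ι → ℂ} (hh : RapidFamily D deg h) (hD : IsOpen D)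
    (hdeg : Summable fun i => (3 / 4 : ℝ) ^ deg i)
    (ha : ∀ i s t u, (s, t, u) ∈ regularPoints → G s t u * a s t u i = h i (s, t, u)) :
    IsExpansion D deg a fun p => ∑' i, h i p where
  rapidOn := hh.rapidOn hD hdeg fun i s t u _ => ha i s t u
  sumG_eq _ _ _ hp := hh.sumG_eq hD (fun i s t u _ => ha i s t u) hp
  mul_tsum_eq _ _ _ hp hr := G_mul_tsum_eq (D := D) (fun i s t u _ => ha i s t u) hp hr

theorem G_swap (s t u : ℂ) : G t s u = G s t u := by
  rw [G_eq, G_eq, gNum_swap₁₂]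
  ring

theorem G_rotate (s t u : ℂ) : G u s t = G s t u := by
  rw [G_eq, G_eq, gNum_rotate]
  ring

theorem swap_mem_regularPoints {s t u : ℂ} (h : (s, t, u) ∈ regularPoints) :
    (t, s, u) ∈ regularPoints := fun n => ⟨(h n).2.1, (h n).1, (h n).2.2⟩

theorem rotate_mem_regularPoints {s t u : ℂ} (h : (s, t, u) ∈ regularPoints) :
    (u, s, t) ∈ regularPoints := fun n => ⟨(h n).2.2, (h n).1, (h n).2.1⟩

section

variable {a b c : ℂ} {D : Set (ℂ × ℂ × ℂ)}

theorem isExpansion_triple (ha : ‖a‖ = 2) (hb : ‖b‖ = 2) (hc : ‖c‖ = 2) (hD : IsOpen D) :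
    IsExpansion D deg₃ (fun s t u => triple (eta a) (eta b) (eta c) s t u)
      fun p => ∑' i, tripleTerm a b c i p :=
  ((rapidFamily_tripleTerm ha hb hc).mono (subset_univ D)).isExpansion hD summable_pow_deg₃
    fun i _ _ _ hr => G_mul_triple a b c i hr

theorem isExpansion_double (ha : ‖a‖ = 2) (hb : ‖b‖ = 2) (hD : IsOpen D) :
    IsExpansion D deg₂ (fun s t u => double (eta a) (eta b) s t u)
      fun p => ∑' i, doubleTerm a b i p :=
  ((rapidFamily_doubleTerm ha hb).mono (subset_univ D)).isExpansion hD summable_pow_deg₂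
    fun i _ _ _ hr => G_mul_double a b i hr

theorem isExpansion_double_swap (ha : ‖a‖ = 2) (hb : ‖b‖ = 2) (hD : IsOpen D) :
    IsExpansion D deg₂ (fun s t u => double (eta a) (eta b) t s u)
      fun p => ∑' i, doubleTerm a b i (p.2.1, p.1, p.2.2) :=
  ((rapidFamily_doubleTerm ha hb).comp differentiable_swap fun _ _ => mem_univ _).isExpansion hD
    summable_pow_deg₂ fun i s t u hr => by
      rw [← G_swap]
      exact G_mul_double a b i (swap_mem_regularPoints hr)

theorem isExpansion_double_rotate (ha : ‖a‖ = 2) (hb : ‖b‖ = 2) (hD : IsOpen D) :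
    IsExpansion D deg₂ (fun s t u => double (eta a) (eta b) t u s)
      fun p => ∑' i, doubleTerm a b i (p.2.1, p.2.2, p.1) :=
  ((rapidFamily_doubleTerm ha hb).comp differentiable_rotate fun _ _ => mem_univ _).isExpansion hD
    summable_pow_deg₂ fun i s t u hr => by
      rw [G_rotate t u s]
      exact G_mul_double a b i (rotate_mem_regularPoints (rotate_mem_regularPoints hr))

theorem isExpansion_double_rotate' (ha : ‖a‖ = 2) (hb : ‖b‖ = 2) (hD : IsOpen D) :
    IsExpansion D deg₂ (fun s t u => double (eta a) (eta b) u s t)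
      fun p => ∑' i, doubleTerm a b i (p.2.2, p.1, p.2.1) :=
  ((rapidFamily_doubleTerm ha hb).comp differentiable_rotate' fun _ _ => mem_univ _).isExpansion hD
    summable_pow_deg₂ fun i s t u hr => by
      rw [← G_rotate]
      exact G_mul_double a b i (rotate_mem_regularPoints hr)

theorem isExpansion_single (ha : ‖a‖ = 2) (hD : IsOpen D) (hD₁ : D ⊆ D₁) :
    IsExpansion D id (fun s t u => single (eta a) s t u) fun p => ∑' n, singleTerm a n p :=
  ((rapidFamily_singleTerm ha).mono hD₁).isExpansion hD summable_pow_id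
    fun n _ _ _ hr => G_mul_single a n hr

theorem isExpansion_single_rotate (ha : ‖a‖ = 2) :
    IsExpansion D₂ id (fun s t u => single (eta a) t u s)
      fun p => ∑' n, singleTerm a n (p.2.1, p.2.2, p.1) :=
  ((rapidFamily_singleTerm ha).comp differentiable_rotate fun _ hp =>
      D₂_subset_D₁ (rotate_mem_D₂ hp)).isExpansion isOpen_D₂
    summable_pow_id fun n s t u hr => by
      rw [G_rotate t u s]
      exact G_mul_single a n (rotate_mem_regularPoints (rotate_mem_regularPoints hr))

theorem isExpansion_single_rotate' (ha : ‖a‖ = 2) :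
    IsExpansion D₂ id (fun s t u => single (eta a) u s t)
      fun p => ∑' n, singleTerm a n (p.2.2, p.1, p.2.1) :=
  ((rapidFamily_singleTerm ha).comp differentiable_rotate' fun _ hp =>
      D₂_subset_D₁ (rotate_mem_D₂ (rotate_mem_D₂ hp))).isExpansion isOpen_D₂
    summable_pow_id fun n s t u hr => by
      rw [← G_rotate]
      exact G_mul_single a n (rotate_mem_regularPoints hr)

end

theorem differentiableOn_S₁ : DifferentiableOn ℂ (fun p : ℂ × ℂ × ℂ => S₁ p.1 p.2.1 p.2.2) D₁ :=
  differentiableOn_W₁.congr fun _ hp => S₁_eq_W₁ hp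

end Tornheim

end

theorem theorem1 :
    -- the Tornheim series has its continuation `T`
    Tornheim.IsContinuation (fun (s, t, u) => Tornheim.T s t u) ∧
    -- `S₁`: domain and true singularities
    (∀ s t u, (s, t, u) ∈ Tornheim.D₂ → Tornheim.S₁ s t u = Tornheim.comb₁ s t u) ∧
    DifferentiableOn ℂ (fun (s, t, u) => Tornheim.S₁ s t u) Tornheim.D₁ ∧
    Tornheim.SingularOff Tornheim.D₁ Tornheim.S₁ ∧
    -- `S₁`: convergence of the five series
    Tornheim.RapidOn Tornheim.D₁ Tornheim.deg₃
      (fun s t u => Tornheim.triple Tornheim.etaP Tornheim.etaP Tornheim.etaM s t u) ∧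
    Tornheim.RapidOn Tornheim.D₁ id
      (fun s t u => Tornheim.single Tornheim.etaP s t u) ∧
    Tornheim.RapidOn Tornheim.D₁ Tornheim.deg₂
      (fun s t u => Tornheim.double Tornheim.etaM Tornheim.etaP s t u) ∧
    Tornheim.RapidOn Tornheim.D₁ Tornheim.deg₂
      (fun s t u => Tornheim.double Tornheim.etaM Tornheim.etaP t s u) ∧
    Tornheim.RapidOn Tornheim.D₁ Tornheim.deg₂
      (fun s t u => Tornheim.double Tornheim.etaP Tornheim.etaP u s t) ∧
    -- `S₁`: the expansion where the braces are finite
    (∀ s t u, (s, t, u) ∈ Tornheim.D₁ → (s, t, u) ∈ Tornheim.regularPoints →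
      Tornheim.S₁ s t u = Tornheim.G s t u *
        (∑' i, Tornheim.triple Tornheim.etaP Tornheim.etaP Tornheim.etaM s t u i
          + ∑' n, Tornheim.single Tornheim.etaP s t u n
          + ∑' i, Tornheim.double Tornheim.etaM Tornheim.etaP s t u i
          + ∑' i, Tornheim.double Tornheim.etaM Tornheim.etaP t s u i
          + ∑' i, Tornheim.double Tornheim.etaP Tornheim.etaP u s t i)) ∧
    -- `S₁`: the expansion on the whole domain
    (∀ s t u, (s, t, u) ∈ Tornheim.D₁ →
      Tornheim.S₁ s t u =
        Tornheim.sumG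
            (fun s t u => Tornheim.triple Tornheim.etaP Tornheim.etaP Tornheim.etaM s t u) s t u
          + Tornheim.sumG (fun s t u => Tornheim.single Tornheim.etaP s t u) s t u
          + Tornheim.sumG
            (fun s t u => Tornheim.double Tornheim.etaM Tornheim.etaP s t u) s t u
          + Tornheim.sumG
            (fun s t u => Tornheim.double Tornheim.etaM Tornheim.etaP t s u) s t u
          + Tornheim.sumG
            (fun s t u => Tornheim.double Tornheim.etaP Tornheim.etaP u s t) s t u) ∧
    -- `S₂`: domain and true singularities
    DifferentiableOn ℂ (fun (s, t, u) => Tornheim.S₂ s t u) Tornheim.D₂ ∧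
    Tornheim.SingularOff Tornheim.D₂ Tornheim.S₂ ∧
    -- `S₂`: convergence of the seven series
    Tornheim.RapidOn Tornheim.D₂ Tornheim.deg₃
      (fun s t u => Tornheim.triple Tornheim.etaP Tornheim.etaP Tornheim.etaP s t u) ∧
    Tornheim.RapidOn Tornheim.D₂ Tornheim.deg₂
      (fun s t u => Tornheim.double Tornheim.etaM Tornheim.etaM u s t) ∧
    Tornheim.RapidOn Tornheim.D₂ Tornheim.deg₂
      (fun s t u => Tornheim.double Tornheim.etaM Tornheim.etaM s t u) ∧
    Tornheim.RapidOn Tornheim.D₂ Tornheim.deg₂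
      (fun s t u => Tornheim.double Tornheim.etaM Tornheim.etaM t u s) ∧
    Tornheim.RapidOn Tornheim.D₂ id
      (fun s t u => Tornheim.single Tornheim.etaM t u s) ∧
    Tornheim.RapidOn Tornheim.D₂ id
      (fun s t u => Tornheim.single Tornheim.etaM u s t) ∧
    Tornheim.RapidOn Tornheim.D₂ id
      (fun s t u => Tornheim.single Tornheim.etaM s t u) ∧
    -- `S₂`: the expansion where the braces are finite
    (∀ s t u, (s, t, u) ∈ Tornheim.D₂ → (s, t, u) ∈ Tornheim.regularPoints →
      Tornheim.S₂ s t u = Tornheim.G s t u *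
        ((2 : ℂ) ^ (2 - s - t - u) / (s + t + u - 2)
          + ∑' i, Tornheim.triple Tornheim.etaP Tornheim.etaP Tornheim.etaP s t u i
          + ∑' i, Tornheim.double Tornheim.etaM Tornheim.etaM u s t i
          + ∑' i, Tornheim.double Tornheim.etaM Tornheim.etaM s t u i
          + ∑' i, Tornheim.double Tornheim.etaM Tornheim.etaM t u s i
          + ∑' l, Tornheim.single Tornheim.etaM t u s l
          + ∑' m, Tornheim.single Tornheim.etaM u s t m
          + ∑' n, Tornheim.single Tornheim.etaM s t u n)) ∧
    -- `S₂`: the expansion on the whole domain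
    (∀ s t u, (s, t, u) ∈ Tornheim.D₂ →
      Tornheim.S₂ s t u =
        Tornheim.G s t u * ((2 : ℂ) ^ (2 - s - t - u) / (s + t + u - 2))
          + Tornheim.sumG
            (fun s t u => Tornheim.triple Tornheim.etaP Tornheim.etaP Tornheim.etaP s t u) s t u
          + Tornheim.sumG
            (fun s t u => Tornheim.double Tornheim.etaM Tornheim.etaM u s t) s t u
          + Tornheim.sumG
            (fun s t u => Tornheim.double Tornheim.etaM Tornheim.etaM s t u) s t u
          + Tornheim.sumG
            (fun s t u => Tornheim.double Tornheim.etaM Tornheim.etaM t u s) s t u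
          + Tornheim.sumG (fun s t u => Tornheim.single Tornheim.etaM t u s) s t u
          + Tornheim.sumG (fun s t u => Tornheim.single Tornheim.etaM u s t) s t u
          + Tornheim.sumG (fun s t u => Tornheim.single Tornheim.etaM s t u) s t u) := by
  have x1 := Tornheim.isExpansion_triple Tornheim.norm_two Tornheim.norm_two Tornheim.norm_neg_two
    Tornheim.isOpen_D₁
  have x2 := Tornheim.isExpansion_single Tornheim.norm_two Tornheim.isOpen_D₁ subset_rfl
  have x3 := Tornheim.isExpansion_double Tornheim.norm_neg_two Tornheim.norm_two Tornheim.isOpen_D₁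
  have x4 := Tornheim.isExpansion_double_swap Tornheim.norm_neg_two Tornheim.norm_two
    Tornheim.isOpen_D₁
  have x5 := Tornheim.isExpansion_double_rotate' Tornheim.norm_two Tornheim.norm_two
    Tornheim.isOpen_D₁
  have y1 := Tornheim.isExpansion_triple Tornheim.norm_two Tornheim.norm_two Tornheim.norm_two
    Tornheim.isOpen_D₂
  have y2 := Tornheim.isExpansion_double_rotate' Tornheim.norm_neg_two Tornheim.norm_neg_two
    Tornheim.isOpen_D₂
  have y3 := Tornheim.isExpansion_double Tornheim.norm_neg_two Tornheim.norm_neg_two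
    Tornheim.isOpen_D₂
  have y4 := Tornheim.isExpansion_double_rotate Tornheim.norm_neg_two Tornheim.norm_neg_two
    Tornheim.isOpen_D₂
  have y5 := Tornheim.isExpansion_single_rotate Tornheim.norm_neg_two
  have y6 := Tornheim.isExpansion_single_rotate' Tornheim.norm_neg_two
  have y7 := Tornheim.isExpansion_single Tornheim.norm_neg_two Tornheim.isOpen_D₂
    Tornheim.D₂_subset_D₁
  have hP : Tornheim.etaP = Tornheim.eta 2 := rfl
  have hM : Tornheim.etaM = Tornheim.eta (-2) := rfl
  rw [hP, hM]
  refine ⟨Tornheim.isContinuation_T, fun s t u h => ?_, Tornheim.differentiableOn_S₁,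
    Tornheim.singularOff_S₁, x1.rapidOn, x2.rapidOn, x3.rapidOn, x4.rapidOn, x5.rapidOn,
    fun s t u h hr => ?_, fun s t u h => ?_, Tornheim.differentiableOn_S₂,
    Tornheim.singularOff_S₂, y1.rapidOn, y2.rapidOn, y3.rapidOn, y4.rapidOn, y5.rapidOn,
    y6.rapidOn, y7.rapidOn, fun s t u h hr => ?_, fun s t u h => ?_⟩
  · rw [Tornheim.S₁_eq_W₁ (Tornheim.D₂_subset_D₁ h), Tornheim.comb₁_eq_W₁ h]
  · simp only [mul_add]
    rw [x1.mul_tsum_eq s t u h hr, x2.mul_tsum_eq s t u h hr, x3.mul_tsum_eq s t u h hr,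
      x4.mul_tsum_eq s t u h hr, x5.mul_tsum_eq s t u h hr, Tornheim.S₁_eq_W₁ h, Tornheim.W₁]
  · rw [x1.sumG_eq s t u h, x2.sumG_eq s t u h, x3.sumG_eq s t u h, x4.sumG_eq s t u h,
      x5.sumG_eq s t u h, Tornheim.S₁_eq_W₁ h, Tornheim.W₁]
  · simp only [mul_add]
    rw [y1.mul_tsum_eq s t u h hr, y2.mul_tsum_eq s t u h hr, y3.mul_tsum_eq s t u h hr,
      y4.mul_tsum_eq s t u h hr, y5.mul_tsum_eq s t u h hr, y6.mul_tsum_eq s t u h hr,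
      y7.mul_tsum_eq s t u h hr, Tornheim.S₂_eq_W₂ h, Tornheim.W₂, Tornheim.W₂Main]
  · rw [y1.sumG_eq s t u h, y2.sumG_eq s t u h, y3.sumG_eq s t u h, y4.sumG_eq s t u h,
      y5.sumG_eq s t u h, y6.sumG_eq s t u h, y7.sumG_eq s t u h, Tornheim.S₂_eq_W₂ h,
      Tornheim.W₂, Tornheim.W₂Main]
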